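/- Fix a relational schema with at least one relation (each relation has a finite list of distinct attribute names) and a non-empty, linearly ordered domain $D$. A database assigns to every relation name a finite set of tuples over $D$ (no nulls). An $n$-ary query is a function from databases to sets of $n$-tuples; two query expressions are equivalent if they define the same function, and two languages have the same expressiveness for $n$-ary queries if each $n$-ary expression of one is equivalent to an expression of the other. Comparison operators $\theta$ range over $=,\neq,<,\le,>,\ge$. Consider the following four non-disjunctive languages. * $\mathrm{Datalog}^*$: non-recursive Datalog with negated subgoals and built-in subgoals $x\,\theta\,y$, $x\,\theta\,v$ ($v\in D$), in which every IDB predicate is the head of exactly one rule and is used at most once in the rule bodies. Rules are safe: every variable of a rule occurs in a positive relational subgoal of its body or is linked by a chain of equality subgoals to such a variable or to a constant; for the variables of the head, the chain must end in a positive relational subgoal. * $\mathrm{RA}^*$: expressions built from the relation names with $\times$, $\pi$, $-$, and selections $\sigma_c$ and joins $\bowtie_c$ whose condition $c$ is a conjunction of simple conditions $X\,\theta\,Y$ ($X$ an attribute, $Y$ an attribute or a constant), in the unnamed (positional) perspective. There is no union and no constant relation. * $\mathrm{TRC}^*$: queries $\{q(A_1,\dots,A_n)\mid\varphi\}$, where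 $\varphi$ is built with $\wedge$, $\neg$ and $\exists r\in R[\dots]$ (an empty conjunction is allowed) from predicates $r.A\,\theta\,s.B$, $r.A\,\theta\,v$ and $q.A_i=r.A$. Each output attribute has an equality predicate $q.A_i=r.A$ outside all negations (safety), and every predicate is guarded: it mentions a table variable that is quantified inside the same negation scope as the predicate. For $n=0$ these are logical sentences. * $\mathrm{SQL}^*$: SQL under set semantics and two-valued logic given by the grammar $Q ::=$ `SELECT [DISTINCT] (C {, C} | *) FROM R {, R} [WHERE P]`; main queries: $Q$, or a Boolean query `SELECT NOT (P)` or `SELECT [NOT] EXISTS (Q)`; $C ::=$ `[T.]A`; $R ::=$ `T [[AS] T]`; $P ::=$ `P AND P` | `C θ C` | `C θ V` | `NOT (P)` | `[NOT] EXISTS (Q)` | `C [NOT] IN (Q)` | `C θ ALL (Q)` | `C θ ANY (Q)`, where `T`, `A`, `V` are table identifiers, attribute names and constants, and where every predicate is guarded: it references a table introduced within the scope of the last negation (`NOT (…)`, `NOT EXISTS`, `NOT IN` or `ALL`); the comparison implicit in a membership or quantified subquery counts as a predicate of that subquery. Then: 1. For every $n\ge 1$, the languages $\mathrm{Datalog}^*$,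 $\mathrm{RA}^*$, $\mathrm{TRC}^*$ and $\mathrm{SQL}^*$ have the same expressiveness for $n$-ary queries. 2. For Boolean queries ($n=0$), $\mathrm{Datalog}^*$, $\mathrm{TRC}^*$ and $\mathrm{SQL}^*$ have the same expressiveness. Every Boolean query of $\mathrm{RA}^*$ is expressible in them; conversely, for every Boolean query $f$ expressible in them and every relation name $T$, there is an $\mathrm{RA}^*$ expression (of arity $0$) that agrees with $f$ on all databases in which $T$ is non-empty. -/

import Mathlib

/-! ## Schemas, databases, comparisons -/

/-- A relational schema: every relation name has a list of pairwise distinct attribute names. -/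
structure DBSchema (Rel : Type*) (Attr : Type*) where
  attrs : Rel → List Attr
  nodup : ∀ R, (attrs R).Nodup

/-- The number of attributes of a relation. -/
def DBSchema.arity {Rel Attr : Type*} (S : DBSchema Rel Attr) (R : Rel) : ℕ :=
  (S.attrs R).length

/-- A database over the domain `D`: a finite set of tuples (no nulls, no duplicates) of the right
length for every relation name. -/
structure Database {Rel Attr : Type*} (S : DBSchema Rel Attr) (D : Type*) where
  rel : Rel → Set (List D)
  length_eq : ∀ R, ∀ t ∈ rel R, t.length = S.arity R
  finite : ∀ R, (rel R).Finite

/-- The semantics of a query: a function from databases to output tables. -/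
abbrev QueryFun {Rel Attr : Type*} (S : DBSchema Rel Attr) (D : Type*) :=
  Database S D → Set (List D)

/-- The value `v` of attribute `A` in a tuple `t` of relation `R`. -/
def DBSchema.AttrVal {Rel Attr D : Type*} (S : DBSchema Rel Attr) (R : Rel) (t : List D)
    (A : Attr) (v : D) : Prop :=
  ∃ k : ℕ, (S.attrs R)[k]? = some A ∧ t[k]? = some v

/-- The comparison operators `=, ≠, <, ≤, >, ≥`. -/
inductive CmpOp
  | eq | ne | lt | le | gt | ge

def CmpOp.Holds {D : Type*} [LinearOrder D] : CmpOp → D → D → Prop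
  | .eq, x, y => x = y
  | .ne, x, y => x ≠ y
  | .lt, x, y => x < y
  | .le, x, y => x ≤ y
  | .gt, x, y => x > y
  | .ge, x, y => x ≥ y

/-! ## Relational algebra without union (unnamed perspective: attributes are column positions) -/

/-- The right-hand side of a simple condition: a column or a constant. -/
inductive RAOperand (D : Type*)
  | col (j : ℕ)
  | const (v : D)

/-- A simple condition `X θ Y`: `X` is a column, `Y` a column or a constant. -/
structure RACond (D : Type*) where
  lhs : ℕ
  op : CmpOp
  rhs : RAOperand D

/-- Expressions of the fragment: relations, `×`, `σ` and `⋈` with a conjunction (list) of simple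
conditions, `π`, and `−`. There is no union, no disjunction, and no constant relation. -/
inductive RAExpr (Rel : Type*) (D : Type*)
  | rel (R : Rel)
  | prod (E F : RAExpr Rel D)
  | sel (cs : List (RACond D)) (E : RAExpr Rel D)
  | join (cs : List (RACond D)) (E F : RAExpr Rel D)
  | proj (js : List ℕ) (E : RAExpr Rel D)
  | diff (E F : RAExpr Rel D)

/-- The condition only mentions columns `< n`. -/
def RACond.InRange {D : Type*} (c : RACond D) (n : ℕ) : Prop :=
  c.lhs < n ∧ ∀ j, c.rhs = .col j → j < n

def RACond.Holds {D : Type*} [LinearOrder D] (c : RACond D) (t : List D) : Prop :=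
  ∃ x y, t[c.lhs]? = some x ∧
    (match c.rhs with
      | .col j => t[j]? = some y
      | .const v => y = v) ∧
    c.op.Holds x y

def RAExpr.arity {Rel Attr D : Type*} (S : DBSchema Rel Attr) : RAExpr Rel D → ℕ
  | .rel R => S.arity R
  | .prod E F => E.arity S + F.arity S
  | .sel _ E => E.arity S
  | .join _ E F => E.arity S + F.arity S
  | .proj js _ => js.length
  | .diff E _ => E.arity S

/-- Well-formed expressions: columns exist, and the arguments of a difference are compatible. -/
def RAExpr.WF {Rel Attr D : Type*} (S : DBSchema Rel Attr) : RAExpr Rel D → Prop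
  | .rel _ => True
  | .prod E F => E.WF S ∧ F.WF S
  | .sel cs E => E.WF S ∧ ∀ c ∈ cs, c.InRange (E.arity S)
  | .join cs E F => E.WF S ∧ F.WF S ∧ ∀ c ∈ cs, c.InRange (E.arity S + F.arity S)
  | .proj js E => E.WF S ∧ ∀ j ∈ js, j < E.arity S
  | .diff E F => E.WF S ∧ F.WF S ∧ E.arity S = F.arity S

def RAExpr.eval {Rel Attr D : Type*} [LinearOrder D] {S : DBSchema Rel Attr}
    (I : Database S D) : RAExpr Rel D → Set (List D)
  | .rel R => I.rel R
  | .prod E F => {u | ∃ s ∈ E.eval I, ∃ t ∈ F.eval I, u = s ++ t}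
  | .sel cs E => {u | u ∈ E.eval I ∧ ∀ c ∈ cs, c.Holds u}
  | .join cs E F => {u | (∃ s ∈ E.eval I, ∃ t ∈ F.eval I, u = s ++ t) ∧ ∀ c ∈ cs, c.Holds u}
  | .proj js E => {u | ∃ t ∈ E.eval I, List.Forall₂ (fun j v => t[j]? = some v) js u}
  | .diff E F => {u | u ∈ E.eval I ∧ u ∉ F.eval I}

/-- The `n`-ary queries expressible in the fragment of relational algebra. -/
def raQueries {Rel Attr : Type*} (S : DBSchema Rel Attr) (D : Type*) [LinearOrder D] (n : ℕ) :
    Set (QueryFun S D) :=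
  {f | ∃ E : RAExpr Rel D, E.WF S ∧ E.arity S = n ∧ ∀ I, E.eval I = f I}

/-! ## Non-recursive Datalog with negation and built-in predicates -/

/-- Terms: variables (numbered) and constants. -/
inductive DLTerm (D : Type*)
  | var (x : ℕ)
  | const (v : D)

/-- An atom; its predicate symbol is a relation name (EDB) or a numbered IDB symbol. -/
structure DLAtom (Rel : Type*) (D : Type*) where
  pred : Rel ⊕ ℕ
  args : List (DLTerm D)

/-- Subgoals: positive atoms, negated atoms, and built-in predicates `x θ y` or `x θ v`. -/
inductive DLSubgoal (Rel : Type*) (D : Type*)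
  | pos (a : DLAtom Rel D)
  | neg (a : DLAtom Rel D)
  | builtin (x : ℕ) (op : CmpOp) (t : DLTerm D)

/-- A rule `head(args) :- body`. -/
structure DLRule (Rel : Type*) (D : Type*) where
  head : ℕ
  args : List ℕ
  body : List (DLSubgoal Rel D)

/-- The relational atom of a subgoal, if any. -/
def DLSubgoal.atom? {Rel D : Type*} : DLSubgoal Rel D → Option (DLAtom Rel D)
  | .pos a => some a
  | .neg a => some a
  | .builtin _ _ _ => none

/-- The IDB symbol used by a subgoal, if any. -/
def DLSubgoal.idb? {Rel D : Type*} (l : DLSubgoal Rel D) : Option ℕ :=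
  l.atom?.bind fun a => a.pred.getRight?

/-- The variable `x` occurs in the subgoal. -/
def DLSubgoal.Mentions {Rel D : Type*} (x : ℕ) : DLSubgoal Rel D → Prop
  | .pos a => DLTerm.var x ∈ a.args
  | .neg a => DLTerm.var x ∈ a.args
  | .builtin y _ t => x = y ∨ t = .var x

/-- Limited variables: those in a positive relational subgoal, those reached from limited ones by
equalities, and, if `allowConst` holds, those equated with a constant. -/
inductive DLRule.Limited {Rel D : Type*} (r : DLRule Rel D) (allowConst : Prop) : ℕ → Prop
  | atom {a : DLAtom Rel D} {x : ℕ} (h : DLSubgoal.pos a ∈ r.body) (hx : DLTerm.var x ∈ a.args) :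
      r.Limited allowConst x
  | eqLeft {x y : ℕ} (h : DLSubgoal.builtin x .eq (.var y) ∈ r.body)
      (hy : r.Limited allowConst y) : r.Limited allowConst x
  | eqRight {x y : ℕ} (h : DLSubgoal.builtin x .eq (.var y) ∈ r.body)
      (hx : r.Limited allowConst x) : r.Limited allowConst y
  | eqConst {x : ℕ} {v : D} (hc : allowConst)
      (h : DLSubgoal.builtin x .eq (.const v) ∈ r.body) : r.Limited allowConst x

/-- Safety: every variable of the rule is limited, and only values taken from positive relational
subgoals are returned by the head. -/
def DLRule.Safe {Rel D : Type*} (r : DLRule Rel D) : Prop :=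
  (∀ x ∈ r.args, r.Limited False x) ∧ ∀ l ∈ r.body, ∀ x, l.Mentions x → r.Limited True x

/-- A program together with its answer predicate. Being non-recursive, its rules can be sorted
topologically; they are listed in such an order (see `DLProgram.WF`). -/
structure DLProgram (Rel : Type*) (D : Type*) where
  rules : List (DLRule Rel D)
  goal : ℕ

/-- Membership in the non-disjunctive fragment, with an answer predicate of arity `n`. -/
structure DLProgram.WF {Rel Attr D : Type*} (S : DBSchema Rel Attr) (P : DLProgram Rel D)
    (n : ℕ) : Prop where
  safe : ∀ r ∈ P.rules, r.Safe
  /-- EDB atoms have the right number of arguments. -/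
  edb_arity : ∀ r ∈ P.rules, ∀ l ∈ r.body, ∀ a, l.atom? = some a →
    ∀ R, a.pred = .inl R → a.args.length = S.arity R
  /-- Non-recursive: an IDB used in a body is defined by an earlier rule, with the same arity. -/
  topological : ∀ before r after, P.rules = before ++ r :: after →
    ∀ l ∈ r.body, ∀ a, l.atom? = some a → ∀ p, a.pred = .inr p →
      ∃ r' ∈ before, r'.head = p ∧ r'.args.length = a.args.length
  /-- No IDB is the head of two rules. -/
  head_once : (P.rules.map DLRule.head).Nodup
  /-- Every IDB is used at most once in all the bodies together. -/
  used_once : (P.rules.flatMap fun r => r.body.filterMap DLSubgoal.idb?).Nodup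
  goal_def : ∃ r ∈ P.rules, r.head = P.goal ∧ r.args.length = n

def DLTerm.val {D : Type*} (ν : ℕ → D) : DLTerm D → D
  | .var x => ν x
  | .const v => v

/-- The atom is true under the valuation `ν`, where `J` interprets the IDB symbols. -/
def DLAtom.Holds {Rel Attr D : Type*} {S : DBSchema Rel Attr} (I : Database S D)
    (J : ℕ → Set (List D)) (ν : ℕ → D) (a : DLAtom Rel D) : Prop :=
  match a.pred with
  | .inl R => a.args.map (DLTerm.val ν) ∈ I.rel R
  | .inr p => a.args.map (DLTerm.val ν) ∈ J p

def DLSubgoal.Holds {Rel Attr D : Type*} [LinearOrder D] {S : DBSchema Rel Attr}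
    (I : Database S D) (J : ℕ → Set (List D)) (ν : ℕ → D) : DLSubgoal Rel D → Prop
  | .pos a => a.Holds I J ν
  | .neg a => ¬ a.Holds I J ν
  | .builtin x op t => op.Holds (ν x) (t.val ν)

/-- The relation that a rule computes for its head. -/
def DLRule.eval {Rel Attr D : Type*} [LinearOrder D] {S : DBSchema Rel Attr}
    (I : Database S D) (J : ℕ → Set (List D)) (r : DLRule Rel D) : Set (List D) :=
  {u | ∃ ν : ℕ → D, (∀ l ∈ r.body, l.Holds I J ν) ∧ u = r.args.map ν}

/-- Bottom-up evaluation, rule by rule in the listed topological order. -/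
def DLProgram.eval {Rel Attr D : Type*} [LinearOrder D] {S : DBSchema Rel Attr}
    (P : DLProgram Rel D) (I : Database S D) : Set (List D) :=
  P.rules.foldl (fun J r => Function.update J r.head (r.eval I J)) (fun _ => ∅) P.goal

/-- The `n`-ary queries expressible in the fragment of Datalog. -/
def datalogQueries {Rel Attr : Type*} (S : DBSchema Rel Attr) (D : Type*) [LinearOrder D]
    (n : ℕ) : Set (QueryFun S D) :=
  {f | ∃ P : DLProgram Rel D, P.WF S n ∧ ∀ I, P.eval I = f I}

/-! ## Safe tuple relational calculus -/

/-- Formulas of the fragment over numbered table variables. `out i r A` is the output predicate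
`q.Aᵢ = r.A`, where `q` is the result table; `top` is the empty conjunction, as in `∃ r ∈ R []`. -/
inductive TRCFormula (Rel : Type*) (Attr : Type*) (D : Type*)
  | top
  | joinPred (r : ℕ) (A : Attr) (op : CmpOp) (s : ℕ) (B : Attr)
  | selPred (r : ℕ) (A : Attr) (op : CmpOp) (v : D)
  | out (i : ℕ) (r : ℕ) (A : Attr)
  | and (φ ψ : TRCFormula Rel Attr D)
  | ex (r : ℕ) (R : Rel) (φ : TRCFormula Rel Attr D)
  | not (φ : TRCFormula Rel Attr D)

/-- Well-formedness: every referenced table variable is bound (`Γ` records to which relation) and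
has the attribute, and there are `n` output attributes. -/
def TRCFormula.WF {Rel Attr D : Type*} (S : DBSchema Rel Attr) (n : ℕ) :
    (ℕ → Option Rel) → TRCFormula Rel Attr D → Prop
  | _, .top => True
  | Γ, .joinPred r A _ s B =>
      (∃ R, Γ r = some R ∧ A ∈ S.attrs R) ∧ ∃ R, Γ s = some R ∧ B ∈ S.attrs R
  | Γ, .selPred r A _ _ => ∃ R, Γ r = some R ∧ A ∈ S.attrs R
  | Γ, .out i r A => i < n ∧ ∃ R, Γ r = some R ∧ A ∈ S.attrs R
  | Γ, .and φ ψ => φ.WF S n Γ ∧ ψ.WF S n Γ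
  | Γ, .ex r R φ => φ.WF S n (Function.update Γ r (some R))
  | Γ, .not φ => φ.WF S n Γ

/-- Every predicate is guarded: it refers to a table variable that is quantified inside the same
negation scope. `L` is the set of table variables quantified in the current negation scope. -/
def TRCFormula.Guarded {Rel Attr D : Type*} : Set ℕ → TRCFormula Rel Attr D → Prop
  | _, .top => True
  | L, .joinPred r _ _ s _ => r ∈ L ∨ s ∈ L
  | L, .selPred r _ _ _ => r ∈ L
  | L, .out _ r _ => r ∈ L
  | L, .and φ ψ => φ.Guarded L ∧ ψ.Guarded L
  | L, .ex r _ φ => φ.Guarded (insert r L)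
  | _, .not φ => φ.Guarded ∅

/-- There is an equality predicate for the output attribute `i` outside all negations. -/
def TRCFormula.Outputs {Rel Attr D : Type*} (i : ℕ) : TRCFormula Rel Attr D → Prop
  | .out j _ _ => i = j
  | .and φ ψ => φ.Outputs i ∨ ψ.Outputs i
  | .ex _ _ φ => φ.Outputs i
  | _ => False

/-- The attribute `r.A` has value `v` in the environment `η`. -/
def trcVal {Rel Attr D : Type*} (S : DBSchema Rel Attr) (η : ℕ → Option (Rel × List D))
    (r : ℕ) (A : Attr) (v : D) : Prop :=
  ∃ R t, η r = some (R, t) ∧ S.AttrVal R t A v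

/-- Satisfaction; `q` is the tuple of the result table. -/
def TRCFormula.Sat {Rel Attr D : Type*} [LinearOrder D] {S : DBSchema Rel Attr}
    (I : Database S D) (q : List D) : (ℕ → Option (Rel × List D)) → TRCFormula Rel Attr D → Prop
  | _, .top => True
  | η, .joinPred r A op s B => ∃ x y, trcVal S η r A x ∧ trcVal S η s B y ∧ op.Holds x y
  | η, .selPred r A op v => ∃ x, trcVal S η r A x ∧ op.Holds x v
  | η, .out i r A => ∃ x, q[i]? = some x ∧ trcVal S η r A x
  | η, .and φ ψ => φ.Sat I q η ∧ ψ.Sat I q η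
  | η, .ex r R φ => ∃ t ∈ I.rel R, φ.Sat I q (Function.update η r (some (R, t)))
  | η, .not φ => ¬ φ.Sat I q η

/-- The `n`-ary queries `{ q(A₁, …, Aₙ) | φ }` expressible in the fragment of safe tuple relational
calculus; for `n = 0` these are the logical sentences. -/
def trcQueries {Rel Attr : Type*} (S : DBSchema Rel Attr) (D : Type*) [LinearOrder D] (n : ℕ) :
    Set (QueryFun S D) :=
  {f | ∃ φ : TRCFormula Rel Attr D, φ.WF S n (fun _ => none) ∧ φ.Guarded ∅ ∧
    (∀ i < n, φ.Outputs i) ∧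
    ∀ I, {q : List D | q.length = n ∧ φ.Sat I q (fun _ => none)} = f I}

/-! ## SQL under set semantics and binary logic -/

/-- Table identifiers: those spelled as a relation name, and further ones usable as aliases. -/
abbrev SQLIdent (Rel : Type*) := Rel ⊕ ℕ

/-- A column `[T.]A`. -/
structure SQLCol (Rel : Type*) (Attr : Type*) where
  tbl : Option (SQLIdent Rel)
  attr : Attr

/-- An entry `R [[AS] T]` of a `FROM` clause. -/
structure SQLFrom (Rel : Type*) where
  rel : Rel
  alias? : Option (SQLIdent Rel)

/-- The list after `SELECT`: `*` or columns. -/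
inductive SQLSelect (Rel : Type*) (Attr : Type*)
  | star
  | cols (cs : List (SQLCol Rel Attr))

universe u v w

mutual

/-- `SELECT [DISTINCT] … FROM …` without or with a `WHERE` clause. (Under set semantics,
`DISTINCT` is implicit.) -/
inductive SQLQuery (Rel : Type u) (Attr : Type v) (D : Type w)
  | select (s : SQLSelect Rel Attr) (fr : List (SQLFrom Rel))
  | selectWhere (s : SQLSelect Rel Attr) (fr : List (SQLFrom Rel)) (P : SQLPred Rel Attr D)

/-- Predicates. In `exist` and `isIn`, the flag `true` stands for the forms `NOT EXISTS (Q)` and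
`C NOT IN (Q)`. -/
inductive SQLPred (Rel : Type u) (Attr : Type v) (D : Type w)
  | and (P P' : SQLPred Rel Attr D)
  | joinPred (c : SQLCol Rel Attr) (op : CmpOp) (c' : SQLCol Rel Attr)
  | selPred (c : SQLCol Rel Attr) (op : CmpOp) (v : D)
  | not (P : SQLPred Rel Attr D)
  | exist (neg : Bool) (Q : SQLQuery Rel Attr D)
  | isIn (c : SQLCol Rel Attr) (neg : Bool) (Q : SQLQuery Rel Attr D)
  | all (c : SQLCol Rel Attr) (op : CmpOp) (Q : SQLQuery Rel Attr D)
  | any (c : SQLCol Rel Attr) (op : CmpOp) (Q : SQLQuery Rel Attr D)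

end

/-- Main queries: non-Boolean ones, `SELECT NOT (P)`, and `SELECT [NOT] EXISTS (Q)`. -/
inductive SQLMain (Rel : Type*) (Attr : Type*) (D : Type*)
  | query (Q : SQLQuery Rel Attr D)
  | notPred (P : SQLPred Rel Attr D)
  | exist (neg : Bool) (Q : SQLQuery Rel Attr D)

/-- The table occurrences introduced by one `FROM` clause, with the names they are known by. -/
abbrev SQLBlock (Rel : Type*) := List (SQLIdent Rel × Rel)

/-- An occurrence is known by its alias, or by the relation name if there is no alias. -/
def sqlBlock {Rel : Type*} (fr : List (SQLFrom Rel)) : SQLBlock Rel :=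
  fr.map fun e => (e.alias?.getD (.inl e.rel), e.rel)

def SQLQuery.sel {Rel Attr D : Type*} : SQLQuery Rel Attr D → SQLSelect Rel Attr
  | .select s _ => s
  | .selectWhere s _ _ => s

def SQLQuery.block {Rel Attr D : Type*} : SQLQuery Rel Attr D → SQLBlock Rel
  | .select _ fr => sqlBlock fr
  | .selectWhere _ fr _ => sqlBlock fr

/-- `T.A` looks for a table named `T`, and `A` for a table that has an attribute `A`. -/
def SQLCol.Matches {Rel Attr : Type*} (S : DBSchema Rel Attr) (c : SQLCol Rel Attr)
    (e : SQLIdent Rel × Rel) : Prop :=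
  match c.tbl with
  | some T => e.1 = T
  | none => c.attr ∈ S.attrs e.2

/-- Name resolution in the nested blocks `ctx` (innermost first): the column refers to the unique
matching table occurrence, number `j`, of the innermost block, number `i`, that has a match. -/
def SQLCol.Resolves {Rel Attr : Type*} (S : DBSchema Rel Attr) (ctx : List (SQLBlock Rel))
    (c : SQLCol Rel Attr) (i j : ℕ) (R : Rel) : Prop :=
  ∃ b T, ctx[i]? = some b ∧ b[j]? = some (T, R) ∧ c.Matches S (T, R) ∧ c.attr ∈ S.attrs R ∧
    (∀ j' e, b[j']? = some e → c.Matches S e → j' = j) ∧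
    ∀ i' < i, ∀ b', ctx[i']? = some b' → ∀ e ∈ b', ¬ c.Matches S e

def SQLCol.Bound {Rel Attr : Type*} (S : DBSchema Rel Attr) (ctx : List (SQLBlock Rel))
    (c : SQLCol Rel Attr) : Prop :=
  ∃ i j R, c.Resolves S ctx i j R

/-- The column belongs to one of the `g` innermost blocks. -/
def SQLCol.Local {Rel Attr : Type*} (S : DBSchema Rel Attr) (ctx : List (SQLBlock Rel)) (g : ℕ)
    (c : SQLCol Rel Attr) : Prop :=
  ∃ i j R, i < g ∧ c.Resolves S ctx i j R

/-- The number of output columns. -/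
def SQLQuery.outArity {Rel Attr D : Type*} (S : DBSchema Rel Attr) (Q : SQLQuery Rel Attr D) : ℕ :=
  match Q.sel with
  | .star => (Q.block.map fun e => S.arity e.2).sum
  | .cols cs => cs.length

/-- The output columns of `Q` belong to `Q` itself or to one of the `g` innermost blocks around. -/
def SQLQuery.OutLocal {Rel Attr D : Type*} (S : DBSchema Rel Attr) (ctx : List (SQLBlock Rel))
    (g : ℕ) (Q : SQLQuery Rel Attr D) : Prop :=
  match Q.sel with
  | .star => True
  | .cols cs => ∀ c ∈ cs, c.Local S (Q.block :: ctx) (g + 1)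

/-- The `FROM` clause is non-empty with distinct names, and the `SELECT` list is non-empty and its
columns exist. -/
def sqlHeadWF {Rel Attr : Type*} (S : DBSchema Rel Attr) (ctx : List (SQLBlock Rel))
    (s : SQLSelect Rel Attr) (fr : List (SQLFrom Rel)) : Prop :=
  fr ≠ [] ∧ ((sqlBlock fr).map Prod.fst).Nodup ∧
    match s with
    | .star => True
    | .cols cs => cs ≠ [] ∧ ∀ c ∈ cs, c.Bound S (sqlBlock fr :: ctx)

/-- The number of blocks in the current negation scope, after a possible negation. -/
def scopeAfter (neg : Bool) (g : ℕ) : ℕ :=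
  if neg then 0 else g

mutual

/-- Well-formed queries with guarded predicates. `ctx` lists the enclosing blocks, innermost first;
the first `g` of them lie in the current negation scope. -/
def SQLQuery.WF {Rel : Type u} {Attr : Type v} {D : Type w} (S : DBSchema Rel Attr) :
    List (SQLBlock Rel) → ℕ → SQLQuery Rel Attr D → Prop
  | ctx, _, .select s fr => sqlHeadWF S ctx s fr
  | ctx, g, .selectWhere s fr P => sqlHeadWF S ctx s fr ∧ P.WF S (sqlBlock fr :: ctx) (g + 1)

/-- A new negation scope is opened by `NOT`, `NOT EXISTS`, `NOT IN` and `ALL` (which says that no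
value of the subquery violates the comparison). The comparison implicit in a membership or
quantified subquery counts as a predicate of that subquery. -/
def SQLPred.WF {Rel : Type u} {Attr : Type v} {D : Type w} (S : DBSchema Rel Attr) :
    List (SQLBlock Rel) → ℕ → SQLPred Rel Attr D → Prop
  | ctx, g, .and P P' => P.WF S ctx g ∧ P'.WF S ctx g
  | ctx, g, .joinPred c _ c' =>
      c.Bound S ctx ∧ c'.Bound S ctx ∧ (c.Local S ctx g ∨ c'.Local S ctx g)
  | ctx, g, .selPred c _ _ => c.Local S ctx g
  | ctx, _, .not P => P.WF S ctx 0
  | ctx, g, .exist neg Q => Q.WF S ctx (scopeAfter neg g)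
  | ctx, g, .isIn c neg Q =>
      c.Bound S ctx ∧ Q.WF S ctx (scopeAfter neg g) ∧ Q.outArity S = 1 ∧
        (c.Local S ctx (scopeAfter neg g) ∨ Q.OutLocal S ctx (scopeAfter neg g))
  | ctx, _, .all c _ Q =>
      c.Bound S ctx ∧ Q.WF S ctx 0 ∧ Q.outArity S = 1 ∧ Q.OutLocal S ctx 0
  | ctx, g, .any c _ Q =>
      c.Bound S ctx ∧ Q.WF S ctx g ∧ Q.outArity S = 1 ∧ (c.Local S ctx g ∨ Q.OutLocal S ctx g)

end

/-- The value `v` of a column; `env` holds the current rows of the blocks in `ctx`. -/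
def SQLCol.Val {Rel : Type u} {Attr : Type v} {D : Type w}
    (S : DBSchema Rel Attr) (ctx : List (SQLBlock Rel))
    (env : List (List (List D))) (c : SQLCol Rel Attr) (v : D) : Prop :=
  ∃ (i j : ℕ) (R : Rel) (rows : List (List D)) (t : List D),
    c.Resolves S ctx i j R ∧ env[i]? = some rows ∧ rows[j]? = some t ∧
    S.AttrVal R t c.attr v

/-- `rows` is a choice of one row for each table occurrence in the block. -/
def SQLBlock.Rows {Rel : Type u} {Attr : Type v} {D : Type w} {S : DBSchema Rel Attr} (I : Database S D)
    (b : SQLBlock Rel) (rows : List (List D)) : Prop :=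
  List.Forall₂ (fun e t => t ∈ I.rel e.2) b rows

/-- The tuple `u` returned for the rows in `env`, the innermost ones being those of the query. -/
def SQLSelect.Returns {Rel : Type u} {Attr : Type v} {D : Type w}
    (S : DBSchema Rel Attr) (ctx : List (SQLBlock Rel))
    (env : List (List (List D))) (s : SQLSelect Rel Attr) (u : List D) : Prop :=
  match s with
  | .star => ∃ rows, env[0]? = some rows ∧ u = rows.flatten
  | .cols cs => List.Forall₂ (fun c v => c.Val S ctx env v) cs u

mutual

/-- `u` is a row of the result of `Q`. -/
def SQLQuery.Yields {Rel : Type u} {Attr : Type v} {D : Type w} [LinearOrder D]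
    {S : DBSchema Rel Attr} (I : Database S D) :
    List (SQLBlock Rel) → List (List (List D)) → SQLQuery Rel Attr D → List D → Prop
  | ctx, env, .select s fr, u =>
      ∃ rows, (sqlBlock fr).Rows I rows ∧ s.Returns S (sqlBlock fr :: ctx) (rows :: env) u
  | ctx, env, .selectWhere s fr P, u =>
      ∃ rows, (sqlBlock fr).Rows I rows ∧ P.Sat I (sqlBlock fr :: ctx) (rows :: env) ∧
        s.Returns S (sqlBlock fr :: ctx) (rows :: env) u

/-- Truth of a predicate for the current rows. -/
def SQLPred.Sat {Rel : Type u} {Attr : Type v} {D : Type w} [LinearOrder D] {S : DBSchema Rel Attr}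
    (I : Database S D) :
    List (SQLBlock Rel) → List (List (List D)) → SQLPred Rel Attr D → Prop
  | ctx, env, .and P P' => P.Sat I ctx env ∧ P'.Sat I ctx env
  | ctx, env, .joinPred c op c' => ∃ x y, c.Val S ctx env x ∧ c'.Val S ctx env y ∧ op.Holds x y
  | ctx, env, .selPred c op v => ∃ x, c.Val S ctx env x ∧ op.Holds x v
  | ctx, env, .not P => ¬ P.Sat I ctx env
  | ctx, env, .exist false Q => ∃ u, Q.Yields I ctx env u
  | ctx, env, .exist true Q => ¬ ∃ u, Q.Yields I ctx env u
  | ctx, env, .isIn c false Q => ∃ x, c.Val S ctx env x ∧ Q.Yields I ctx env [x]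
  | ctx, env, .isIn c true Q => ∃ x, c.Val S ctx env x ∧ ¬ Q.Yields I ctx env [x]
  | ctx, env, .all c op Q =>
      ∃ x, c.Val S ctx env x ∧ ∀ y, Q.Yields I ctx env [y] → op.Holds x y
  | ctx, env, .any c op Q =>
      ∃ x, c.Val S ctx env x ∧ ∃ y, Q.Yields I ctx env [y] ∧ op.Holds x y

end

/-- Membership in the fragment with `n` output columns; Boolean queries have none. -/
def SQLMain.WF {Rel Attr D : Type*} (S : DBSchema Rel Attr) (n : ℕ) : SQLMain Rel Attr D → Prop
  | .query Q => Q.WF S [] 0 ∧ Q.outArity S = n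
  | .notPred P => P.WF S [] 0 ∧ n = 0
  | .exist _ Q => Q.WF S [] 0 ∧ n = 0

/-- The answer. A Boolean query returns the empty tuple if it is true, and nothing otherwise. -/
def SQLMain.eval {Rel Attr D : Type*} [LinearOrder D] {S : DBSchema Rel Attr}
    (I : Database S D) : SQLMain Rel Attr D → Set (List D)
  | .query Q => {u | Q.Yields I [] [] u}
  | .notPred P => {u | u = [] ∧ ¬ P.Sat I [] []}
  | .exist false Q => {u | u = [] ∧ ∃ w, Q.Yields I [] [] w}
  | .exist true Q => {u | u = [] ∧ ¬ ∃ w, Q.Yields I [] [] w}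

/-- The `n`-ary queries expressible in the fragment of SQL. -/
def sqlQueries {Rel Attr : Type*} (S : DBSchema Rel Attr) (D : Type*) [LinearOrder D] (n : ℕ) :
    Set (QueryFun S D) :=
  {f | ∃ M : SQLMain Rel Attr D, M.WF S n ∧ ∀ I, M.eval I = f I}

/-! ## A calculus of blocks without guards

All languages are compared with queries of the form `SELECT out FROM rels WHERE cond`, in which the
table occurrences are numbered from the outermost to the innermost one. -/

-- Every language is compared with one intermediate language, the block calculus `bcQueries`. A
-- query there has a fixed list of table occurrences, a condition built with conjunction, negation
-- and existential quantification over rows, and a list of output columns. Disjunction inside the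
-- condition comes for free by De Morgan. What is missing is a union at the top, since each output
-- value is read from one fixed column. This is the common limitation of the four fragments.
--
-- The calculus has no guards, and guards cost no expressiveness. A comparison of a distant column
-- `c` of a relation `R` with a term `t` can be made local by quantifying a copy `s` over `R`,
-- requiring that `s` agree with `c` in that column, and comparing the column of `s` with `t`; the
-- row of `c` itself is a witness. This is `BCFormula.exists_guarded`, from which both the tuple
-- calculus and SQL are reached.
--
-- The algebra has no variables, so a formula acts as a filter on an expression `G` that supplies
-- the rows (`BCFormula.exists_raExpr`): conjunction is composition of filters, quantification is a
-- product followed by a projection, and negation is a difference from `G`. Supplying rows starts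
-- from a unit, an expression of arity `0` that returns the empty tuple. A block with an output
-- column has a table occurrence, and the projection of that relation on no columns serves as unit:
-- where it is empty, so is the answer. A Boolean query may have no table occurrence, hence the
-- proviso on a non-empty relation. Datalog has a rule with an empty body, so it simulates the
-- algebra over a schema enlarged by a unit relation (`RAExpr.exists_dlComputes`). The rules follow
-- the expression tree, in which every node has one parent, and this yields the single use of each
-- IDB symbol.
--
-- In the other direction, a Datalog program is unfolded rule by rule (`DLRule.exists_bcQuery`).
-- Safety makes each variable a column of some positive subgoal or a constant, so that valuations
-- can be replaced by choices of rows. The algebra reaches the block calculus through Datalog. In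
-- the tuple calculus, safety assigns to each output attribute a relation and a column that must
-- contain its value (`TRCFormula.Outputs.exists_col`), and the block ranges over one extra
-- occurrence of that relation per attribute. In SQL, name resolution is static, and membership and
-- quantified subqueries reduce to existence (`SQLPred.exists_bcFormula`).

/-- The value of column `c.2` of table occurrence `c.1`. -/
def colVal {D : Type*} (rows : List (List D)) (c : ℕ × ℕ) : Option D :=
  rows[c.1]?.bind fun t => t[c.2]?

/-- A column or a constant. -/
inductive BCTerm (D : Type*)
  | col (c : ℕ × ℕ)
  | const (v : D)

def BCTerm.val {D : Type*} (rows : List (List D)) : BCTerm D → Option D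
  | .col c => colVal rows c
  | .const v => some v

/-- Formulas of the block calculus; `ex R φ` introduces a new table occurrence, numbered last. -/
inductive BCFormula (Rel : Type*) (D : Type*)
  | top
  | cmp (c : ℕ × ℕ) (op : CmpOp) (t : BCTerm D)
  | and (φ ψ : BCFormula Rel D)
  | ex (R : Rel) (φ : BCFormula Rel D)
  | not (φ : BCFormula Rel D)

/-- A query `SELECT out FROM rels WHERE cond`. -/
structure BCQuery (Rel : Type*) (D : Type*) where
  rels : List Rel
  cond : BCFormula Rel D
  out : List (ℕ × ℕ)

section BlockCalculus

variable {Rel Attr D : Type*} {S : DBSchema Rel Attr}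

-- Scopes, rows and column values

/-- The column exists in the list `ctx` of table occurrences. -/
def ColIn (S : DBSchema Rel Attr) (ctx : List Rel) (c : ℕ × ℕ) : Prop :=
  ∃ R, ctx[c.1]? = some R ∧ c.2 < S.arity R

def BCTerm.WF (S : DBSchema Rel Attr) (ctx : List Rel) : BCTerm D → Prop
  | .col c => ColIn S ctx c
  | .const _ => True

def BCFormula.WF (S : DBSchema Rel Attr) : List Rel → BCFormula Rel D → Prop
  | _, .top => True
  | ctx, .cmp c _ t => ColIn S ctx c ∧ t.WF S ctx
  | ctx, .and φ ψ => φ.WF S ctx ∧ ψ.WF S ctx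
  | ctx, .ex R φ => φ.WF S (ctx ++ [R])
  | ctx, .not φ => φ.WF S ctx

/-- `rows` is a choice of one row for each table occurrence. -/
def RowsOf (I : Database S D) (ctx : List Rel) (rows : List (List D)) : Prop :=
  List.Forall₂ (fun R t => t ∈ I.rel R) ctx rows

/-- The columns `cs` have the values `u`. -/
def ColVals (rows : List (List D)) (cs : List (ℕ × ℕ)) (u : List D) : Prop :=
  List.Forall₂ (fun c v => colVal rows c = some v) cs u

theorem RowsOf.append {I : Database S D} {c₁ c₂ : List Rel} {r₁ r₂ : List (List D)}
    (h₁ : RowsOf I c₁ r₁) (h₂ : RowsOf I c₂ r₂) : RowsOf I (c₁ ++ c₂) (r₁ ++ r₂) :=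
  List.rel_append h₁ h₂

theorem RowsOf.snoc {I : Database S D} {ctx : List Rel} {rows : List (List D)} {R : Rel}
    {t : List D} (h : RowsOf I ctx rows) (ht : t ∈ I.rel R) :
    RowsOf I (ctx ++ [R]) (rows ++ [t]) :=
  h.append (.cons ht .nil)

theorem forall₂_congr_of_mem {α β : Type*} {P Q : α → β → Prop} {l : List α} {u : List β}
    (h : ∀ a ∈ l, ∀ b, P a b ↔ Q a b) : List.Forall₂ P l u ↔ List.Forall₂ Q l u := by
  induction l generalizing u with
  | nil => simp
  | cons a l ih =>
    cases u with
    | nil => simp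
    | cons b u =>
      rw [List.forall₂_cons, List.forall₂_cons, h a List.mem_cons_self b,
        ih fun a ha => h a (List.mem_cons_of_mem _ ha)]

theorem RowsOf.of_append {I : Database S D} {c₁ c₂ : List Rel} {rows : List (List D)}
    (h : RowsOf I (c₁ ++ c₂) rows) :
    ∃ r₁ r₂, RowsOf I c₁ r₁ ∧ RowsOf I c₂ r₂ ∧ rows = r₁ ++ r₂ := by
  induction c₁ generalizing rows with
  | nil => exact ⟨[], rows, .nil, h, rfl⟩
  | cons R c₁ ih =>
    cases h with
    | cons ht h =>
      obtain ⟨r₁, r₂, h₁, h₂, rfl⟩ := ih h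
      exact ⟨_ :: r₁, r₂, .cons ht h₁, h₂, rfl⟩

theorem RowsOf.get {I : Database S D} {ctx : List Rel} {rows : List (List D)}
    (h : RowsOf I ctx rows) {r : ℕ} {R : Rel} (hr : ctx[r]? = some R) :
    ∃ t, rows[r]? = some t ∧ t ∈ I.rel R := by
  induction h generalizing r with
  | nil => simp at hr
  | @cons R' t ctx rows ht _ ih =>
    cases r with
    | zero => simp at hr; subst hr; exact ⟨t, rfl, ht⟩
    | succ r => simpa using ih (by simpa using hr)

/-- Tuples of a database have exactly the length that the schema prescribes. Because of this the
`Option` values never fail on well-formed input, and negation behaves classically. -/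
theorem RowsOf.colVal_eq_some {I : Database S D} {ctx : List Rel} {rows : List (List D)}
    (h : RowsOf I ctx rows) {c : ℕ × ℕ} (hc : ColIn S ctx c) : ∃ v, colVal rows c = some v := by
  obtain ⟨R, hR, hlt⟩ := hc
  obtain ⟨t, ht, hm⟩ := h.get hR
  rw [← I.length_eq R t hm] at hlt
  exact ⟨t[c.2], by simp [colVal, ht, hlt]⟩

theorem ColIn.append_right {ctx : List Rel} {c : ℕ × ℕ} (h : ColIn S ctx c) (ctx' : List Rel) :
    ColIn S (ctx ++ ctx') c := by
  obtain ⟨R, hR, hlt⟩ := h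
  refine ⟨R, ?_, hlt⟩
  rw [List.getElem?_append_left (List.getElem?_eq_some_iff.1 hR).1, hR]

theorem ColIn.append_left {ctx : List Rel} {r k : ℕ} (h : ColIn S ctx (r, k)) (pre : List Rel) :
    ColIn S (pre ++ ctx) (pre.length + r, k) := by
  obtain ⟨R, hR, hlt⟩ := h
  refine ⟨R, ?_, hlt⟩
  simpa [List.getElem?_append_right] using hR

theorem ColIn.snoc {ctx : List Rel} {R : Rel} {k : ℕ} (h : k < S.arity R) :
    ColIn S (ctx ++ [R]) (ctx.length, k) := ⟨R, by simp, h⟩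

theorem colVal_append_left (rows : List (List D)) (pre : List (List D)) (r k : ℕ) :
    colVal (pre ++ rows) (pre.length + r, k) = colVal rows (r, k) := by
  simp [colVal, List.getElem?_append_right]

theorem colVal_append_right {rows : List (List D)} {c : ℕ × ℕ} (h : c.1 < rows.length)
    (rows' : List (List D)) : colVal (rows ++ rows') c = colVal rows c := by
  simp [colVal, List.getElem?_append_left h]

theorem RowsOf.colVal_append {I : Database S D} {ctx : List Rel} {rows : List (List D)}
    (h : RowsOf I ctx rows) {c : ℕ × ℕ} (hc : ColIn S ctx c) (rows' : List (List D)) :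
    colVal (rows ++ rows') c = colVal rows c := by
  apply colVal_append_right
  rw [← List.Forall₂.length_eq h]
  obtain ⟨R, hR, -⟩ := hc
  exact (List.getElem?_eq_some_iff.1 hR).1

theorem BCTerm.WF.append_right {ctx : List Rel} {t : BCTerm D} (h : t.WF S ctx)
    (ctx' : List Rel) : t.WF S (ctx ++ ctx') := by
  cases t with
  | col c => exact ColIn.append_right h ctx'
  | const v => trivial

theorem RowsOf.val_append {I : Database S D} {ctx : List Rel} {rows : List (List D)}
    (h : RowsOf I ctx rows) {t : BCTerm D} (ht : t.WF S ctx) (rows' : List (List D)) :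
    t.val (rows ++ rows') = t.val rows := by
  cases t with
  | col c => exact h.colVal_append ht rows'
  | const v => rfl

theorem RowsOf.val_eq_some {I : Database S D} {ctx : List Rel} {rows : List (List D)}
    (h : RowsOf I ctx rows) {t : BCTerm D} (ht : t.WF S ctx) : ∃ v, t.val rows = some v := by
  cases t with
  | col c => exact h.colVal_eq_some ht
  | const v => exact ⟨v, rfl⟩

/-- A partial function has at most one value at each argument. Used to identify an output tuple with
one that has been computed by hand. -/
theorem forall₂_eq_some_unique {α β : Type*} {g : α → Option β} {cs : List α} {u v : List β}
    (hu : List.Forall₂ (fun c x => g c = some x) cs u)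
    (hv : List.Forall₂ (fun c x => g c = some x) cs v) : u = v := by
  induction hu generalizing v with
  | nil => cases hv; rfl
  | cons h _ ih =>
    cases hv with
    | cons h' hv =>
      rw [h] at h'
      cases h'
      rw [ih hv]

theorem RowsOf.exists_colVals {I : Database S D} {ctx : List Rel} {rows : List (List D)}
    (h : RowsOf I ctx rows) {cs : List (ℕ × ℕ)} (hc : ∀ c ∈ cs, ColIn S ctx c) :
    ∃ u, ColVals rows cs u := by
  induction cs with
  | nil => exact ⟨[], .nil⟩
  | cons c cs ih =>
    obtain ⟨u, hu⟩ := ih fun c hc' => hc c (List.mem_cons_of_mem _ hc')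
    obtain ⟨v, hv⟩ := h.colVal_eq_some (hc c List.mem_cons_self)
    exact ⟨v :: u, .cons hv hu⟩

-- Renumbering and blocks of quantifiers

/-- Renumbering of the table occurrences below `k` others. -/
def BCFormula.shift (k : ℕ) : BCFormula Rel D → BCFormula Rel D
  | .top => .top
  | .cmp c op (.col c') => .cmp (k + c.1, c.2) op (.col (k + c'.1, c'.2))
  | .cmp c op (.const v) => .cmp (k + c.1, c.2) op (.const v)
  | .and φ ψ => .and (φ.shift k) (ψ.shift k)
  | .ex R φ => .ex R (φ.shift k)
  | .not φ => .not (φ.shift k)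

theorem BCFormula.WF.shift {φ : BCFormula Rel D} {ctx : List Rel} (h : φ.WF S ctx)
    (pre : List Rel) : (φ.shift pre.length).WF S (pre ++ ctx) := by
  induction φ generalizing ctx with
  | top => trivial
  | cmp c op t =>
    cases t with
    | col c' => exact ⟨ColIn.append_left h.1 pre, ColIn.append_left h.2 pre⟩
    | const v => exact ⟨ColIn.append_left h.1 pre, trivial⟩
  | and φ ψ ih₁ ih₂ => exact ⟨ih₁ h.1, ih₂ h.2⟩
  | ex R φ ih =>
    have := ih h
    rwa [← List.append_assoc] at this
  | not φ ih => exact ih (ctx := ctx) h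

/-- Several new table occurrences. -/
def BCFormula.exs (Rs : List Rel) (φ : BCFormula Rel D) : BCFormula Rel D :=
  Rs.foldr .ex φ

theorem BCFormula.wf_exs {Rs : List Rel} {φ : BCFormula Rel D} {ctx : List Rel} :
    (exs Rs φ).WF S ctx ↔ φ.WF S (ctx ++ Rs) := by
  induction Rs generalizing ctx with
  | nil => simp [exs]
  | cons R Rs ih =>
    change (exs Rs φ).WF S (ctx ++ [R]) ↔ _
    rw [ih, List.append_assoc, List.singleton_append]

-- Semantics of the block calculus

variable [LinearOrder D]

def BCFormula.Sat (I : Database S D) : List (List D) → BCFormula Rel D → Prop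
  | _, .top => True
  | rows, .cmp c op t => ∃ x y, colVal rows c = some x ∧ t.val rows = some y ∧ op.Holds x y
  | rows, .and φ ψ => φ.Sat I rows ∧ ψ.Sat I rows
  | rows, .ex R φ => ∃ t ∈ I.rel R, φ.Sat I (rows ++ [t])
  | rows, .not φ => ¬ φ.Sat I rows

/-- A well-formed query in the scope of the table occurrences `ctx`. -/
def BCQuery.WF (S : DBSchema Rel Attr) (ctx : List Rel) (Q : BCQuery Rel D) : Prop :=
  Q.cond.WF S (ctx ++ Q.rels) ∧ ∀ c ∈ Q.out, ColIn S (ctx ++ Q.rels) c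

/-- `u` is a result of the query for the rows of the surrounding scope. -/
def BCQuery.Yields (I : Database S D) (rows : List (List D)) (Q : BCQuery Rel D) (u : List D) :
    Prop :=
  ∃ rs, RowsOf I Q.rels rs ∧ Q.cond.Sat I (rows ++ rs) ∧ ColVals (rows ++ rs) Q.out u

/-- The `n`-ary queries expressible in the block calculus. -/
def bcQueries (S : DBSchema Rel Attr) (D : Type*) [LinearOrder D] (n : ℕ) :
    Set (QueryFun S D) :=
  {f | ∃ Q : BCQuery Rel D, Q.WF S [] ∧ Q.out.length = n ∧ ∀ I, {u | Q.Yields I [] u} = f I}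

/-- Bound occurrences are numbered after the free ones, so a prefix moves all numbers, free and
bound, by the same amount. -/
theorem BCFormula.sat_shift (I : Database S D) (φ : BCFormula Rel D) (pre rows : List (List D)) :
    (φ.shift pre.length).Sat I (pre ++ rows) ↔ φ.Sat I rows := by
  induction φ generalizing rows with
  | top => rfl
  | cmp c op t => cases t <;> simp [shift, Sat, BCTerm.val, colVal_append_left]
  | and φ ψ ih₁ ih₂ => simp only [shift, Sat, ih₁, ih₂]
  | ex R φ ih => simp only [shift, Sat, List.append_assoc, ih]
  | not φ ih => simp only [shift, Sat, ih]

theorem BCFormula.sat_exs {I : Database S D} {Rs : List Rel} {φ : BCFormula Rel D}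
    {rows : List (List D)} :
    (exs Rs φ).Sat I rows ↔ ∃ rs, RowsOf I Rs rs ∧ φ.Sat I (rows ++ rs) := by
  induction Rs generalizing rows with
  | nil =>
    constructor
    · exact fun h => ⟨[], .nil, by simpa [exs] using h⟩
    · rintro ⟨rs, h, hs⟩
      cases h
      simpa [exs] using hs
  | cons R Rs ih =>
    change (∃ t ∈ I.rel R, (exs Rs φ).Sat I (rows ++ [t])) ↔ _
    simp only [ih, List.append_assoc, List.singleton_append]
    constructor
    · rintro ⟨t, ht, rs, hrs, hs⟩
      exact ⟨t :: rs, .cons ht hrs, hs⟩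
    · rintro ⟨rs, h, hs⟩
      cases h with
      | cons ht hrs => exact ⟨_, ht, _, hrs, hs⟩

/-- The operator `θ'` with `y θ' x` if and only if `x θ y`. -/
def CmpOp.flip : CmpOp → CmpOp
  | .eq => .eq
  | .ne => .ne
  | .lt => .gt
  | .le => .ge
  | .gt => .lt
  | .ge => .le

theorem CmpOp.flip_holds (op : CmpOp) (x y : D) : op.flip.Holds y x ↔ op.Holds x y := by
  cases op <;> simp [flip, Holds, eq_comm]

/-- Comparisons of arbitrary terms can be expressed. -/
theorem BCFormula.exists_cmp {ctx : List Rel} {s t : BCTerm D} (hs : s.WF S ctx)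
    (ht : t.WF S ctx) (op : CmpOp) :
    ∃ φ : BCFormula Rel D, φ.WF S ctx ∧ ∀ (I : Database S D) (rows : List (List D)),
      φ.Sat I rows ↔ ∃ x y, s.val rows = some x ∧ t.val rows = some y ∧ op.Holds x y := by
  cases s with
  | col c => exact ⟨.cmp c op t, ⟨hs, ht⟩, fun I rows => Iff.rfl⟩
  | const v =>
    cases t with
    | col c =>
      refine ⟨.cmp c op.flip (.const v), ⟨ht, trivial⟩, fun I rows => ?_⟩
      constructor
      · rintro ⟨x, y, hx, hy, h⟩
        exact ⟨y, x, hy, hx, (op.flip_holds _ _).1 h⟩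
      · rintro ⟨x, y, hx, hy, h⟩
        exact ⟨y, x, hy, hx, (op.flip_holds _ _).2 h⟩
    | const w =>
      -- The calculus has no comparison of two constants. Its truth value does not depend on the
      -- database and is decided here.
      by_cases h : op.Holds v w
      · exact ⟨.top, trivial, fun I rows => by simp [Sat, BCTerm.val, h]⟩
      · exact ⟨.not .top, trivial, fun I rows => by simp [Sat, BCTerm.val, h]⟩

/-- The query with its condition restricted to the results `u` that equal the terms `ts`. -/
theorem BCQuery.exists_mem {ctx : List Rel} {Q : BCQuery Rel D} (hQ : Q.WF S ctx)
    {ts : List (BCTerm D)} (hts : ∀ t ∈ ts, t.WF S ctx) :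
    ∃ φ : BCFormula Rel D, φ.WF S ctx ∧ ∀ (I : Database S D) (rows : List (List D)) (u : List D),
      RowsOf I ctx rows → List.Forall₂ (fun t v => t.val rows = some v) ts u →
      (φ.Sat I rows ↔ Q.Yields I rows u) := by
  obtain ⟨rels, cond, out⟩ := Q
  -- The output columns and the terms are consumed in parallel. If their numbers differ, no `u` has
  -- both lengths, and the false formula `.not .top` is right.
  have key : ∀ (cs : List (ℕ × ℕ)), (∀ c ∈ cs, ColIn S (ctx ++ rels) c) →
      ∀ ts : List (BCTerm D), (∀ t ∈ ts, t.WF S ctx) →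
      ∃ φ : BCFormula Rel D, φ.WF S (ctx ++ rels) ∧
        ∀ (I : Database S D) (rows rs : List (List D)) (u : List D),
        RowsOf I ctx rows → RowsOf I rels rs →
        List.Forall₂ (fun t v => t.val rows = some v) ts u →
        (φ.Sat I (rows ++ rs) ↔ ColVals (rows ++ rs) cs u) := by
    intro cs
    induction cs with
    | nil =>
      intro _ ts _
      cases ts with
      | nil =>
        refine ⟨.top, trivial, fun I rows rs u _ _ hu => ?_⟩
        cases hu
        simp [BCFormula.Sat, ColVals]
      | cons t ts =>
        refine ⟨.not .top, trivial, fun I rows rs u _ _ hu => ?_⟩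
        cases hu
        simp [BCFormula.Sat, ColVals]
    | cons c cs ih =>
      intro hcs ts hts
      cases ts with
      | nil =>
        refine ⟨.not .top, trivial, fun I rows rs u _ _ hu => ?_⟩
        cases hu
        simp [BCFormula.Sat, ColVals]
      | cons t ts =>
        obtain ⟨φ, hφ, hs⟩ := ih (fun c hc => hcs c (List.mem_cons_of_mem _ hc)) ts
          fun t ht => hts t (List.mem_cons_of_mem _ ht)
        have htw := hts t List.mem_cons_self
        refine ⟨.and (.cmp c .eq t) φ, ⟨⟨hcs c List.mem_cons_self, htw.append_right _⟩, hφ⟩,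
          fun I rows rs u hr hrs hu => ?_⟩
        cases hu with
        | @cons _ v _ u hv hu =>
          simp only [BCFormula.Sat, hs I rows rs u hr hrs hu, ColVals, List.forall₂_cons,
            hr.val_append htw, hv, CmpOp.Holds]
          refine and_congr ?_ Iff.rfl
          constructor
          · rintro ⟨x, y, hx, hy, rfl⟩
            rw [hx, hy]
          · exact fun h => ⟨v, v, h, rfl, rfl⟩
  obtain ⟨φ, hφ, hs⟩ := key out hQ.2 ts hts
  refine ⟨.exs rels (.and cond φ), BCFormula.wf_exs.2 ⟨hQ.1, hφ⟩, fun I rows u hr hu => ?_⟩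
  rw [BCFormula.sat_exs]
  refine exists_congr fun rs => and_congr_right fun hrs => ?_
  exact and_congr Iff.rfl (hs I rows rs u hr hrs hu)

end BlockCalculus

/-! ## From the block calculus to relational algebra -/

section BlockToAlgebra

variable {Rel Rel' Attr Attr' D : Type*} {S : DBSchema Rel Attr} {S' : DBSchema Rel' Attr'}

/-- The number of columns of a list of table occurrences. -/
def ctxArity (S : DBSchema Rel Attr) (ctx : List Rel) : ℕ :=
  (ctx.map S.arity).sum

/-- The position of a column in the concatenation of the rows. -/
def colPos (S : DBSchema Rel Attr) (ctx : List Rel) (c : ℕ × ℕ) : ℕ :=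
  ctxArity S (ctx.take c.1) + c.2

theorem ctxArity_append (S : DBSchema Rel Attr) (c₁ c₂ : List Rel) :
    ctxArity S (c₁ ++ c₂) = ctxArity S c₁ + ctxArity S c₂ := by
  simp [ctxArity]

theorem ctxArity_singleton (S : DBSchema Rel Attr) (R : Rel) : ctxArity S [R] = S.arity R := by
  simp [ctxArity]

theorem RowsOf.length_flatten {I : Database S D} {ctx : List Rel} {rows : List (List D)}
    (h : RowsOf I ctx rows) : rows.flatten.length = ctxArity S ctx := by
  induction h with
  | nil => rfl
  | cons ht _ ih => simp [ctxArity, I.length_eq _ _ ht] at ih ⊢; exact ih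

/-- Each row has the arity of its relation, so the rows before occurrence `c.1` fill exactly the
offset in `colPos`. -/
theorem RowsOf.getElem?_flatten {I : Database S D} {ctx : List Rel} {rows : List (List D)}
    (h : RowsOf I ctx rows) {c : ℕ × ℕ} (hc : ColIn S ctx c) :
    rows.flatten[colPos S ctx c]? = colVal rows c := by
  obtain ⟨r, k⟩ := c
  induction h generalizing r with
  | nil => obtain ⟨R, hR, -⟩ := hc; simp at hR
  | @cons R t ctx rows ht hrs ih =>
    obtain ⟨R', hR, hlt⟩ := hc
    have hl := I.length_eq _ _ ht
    cases r with
    | zero =>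
      simp only [List.getElem?_cons_zero, Option.some.injEq] at hR
      subst hR
      simp only at hlt
      simp [colPos, ctxArity, colVal, List.getElem?_append_left (hl ▸ hlt)]
    | succ r =>
      have := ih r ⟨R', by simpa using hR, hlt⟩
      rw [show colVal (t :: rows) (r + 1, k) = colVal rows (r, k) by simp [colVal], ← this]
      rw [show colPos S (R :: ctx) (r + 1, k) = t.length + colPos S ctx (r, k) by
        simp [colPos, ctxArity, hl, Nat.add_assoc]]
      simp [List.getElem?_append_right]

theorem ColIn.colPos_lt {ctx : List Rel} {c : ℕ × ℕ} (hc : ColIn S ctx c) :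
    colPos S ctx c < ctxArity S ctx := by
  obtain ⟨R, hR, hlt⟩ := hc
  obtain ⟨h, rfl⟩ := List.getElem?_eq_some_iff.1 hR
  have : ctxArity S ctx = ctxArity S (ctx.take c.1) + ctxArity S (ctx.drop c.1) := by
    rw [← ctxArity_append, List.take_append_drop]
  rw [this, List.drop_eq_getElem_cons h]
  simp only [colPos, ctxArity, List.map_cons, List.sum_cons]
  omega

/-- Projection on an initial range of positions cuts off the tail. In this way the algebra forgets
the row of a quantified table occurrence. -/
theorem forall₂_getElem?_range {α : Type*} (s t : List α) :
    List.Forall₂ (fun j v => (s ++ t)[j]? = some v) (List.range s.length) s := by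
  rw [List.forall₂_iff_get]
  refine ⟨by simp, fun i h₁ h₂ => ?_⟩
  simp only [List.get_eq_getElem, List.getElem_range, List.getElem?_append_left h₂,
    List.getElem?_eq_getElem h₂]

variable [LinearOrder D]

theorem RAExpr.length_of_mem_eval {I : Database S D} {E : RAExpr Rel D} (hE : E.WF S)
    {u : List D} (hu : u ∈ E.eval I) : u.length = E.arity S := by
  induction E generalizing u with
  | rel R => exact I.length_eq R u hu
  | prod E F ih₁ ih₂ =>
    obtain ⟨s, hs, t, ht, rfl⟩ := hu
    simp [ih₁ hE.1 hs, ih₂ hE.2 ht, arity]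
  | sel cs E ih => exact ih hE.1 hu.1
  | join cs E F ih₁ ih₂ =>
    obtain ⟨⟨s, hs, t, ht, rfl⟩, -⟩ := hu
    simp [ih₁ hE.1 hs, ih₂ hE.2.1 ht, arity]
  | proj js E ih =>
    obtain ⟨t, -, h⟩ := hu
    exact h.length_eq.symm
  | diff E F ih₁ ih₂ => exact ih₁ hE.1 hu.1

/-- A formula is turned into a restriction of any expression `G` that provides the rows. -/
theorem BCFormula.exists_raExpr {f : Rel → Rel'} (hf : ∀ R, S'.arity (f R) = S.arity R)
    {φ : BCFormula Rel D} {ctx : List Rel} (hφ : φ.WF S ctx) {G : RAExpr Rel' D}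
    (hG : G.WF S') (ha : G.arity S' = ctxArity S ctx) :
    ∃ E : RAExpr Rel' D, E.WF S' ∧ E.arity S' = ctxArity S ctx ∧
      (∀ I' : Database S' D, E.eval I' ⊆ G.eval I') ∧
      ∀ (I : Database S D) (I' : Database S' D), (∀ R, I'.rel (f R) = I.rel R) →
        ∀ rows, RowsOf I ctx rows →
          (rows.flatten ∈ E.eval I' ↔ rows.flatten ∈ G.eval I' ∧ φ.Sat I rows) := by
  induction φ generalizing ctx G with
  | top => exact ⟨G, hG, ha, fun _ => subset_rfl, fun I I' _ rows _ => by simp [Sat]⟩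
  | cmp c op t =>
    have hcol := hφ.1.colPos_lt
    cases t with
    | col c' =>
      have hcol' := ColIn.colPos_lt hφ.2
      refine ⟨.sel [⟨colPos S ctx c, op, .col (colPos S ctx c')⟩] G, ⟨hG, ?_⟩, ha,
        fun I' u hu => hu.1, fun I I' _ rows hr => ?_⟩
      · simp only [List.mem_singleton, forall_eq, RACond.InRange, ha, RAOperand.col.injEq]
        exact ⟨hcol, fun j hj => hj ▸ hcol'⟩
      · simp only [RAExpr.eval, Set.mem_ofPred_eq, List.mem_singleton, forall_eq, RACond.Holds,
          hr.getElem?_flatten hφ.1, hr.getElem?_flatten hφ.2, Sat, BCTerm.val]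
    | const v =>
      refine ⟨.sel [⟨colPos S ctx c, op, .const v⟩] G, ⟨hG, ?_⟩, ha,
        fun I' u hu => hu.1, fun I I' _ rows hr => ?_⟩
      · simp only [List.mem_singleton, forall_eq, RACond.InRange, ha, reduceCtorEq,
          false_imp_iff, implies_true, and_true]
        exact hcol
      · simp only [RAExpr.eval, Set.mem_ofPred_eq, List.mem_singleton, forall_eq, RACond.Holds,
          hr.getElem?_flatten hφ.1, Sat, BCTerm.val, Option.some.injEq, eq_comm]
  | and φ ψ ih₁ ih₂ =>
    obtain ⟨E, hE, hEa, hEs, hEe⟩ := ih₁ hφ.1 hG ha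
    -- The second conjunct filters the result `E` of the first, so no intersection is needed. This
    -- is why the claim is made for every `G`.
    obtain ⟨F, hF, hFa, hFs, hFe⟩ := ih₂ hφ.2 hE hEa
    refine ⟨F, hF, hFa, fun I' => (hFs I').trans (hEs I'), fun I I' hI rows hr => ?_⟩
    rw [hFe I I' hI rows hr, hEe I I' hI rows hr, and_assoc]
    rfl
  | ex R φ ih =>
    -- The product with the relation supplies the rows of the larger scope. The later projection on
    -- the old columns is the quantifier.
    obtain ⟨E, hE, hEa, hEs, hEe⟩ := ih (G := .prod G (.rel (f R))) hφ ⟨hG, trivial⟩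
      (by simp [RAExpr.arity, ha, hf, ctxArity_append, ctxArity_singleton])
    refine ⟨.proj (List.range (ctxArity S ctx)) E, ⟨hE, ?_⟩, by simp [RAExpr.arity], ?_, ?_⟩
    · intro j hj
      rw [List.mem_range] at hj
      rw [hEa, ctxArity_append]
      omega
    · rintro I' u ⟨t, ht, hu⟩
      obtain ⟨s, hs, t', -, rfl⟩ := hEs I' ht
      have := forall₂_getElem?_range s t'
      rw [RAExpr.length_of_mem_eval hG hs, ha] at this
      rwa [forall₂_eq_some_unique hu this]
    · intro I I' hI rows hr
      constructor
      · rintro ⟨t, ht, hu⟩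
        obtain ⟨s, hs, t', ht', rfl⟩ := hEs I' ht
        have := forall₂_getElem?_range s t'
        rw [RAExpr.length_of_mem_eval hG hs, ha] at this
        -- Since `E` is contained in the product, its tuple splits into a tuple `s` of `G` and a row
        -- `t'`. The projection returns `s`, which therefore is the given concatenation of rows.
        have hst := forall₂_eq_some_unique hu this
        subst hst
        refine ⟨hs, t', ?_, ?_⟩
        · rw [← hI]; exact ht'
        · have hm : t' ∈ I.rel R := by rw [← hI]; exact ht'
          refine ((hEe I I' hI (rows ++ [t']) (hr.snoc hm)).1 ?_).2
          simpa using ht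
      · rintro ⟨hg, t', hm, hs⟩
        refine ⟨rows.flatten ++ t', ?_, ?_⟩
        · have := (hEe I I' hI (rows ++ [t']) (hr.snoc hm)).2
            ⟨⟨rows.flatten, hg, t', by rw [RAExpr.eval, hI]; exact hm, by simp⟩, hs⟩
          simpa using this
        · have := forall₂_getElem?_range rows.flatten t'
          rwa [hr.length_flatten] at this
  | not φ ih =>
    obtain ⟨E, hE, hEa, hEs, hEe⟩ := ih hφ hG ha
    -- The complement is taken relative to `G`, which makes negation safe.
    refine ⟨.diff G E, ⟨hG, hE, by rw [ha, hEa]⟩, ha, fun I' u hu => hu.1,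
      fun I I' hI rows hr => ?_⟩
    simp only [RAExpr.eval, Set.mem_ofPred_eq, hEe I I' hI rows hr, Sat]
    tauto

/-- A query of the block calculus is expressible in the algebra on the databases where some
expression `B` of arity `0` returns the empty tuple; on the others, nothing is returned. -/
theorem BCQuery.exists_raExpr {f : Rel → Rel'} (hf : ∀ R, S'.arity (f R) = S.arity R)
    {Q : BCQuery Rel D} (hQ : Q.WF S []) {B : RAExpr Rel' D} (hB : B.WF S')
    (hBa : B.arity S' = 0) :
    ∃ E : RAExpr Rel' D, E.WF S' ∧ E.arity S' = Q.out.length ∧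
      ∀ (I : Database S D) (I' : Database S' D), (∀ R, I'.rel (f R) = I.rel R) →
        (B.eval I' = ∅ → E.eval I' = ∅) ∧
        ((B.eval I').Nonempty → E.eval I' = {u | Q.Yields I [] u}) := by
  -- The product of the relations in `ctx`, started with `B`. As `B` has arity `0`, it either
  -- contributes nothing or makes the product empty. Relations are added on the right, in agreement
  -- with the numbering of the occurrences.
  have key : ∀ ctx : List Rel, ∃ G : RAExpr Rel' D, G.WF S' ∧ G.arity S' = ctxArity S ctx ∧
      ∀ (I : Database S D) (I' : Database S' D), (∀ R, I'.rel (f R) = I.rel R) →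
        (B.eval I' = ∅ → G.eval I' = ∅) ∧
        ((B.eval I').Nonempty → G.eval I' = {u | ∃ rows, RowsOf I ctx rows ∧ u = rows.flatten}) := by
    intro ctx
    induction ctx using List.reverseRecOn with
    | nil =>
      refine ⟨B, hB, hBa, fun I I' _ => ⟨id, fun hne => ?_⟩⟩
      have h0 : ∀ u ∈ B.eval I', u = [] := fun u hu => by
        simpa [hBa] using RAExpr.length_of_mem_eval hB hu
      obtain ⟨u, hu⟩ := hne
      ext v
      constructor
      · intro hv
        exact ⟨[], .nil, h0 v hv⟩
      · rintro ⟨rows, hr, rfl⟩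
        cases hr
        have := h0 u hu
        subst this
        exact hu
    | append_singleton ctx R ih =>
      obtain ⟨G, hG, hGa, hGe⟩ := ih
      refine ⟨.prod G (.rel (f R)), ⟨hG, trivial⟩, by
        simp [RAExpr.arity, hGa, hf, ctxArity_append, ctxArity_singleton], fun I I' hI => ⟨?_, ?_⟩⟩
      · intro h
        ext u
        simp [RAExpr.eval, (hGe I I' hI).1 h]
      · intro h
        ext u
        simp only [RAExpr.eval, (hGe I I' hI).2 h, hI, Set.mem_ofPred_eq]
        constructor
        · rintro ⟨_, ⟨rows, hr, rfl⟩, t, ht, rfl⟩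
          exact ⟨rows ++ [t], hr.snoc ht, by simp⟩
        · rintro ⟨rows, hr, rfl⟩
          obtain ⟨rows₁, rows₂, h₁, h₂, rfl⟩ := hr.of_append
          cases h₂ with
          | cons ht hn =>
            cases hn
            exact ⟨_, ⟨rows₁, h₁, rfl⟩, _, ht, by simp⟩
  obtain ⟨G, hG, hGa, hGe⟩ := key Q.rels
  obtain ⟨hQc, hQo⟩ := hQ
  obtain ⟨E, hE, hEa, hEs, hEe⟩ := BCFormula.exists_raExpr hf hQc hG hGa
  simp only [List.nil_append] at hEa hQo hEe
  refine ⟨.proj (Q.out.map (colPos S Q.rels)) E, ⟨hE, ?_⟩, by simp [RAExpr.arity],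
    fun I I' hI => ⟨fun h => ?_, fun h => ?_⟩⟩
  · intro j hj
    obtain ⟨c, hc, rfl⟩ := List.mem_map.1 hj
    exact hEa ▸ (hQo c hc).colPos_lt
  · have : E.eval I' = ∅ := Set.subset_empty_iff.1 ((hGe I I' hI).1 h ▸ hEs I')
    ext u
    simp [RAExpr.eval, this]
  · have hcols : ∀ rows u, RowsOf I Q.rels rows →
        (List.Forall₂ (fun j v => rows.flatten[j]? = some v) (Q.out.map (colPos S Q.rels)) u ↔
          ColVals rows Q.out u) := by
      intro rows u hr
      rw [List.forall₂_map_left_iff]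
      exact forall₂_congr_of_mem fun c hc v => by rw [hr.getElem?_flatten (hQo c hc)]
    ext u
    constructor
    · rintro ⟨t, ht, hu⟩
      have hg := hEs I' ht
      rw [(hGe I I' hI).2 h] at hg
      obtain ⟨rows, hr, rfl⟩ := hg
      exact ⟨rows, hr, ((hEe I I' hI rows hr).1 ht).2, (hcols rows u hr).1 hu⟩
    · rintro ⟨rows, hr, hs, hu⟩
      refine ⟨rows.flatten, (hEe I I' hI rows hr).2 ⟨?_, hs⟩, (hcols rows u hr).2 hu⟩
      rw [(hGe I I' hI).2 h]
      exact ⟨rows, hr, rfl⟩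

end BlockToAlgebra

/-! ## From relational algebra with a unit relation to Datalog -/

section AlgebraToDatalog

variable {Rel Attr D : Type*} {S : DBSchema Rel Attr}

/-- The schema with an additional relation that has no attributes. -/
def DBSchema.withUnit (S : DBSchema Rel Attr) : DBSchema (Option Rel) Attr where
  attrs R := R.elim [] S.attrs
  nodup R := by cases R <;> simp [S.nodup]

/-- The database in which the additional relation contains the empty tuple. -/
def Database.withUnit (I : Database S D) : Database S.withUnit D where
  rel R := R.elim {[]} I.rel
  length_eq R t ht := by
    cases R with
    | none => cases ht; rfl
    | some R => exact I.length_eq R t ht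
  finite R := by
    cases R with
    | none => exact Set.finite_singleton _
    | some R => exact I.finite R

-- Topologically sorted lists of rules, and atoms with consecutive variables

/-- The rule `r` can be added to the list `rs` of rules. -/
structure DLRule.Extends (S : DBSchema Rel Attr) (rs : List (DLRule Rel D)) (r : DLRule Rel D) :
    Prop where
  safe : r.Safe
  edb : ∀ l ∈ r.body, ∀ a, l.atom? = some a → ∀ R, a.pred = .inl R → a.args.length = S.arity R
  idb : ∀ l ∈ r.body, ∀ a, l.atom? = some a → ∀ p, a.pred = .inr p →
    ∃ r' ∈ rs, r'.head = p ∧ r'.args.length = a.args.length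

/-- Lists of rules in which every rule can be added to the earlier ones. -/
inductive DLSorted (S : DBSchema Rel Attr) : List (DLRule Rel D) → Prop
  | nil : DLSorted S []
  | snoc {rs : List (DLRule Rel D)} {r : DLRule Rel D} (h : DLSorted S rs) (hr : r.Extends S rs) :
      DLSorted S (rs ++ [r])

/-- `DLRule.Extends` is monotone in the list of earlier rules. -/
theorem DLSorted.append {rs rs' : List (DLRule Rel D)} (h : DLSorted S rs)
    (h' : DLSorted S rs') : DLSorted S (rs ++ rs') := by
  induction h' with
  | nil => simpa using h
  | snoc _ hr ih =>
    rw [← List.append_assoc]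
    refine ih.snoc ⟨hr.safe, hr.edb, fun l hl a ha p hp => ?_⟩
    obtain ⟨r', hr', h⟩ := hr.idb l hl a ha p hp
    exact ⟨r', List.mem_append_right _ hr', h⟩

/-- Turns the inductive description into the one by splittings of the list that `DLProgram.WF` asks
for. -/
theorem DLSorted.extends {rs : List (DLRule Rel D)} (h : DLSorted S rs)
    {before after : List (DLRule Rel D)} {r : DLRule Rel D} (hr : rs = before ++ r :: after) :
    r.Extends S before := by
  induction h generalizing after with
  | nil => simp at hr
  | @snoc rs r' _ hr' ih =>
    rcases List.eq_nil_or_concat after with rfl | ⟨after', r'', rfl⟩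
    · obtain ⟨rfl, h⟩ := List.append_inj' hr rfl
      cases h
      exact hr'
    · rw [List.concat_eq_append, ← List.cons_append, ← List.append_assoc] at hr
      exact ih (List.append_inj' hr rfl).1

/-- All uses of IDB symbols in the bodies. -/
def dlUsed (rs : List (DLRule Rel D)) : List ℕ :=
  rs.flatMap fun r => r.body.filterMap DLSubgoal.idb?

/-- Column `i` of a tuple becomes the value of variable `i`. The remaining variables get an
arbitrary element, so the domain has to be non-empty. -/
theorem exists_valuation [Nonempty D] (t : List D) :
    ∃ ν : ℕ → D, t = (List.range t.length).map ν := by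
  obtain ⟨d⟩ := ‹Nonempty D›
  refine ⟨fun i => t[i]?.getD d, List.ext_getElem (by simp) fun i h₁ h₂ => ?_⟩
  simp [List.getElem?_eq_getElem h₁]

/-- The atom `p(x_a, …, x_{a+n-1})`. -/
def seqAtom (p : Rel ⊕ ℕ) (a n : ℕ) : DLAtom Rel D :=
  ⟨p, (List.range n).map fun i => .var (a + i)⟩

theorem var_mem_seqAtom {p : Rel ⊕ ℕ} {a n x : ℕ} :
    DLTerm.var x ∈ (seqAtom p a n : DLAtom Rel D).args ↔ a ≤ x ∧ x < a + n := by
  simp only [seqAtom, List.mem_map, List.mem_range, DLTerm.var.injEq]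
  constructor
  · rintro ⟨i, hi, rfl⟩
    omega
  · rintro ⟨h₁, h₂⟩
    exact ⟨x - a, by omega, by omega⟩

theorem seqAtom_length (p : Rel ⊕ ℕ) (a n : ℕ) :
    (seqAtom p a n : DLAtom Rel D).args.length = n := by
  simp [seqAtom]

theorem seqAtom_holds_inr {I : Database S D} {J : ℕ → Set (List D)} {ν : ℕ → D} {g a n : ℕ} :
    (seqAtom (.inr g) a n : DLAtom Rel D).Holds I J ν ↔
      (List.range n).map (fun i => ν (a + i)) ∈ J g := by
  simp [DLAtom.Holds, seqAtom, Function.comp_def, DLTerm.val]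

theorem seqAtom_holds_inl {I : Database S D} {J : ℕ → Set (List D)} {ν : ℕ → D} {R : Rel}
    {a n : ℕ} :
    (seqAtom (.inl R) a n : DLAtom Rel D).Holds I J ν ↔
      (List.range n).map (fun i => ν (a + i)) ∈ I.rel R := by
  simp [DLAtom.Holds, seqAtom, Function.comp_def, DLTerm.val]

/-- The built-in subgoal for a simple condition on the columns. -/
def RACond.toSubgoal (c : RACond D) : DLSubgoal Rel D :=
  .builtin c.lhs c.op (match c.rhs with
    | .col j => .var j
    | .const v => .const v)

/-- Expressions without the unit relation. -/
def RAExpr.lift : RAExpr Rel D → RAExpr (Option Rel) D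
  | .rel R => .rel (some R)
  | .prod E F => .prod E.lift F.lift
  | .sel cs E => .sel cs E.lift
  | .join cs E F => .join cs E.lift F.lift
  | .proj js E => .proj js E.lift
  | .diff E F => .diff E.lift F.lift

theorem RAExpr.arity_lift (E : RAExpr Rel D) : E.lift.arity S.withUnit = E.arity S := by
  induction E with
  | rel R => rfl
  | _ => simp_all [lift, arity]

theorem RAExpr.wf_lift {E : RAExpr Rel D} (h : E.WF S) : E.lift.WF S.withUnit := by
  induction E with
  | rel R => trivial
  | _ => simp_all [lift, WF, arity_lift]

-- Rules that compute algebra expressions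

variable [LinearOrder D]

/-- A rule overwrites only its own head. Values that are already computed thus survive the rules
appended later. -/
theorem foldl_update_of_not_head {I : Database S D} {rs : List (DLRule Rel D)} {p : ℕ}
    (h : ∀ r ∈ rs, r.head ≠ p) (J : ℕ → Set (List D)) :
    rs.foldl (fun J r => Function.update J r.head (r.eval I J)) J p = J p := by
  induction rs generalizing J with
  | nil => rfl
  | cons r rs ih =>
    rw [List.foldl_cons, ih fun r' hr' => h r' (List.mem_cons_of_mem _ hr'),
      Function.update_of_ne (h r List.mem_cons_self).symm]

/-- The rules `rs`, with IDB symbols in `[k, m)`, compute for every `(g, E)` in `gs` the value of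
the expression `E` for the IDB symbol `g`, which is not used in `rs`. -/
structure DLComputes (S : DBSchema Rel Attr) (k m : ℕ) (rs : List (DLRule Rel D))
    (gs : List (ℕ × RAExpr (Option Rel) D)) : Prop where
  sorted : DLSorted S rs
  heads_nodup : (rs.map DLRule.head).Nodup
  heads_range : ∀ r ∈ rs, k ≤ r.head ∧ r.head < m
  -- The goals are counted among the uses in advance, so that a later rule may consume each of them
  -- once.
  used_nodup : (gs.map Prod.fst ++ dlUsed rs).Nodup
  used_range : ∀ p ∈ gs.map Prod.fst ++ dlUsed rs, k ≤ p ∧ p < m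
  goal_def : ∀ g ∈ gs, ∃ r ∈ rs, r.head = g.1 ∧ r.args.length = g.2.arity S.withUnit
  le : k ≤ m
  eval_eq : ∀ g ∈ gs, ∀ (I : Database S D) (J : ℕ → Set (List D)),
    rs.foldl (fun J r => Function.update J r.head (r.eval I J)) J g.1 = g.2.eval I.withUnit

theorem DLComputes.nil (S : DBSchema Rel Attr) (k : ℕ) :
    DLComputes (D := D) S k k [] [] where
  sorted := .nil
  heads_nodup := List.nodup_nil
  heads_range := by simp
  used_nodup := by simp [dlUsed]
  used_range := by simp [dlUsed]
  goal_def := by simp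
  le := le_rfl
  eval_eq := by simp

/-- The ranges `[k, m)` and `[m, m')` of IDB symbols are disjoint, so heads and uses cannot collide.
The second list may run after the first because `eval_eq` admits every initial interpretation `J`;
the goals of the first list are not heads in the second. -/
theorem DLComputes.append {k m m' : ℕ} {rs rs' : List (DLRule Rel D)}
    {gs gs' : List (ℕ × RAExpr (Option Rel) D)} (h : DLComputes S k m rs gs)
    (h' : DLComputes S m m' rs' gs') : DLComputes S k m' (rs ++ rs') (gs ++ gs') := by
  have hu : (gs ++ gs').map Prod.fst ++ dlUsed (rs ++ rs') =
      gs.map Prod.fst ++ gs'.map Prod.fst ++ (dlUsed rs ++ dlUsed rs') := by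
    simp [dlUsed]
  have hp : (gs.map Prod.fst ++ gs'.map Prod.fst ++ (dlUsed rs ++ dlUsed rs')).Perm
      (gs.map Prod.fst ++ dlUsed rs ++ (gs'.map Prod.fst ++ dlUsed rs')) := by
    simp only [List.append_assoc]
    refine List.Perm.append_left _ ?_
    simp only [← List.append_assoc]
    exact List.Perm.append_right _ List.perm_append_comm
  have hle := h.le
  have hle' := h'.le
  refine ⟨h.sorted.append h'.sorted, ?_, ?_, ?_, ?_, ?_, hle.trans hle', ?_⟩
  · rw [List.map_append]
    refine h.heads_nodup.append h'.heads_nodup fun p hp hp' => ?_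
    obtain ⟨r, hr, rfl⟩ := List.mem_map.1 hp
    obtain ⟨r', hr', he⟩ := List.mem_map.1 hp'
    have := h.heads_range r hr
    have := h'.heads_range r' hr'
    omega
  · intro r hr
    rcases List.mem_append.1 hr with hr | hr
    · have := h.heads_range r hr
      omega
    · have := h'.heads_range r hr
      omega
  · rw [hu, hp.nodup_iff]
    refine h.used_nodup.append h'.used_nodup fun p hp hp' => ?_
    have := h.used_range p hp
    have := h'.used_range p hp'
    omega
  · intro p hp'
    rw [hu, hp.mem_iff] at hp'
    rcases List.mem_append.1 hp' with hp' | hp'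
    · have := h.used_range p hp'
      omega
    · have := h'.used_range p hp'
      omega
  · intro g hg
    rcases List.mem_append.1 hg with hg | hg
    · obtain ⟨r, hr, hh⟩ := h.goal_def g hg
      exact ⟨r, List.mem_append_left _ hr, hh⟩
    · obtain ⟨r, hr, hh⟩ := h'.goal_def g hg
      exact ⟨r, List.mem_append_right _ hr, hh⟩
  · intro g hg I J
    rw [List.foldl_append]
    rcases List.mem_append.1 hg with hg | hg
    · rw [foldl_update_of_not_head, h.eval_eq g hg]
      intro r hr
      have := h'.heads_range r hr
      have := h.used_range g.1 (List.mem_append_left _ (List.mem_map_of_mem hg))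
      omega
    · exact h'.eval_eq g hg I _

/-- A rule that uses all the computed IDB symbols is added. -/
theorem DLComputes.addRule {k m : ℕ} {rs : List (DLRule Rel D)}
    {gs : List (ℕ × RAExpr (Option Rel) D)} (h : DLComputes S k m rs gs)
    {E : RAExpr (Option Rel) D} {args : List ℕ} {body : List (DLSubgoal Rel D)}
    (hargs : args.length = E.arity S.withUnit)
    (hsafe : (⟨m, args, body⟩ : DLRule Rel D).Safe)
    (hused : body.filterMap DLSubgoal.idb? = gs.map Prod.fst)
    (hedb : ∀ l ∈ body, ∀ a, l.atom? = some a → ∀ R, a.pred = .inl R →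
      a.args.length = S.arity R)
    (hidb : ∀ l ∈ body, ∀ a, l.atom? = some a → ∀ p, a.pred = .inr p →
      ∃ g ∈ gs, g.1 = p ∧ g.2.arity S.withUnit = a.args.length)
    (heval : ∀ (I : Database S D) (J : ℕ → Set (List D)),
      (∀ g ∈ gs, J g.1 = g.2.eval I.withUnit) →
      (⟨m, args, body⟩ : DLRule Rel D).eval I J = E.eval I.withUnit) :
    DLComputes S k (m + 1) (rs ++ [⟨m, args, body⟩]) [(m, E)] := by
  have hle := h.le
  have hu : dlUsed (rs ++ [(⟨m, args, body⟩ : DLRule Rel D)]) = dlUsed rs ++ gs.map Prod.fst := by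
    simp [dlUsed, hused]
  refine ⟨h.sorted.snoc ⟨hsafe, hedb, fun l hl a ha p hp => ?_⟩, ?_, ?_, ?_, ?_, ?_, by omega, ?_⟩
  · obtain ⟨g, hg, rfl, hga⟩ := hidb l hl a ha p hp
    obtain ⟨r, hr, hrg, hra⟩ := h.goal_def g hg
    exact ⟨r, hr, hrg, hra.trans hga⟩
  · rw [List.map_append]
    refine h.heads_nodup.append (by simp) fun p hp hp' => ?_
    obtain ⟨r, hr, rfl⟩ := List.mem_map.1 hp
    have := h.heads_range r hr
    simp at hp'
    omega
  · intro r hr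
    rcases List.mem_append.1 hr with hr | hr
    · have := h.heads_range r hr
      omega
    · rw [List.mem_singleton.1 hr]
      exact ⟨hle, Nat.lt_succ_self m⟩
  -- The consumed goals pass from the list of goals to the uses, which is a permutation. The only
  -- new symbol is `m`, outside the range so far.
  · rw [hu, List.map_singleton, List.singleton_append, List.nodup_cons]
    refine ⟨fun hm => ?_, (List.perm_append_comm.nodup_iff).1 h.used_nodup⟩
    have := h.used_range m (List.perm_append_comm.mem_iff.1 hm)
    omega
  · intro p hp
    rw [hu, List.map_singleton, List.singleton_append, List.mem_cons] at hp
    rcases hp with rfl | hp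
    · exact ⟨hle, Nat.lt_succ_self _⟩
    · have := h.used_range p (List.perm_append_comm.mem_iff.1 hp)
      omega
  · intro g hg
    rw [List.mem_singleton.1 hg]
    exact ⟨_, List.mem_append_right _ List.mem_cons_self, rfl, hargs⟩
  · intro g hg I J
    rw [List.mem_singleton.1 hg, List.foldl_append]
    simp only [List.foldl_cons, List.foldl_nil, Function.update_self]
    exact heval I _ fun g hg => h.eval_eq g hg I J

theorem RACond.toSubgoal_holds {I : Database S D} {J : ℕ → Set (List D)} {ν : ℕ → D}
    {c : RACond D} {n : ℕ} (hc : c.InRange n) :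
    (c.toSubgoal : DLSubgoal Rel D).Holds I J ν ↔ c.Holds ((List.range n).map ν) := by
  obtain ⟨i, op, t⟩ := c
  have hi : i < n := hc.1
  cases t with
  | col j =>
    have hj : j < n := hc.2 j rfl
    simp [toSubgoal, DLSubgoal.Holds, RACond.Holds, DLTerm.val, hi, hj]
  | const v => simp [toSubgoal, DLSubgoal.Holds, RACond.Holds, DLTerm.val, hi]

/-- One more rule for a selection. -/
theorem DLComputes.addSel [Nonempty D] {k m g : ℕ} {rs : List (DLRule Rel D)}
    {E F : RAExpr (Option Rel) D} (h : DLComputes S k m rs [(g, F)]) (hF : F.WF S.withUnit)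
    {cs : List (RACond D)} (hcs : ∀ c ∈ cs, c.InRange (F.arity S.withUnit))
    (hE : E.arity S.withUnit = F.arity S.withUnit)
    (heval : ∀ I : Database S D, E.eval I.withUnit = {u | u ∈ F.eval I.withUnit ∧ ∀ c ∈ cs, c.Holds u}) :
    ∃ r : DLRule Rel D, DLComputes S k (m + 1) (rs ++ [r]) [(m, E)] := by
  set n := F.arity S.withUnit with hn
  have hlim : ∀ (b : Prop) (x : ℕ), x < n → DLRule.Limited
      (⟨m, List.range n, .pos (seqAtom (.inr g) 0 n) :: cs.map RACond.toSubgoal⟩ : DLRule Rel D)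
      b x := fun b x hx =>
    .atom List.mem_cons_self (var_mem_seqAtom.2 ⟨Nat.zero_le _, by omega⟩)
  refine ⟨_, h.addRule (args := List.range n)
    (body := .pos (seqAtom (.inr g) 0 n) :: cs.map RACond.toSubgoal)
    (by simp [hE]) ⟨fun x hx => hlim _ _ (List.mem_range.1 hx), ?_⟩ ?_ ?_ ?_ ?_⟩
  · intro l hl x hx
    rcases List.mem_cons.1 hl with rfl | hl
    · have := var_mem_seqAtom.1 hx
      exact hlim _ _ (by omega)
    · obtain ⟨c, hc, rfl⟩ := List.mem_map.1 hl
      have hr := hcs c hc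
      obtain ⟨i, op, t⟩ := c
      rcases hx with rfl | hx
      · exact hlim _ _ hr.1
      · cases t with
        | col j =>
          cases hx
          exact hlim _ _ (hr.2 _ rfl)
        | const v => cases hx
  · have : (cs.map (RACond.toSubgoal (Rel := Rel))).filterMap DLSubgoal.idb? = [] := by
      simp [List.filterMap_eq_nil_iff, RACond.toSubgoal, DLSubgoal.idb?, DLSubgoal.atom?]
    simp [DLSubgoal.idb?, DLSubgoal.atom?, seqAtom, this]
  · intro l hl a ha R hR
    rcases List.mem_cons.1 hl with rfl | hl
    · cases ha
      cases hR
    · obtain ⟨c, hc, rfl⟩ := List.mem_map.1 hl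
      cases ha
  · intro l hl a ha p hp
    rcases List.mem_cons.1 hl with rfl | hl
    · cases ha
      cases hp
      exact ⟨_, List.mem_cons_self, rfl, (seqAtom_length _ _ _).symm⟩
    · obtain ⟨c, hc, rfl⟩ := List.mem_map.1 hl
      cases ha
  · intro I J hJ
    have hg := hJ _ List.mem_cons_self
    rw [heval I]
    ext u
    simp only [DLRule.eval, List.forall_mem_cons, DLSubgoal.Holds, seqAtom_holds_inr, hg,
      List.forall_mem_map, Set.mem_ofPred_eq, Nat.zero_add]
    constructor
    · rintro ⟨ν, ⟨h₁, h₂⟩, rfl⟩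
      exact ⟨h₁, fun c hc => (RACond.toSubgoal_holds (I := I) (J := J) (hcs c hc)).1 (h₂ c hc)⟩
    · rintro ⟨h₁, h₂⟩
      obtain ⟨ν, hν⟩ := exists_valuation u
      rw [RAExpr.length_of_mem_eval hF h₁, ← hn] at hν
      subst hν
      exact ⟨ν, ⟨h₁, fun c hc => (RACond.toSubgoal_holds (I := I) (J := J) (hcs c hc)).2 (h₂ c hc)⟩, rfl⟩

/-- Each node of the expression gets its own rules and new IDB symbols. An expression is a tree, so
a symbol is consumed by the parent only; equal subexpressions are simply computed several times. -/
theorem RAExpr.exists_dlComputes [Nonempty D] {E : RAExpr (Option Rel) D}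
    (hE : E.WF S.withUnit) (k : ℕ) :
    ∃ m g rs, DLComputes S k m rs [(g, E)] := by
  induction E generalizing k with
  | rel R =>
    cases R with
    | none =>
      -- The unit relation is a fact: no arguments and an empty body, true under every valuation.
      refine ⟨_, _, _, (DLComputes.nil S k).addRule (args := []) (body := []) rfl
        ⟨by simp, by simp⟩ rfl (by simp) (by simp) fun I J _ => ?_⟩
      ext u
      simp [DLRule.eval, RAExpr.eval, Database.withUnit]
    | some R =>
      refine ⟨_, _, _, (DLComputes.nil S k).addRule (args := List.range (S.arity R))
        (body := [.pos (seqAtom (.inl R) 0 (S.arity R))]) (by simp; rfl)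
        ⟨fun x hx => ?_, ?_⟩ rfl ?_ ?_ fun I J _ => ?_⟩
      · exact .atom List.mem_cons_self
          (var_mem_seqAtom.2 ⟨Nat.zero_le _, by simpa using hx⟩)
      · simp only [List.forall_mem_singleton]
        exact fun x hx => .atom List.mem_cons_self hx
      · simp only [List.forall_mem_singleton]
        rintro a ⟨⟩ R' ⟨⟩
        exact seqAtom_length _ _ _
      · simp only [List.forall_mem_singleton]
        rintro a ⟨⟩ p ⟨⟩
      · ext u
        simp only [DLRule.eval, List.forall_mem_singleton, DLSubgoal.Holds, seqAtom_holds_inl,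
          Set.mem_ofPred_eq, Nat.zero_add]
        constructor
        · rintro ⟨ν, h, rfl⟩
          exact h
        · intro h
          have h : u ∈ I.rel R := h
          obtain ⟨ν, hν⟩ := exists_valuation u
          rw [I.length_eq R u h] at hν
          subst hν
          exact ⟨ν, h, rfl⟩
  | prod E F ih₁ ih₂ => exact exists_dlComputes_prod hE (ih₁ hE.1) (ih₂ hE.2) k
  | sel cs E ih =>
    obtain ⟨m, g, rs, h⟩ := ih hE.1 k
    obtain ⟨r, hr⟩ := h.addSel (E := .sel cs E) hE.1 hE.2 rfl fun I => rfl
    exact ⟨_, _, _, hr⟩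
  | join cs E F ih₁ ih₂ =>
    -- A join is a selection from a product and takes two rules.
    have hEF : (RAExpr.prod E F).WF S.withUnit := ⟨hE.1, hE.2.1⟩
    obtain ⟨m, g, rs, h⟩ := exists_dlComputes_prod hEF (ih₁ hE.1) (ih₂ hE.2.1) k
    obtain ⟨r, hr⟩ := h.addSel (E := .join cs E F) hEF hE.2.2 rfl fun I => rfl
    exact ⟨_, _, _, hr⟩
  | proj js E ih =>
    obtain ⟨m, g, rs, h⟩ := ih hE.1 k
    set n := E.arity S.withUnit with hn
    refine ⟨_, _, _, h.addRule (args := js) (body := [.pos (seqAtom (.inr g) 0 n)]) rfl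
        ⟨fun x hx => ?_, ?_⟩ rfl ?_ ?_ fun I J hJ => ?_⟩
    · have := hE.2 x hx
      exact .atom List.mem_cons_self (var_mem_seqAtom.2 ⟨Nat.zero_le _, by omega⟩)
    · simp only [List.forall_mem_singleton]
      exact fun x hx => .atom List.mem_cons_self hx
    · simp only [List.forall_mem_singleton]
      rintro a ⟨⟩ R' ⟨⟩
    · simp only [List.forall_mem_singleton]
      rintro a ⟨⟩ p ⟨⟩
      exact ⟨_, List.mem_cons_self, rfl, (seqAtom_length _ _ _).symm⟩
    · have hg := hJ _ List.mem_cons_self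
      have hjs : ∀ ν : ℕ → D, List.Forall₂ (fun j v => ((List.range n).map ν)[j]? = some v) js
          (js.map ν) := by
        intro ν
        rw [List.forall₂_map_right_iff, List.forall₂_same]
        intro j hj
        simp [hE.2 j hj, hn]
      ext u
      simp only [DLRule.eval, List.forall_mem_singleton, DLSubgoal.Holds, seqAtom_holds_inr, hg,
        Set.mem_ofPred_eq, Nat.zero_add]
      constructor
      · rintro ⟨ν, h, rfl⟩
        exact ⟨_, h, hjs ν⟩
      · rintro ⟨t, ht, hu⟩
        obtain ⟨ν, hν⟩ := exists_valuation t
        rw [RAExpr.length_of_mem_eval hE.1 ht, ← hn] at hν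
        subst hν
        exact ⟨ν, ht, forall₂_eq_some_unique hu (hjs ν)⟩
  | diff E F ih₁ ih₂ =>
    obtain ⟨m, g, rs, h⟩ := ih₁ hE.1 k
    obtain ⟨m', g', rs', h'⟩ := ih₂ hE.2.1 m
    set n := E.arity S.withUnit with hn
    have hlim : ∀ (b : Prop) (x : ℕ), x < n → DLRule.Limited (⟨m', List.range n,
        [.pos (seqAtom (.inr g) 0 n), .neg (seqAtom (.inr g') 0 n)]⟩ : DLRule Rel D) b x :=
      fun b x hx => .atom List.mem_cons_self (var_mem_seqAtom.2 ⟨Nat.zero_le _, by omega⟩)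
    refine ⟨_, _, _, (h.append h').addRule (args := List.range n)
      (body := [.pos (seqAtom (.inr g) 0 n), .neg (seqAtom (.inr g') 0 n)])
      (by simp [RAExpr.arity, hn])
        ⟨fun x hx => hlim _ _ (List.mem_range.1 hx), ?_⟩ rfl ?_ ?_ fun I J hJ => ?_⟩
    · simp only [List.forall_mem_cons, List.not_mem_nil, false_imp_iff, implies_true, and_true]
      exact ⟨fun x hx => hlim _ _ (by have := var_mem_seqAtom.1 hx; omega),
        fun x hx => hlim _ _ (by have := var_mem_seqAtom.1 hx; omega)⟩
    · simp only [List.forall_mem_cons, List.not_mem_nil, false_imp_iff, implies_true, and_true]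
      constructor <;> rintro a ⟨⟩ R' ⟨⟩
    · simp only [List.forall_mem_cons, List.not_mem_nil, false_imp_iff, implies_true, and_true]
      constructor
      · rintro a ⟨⟩ p ⟨⟩
        exact ⟨(g, E), by simp, rfl, (seqAtom_length _ _ _).symm⟩
      · rintro a ⟨⟩ p ⟨⟩
        exact ⟨(g', F), by simp, rfl, hE.2.2.symm.trans (seqAtom_length _ _ _).symm⟩
    · have hg := hJ (g, E) (by simp)
      have hg' := hJ (g', F) (by simp)
      ext u
      simp only [DLRule.eval, List.forall_mem_cons, DLSubgoal.Holds, seqAtom_holds_inr] at hg hg' ⊢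
      simp only [hg, hg', List.not_mem_nil, false_imp_iff, implies_true, and_true,
        Set.mem_ofPred_eq, Nat.zero_add, RAExpr.eval]
      constructor
      · rintro ⟨ν, h, rfl⟩
        exact h
      · intro hu
        obtain ⟨ν, hν⟩ := exists_valuation u
        rw [RAExpr.length_of_mem_eval hE.1 hu.1, ← hn] at hν
        subst hν
        exact ⟨ν, hu, rfl⟩
where
  exists_dlComputes_prod {E F : RAExpr (Option Rel) D} (hEF : (RAExpr.prod E F).WF S.withUnit)
      (ih₁ : ∀ k, ∃ m g rs, DLComputes S k m rs [(g, E)])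
      (ih₂ : ∀ k, ∃ m g rs, DLComputes S k m rs [(g, F)]) (k : ℕ) :
      ∃ m g rs, DLComputes S k m rs [(g, .prod E F)] := by
    obtain ⟨m, g, rs, h⟩ := ih₁ k
    obtain ⟨m', g', rs', h'⟩ := ih₂ m
    set n := E.arity S.withUnit with hn
    set n' := F.arity S.withUnit with hn'
    -- The two atoms use the disjoint ranges `[0, n)` and `[n, n + n')` of variables, so that no
    -- equality is imposed.
    refine ⟨_, _, _, (h.append h').addRule (args := List.range (n + n'))
      (body := [.pos (seqAtom (.inr g) 0 n), .pos (seqAtom (.inr g') n n')])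
      (by simp [RAExpr.arity, hn, hn'])
        ⟨fun x hx => ?_, ?_⟩ rfl ?_ ?_ fun I J hJ => ?_⟩
    · have hx := List.mem_range.1 hx
      by_cases hxn : x < n
      · exact .atom List.mem_cons_self (var_mem_seqAtom.2 ⟨Nat.zero_le _, by omega⟩)
      · exact .atom (List.mem_cons_of_mem _ List.mem_cons_self)
          (var_mem_seqAtom.2 ⟨by omega, by omega⟩)
    · simp only [List.forall_mem_cons, List.not_mem_nil, false_imp_iff, implies_true, and_true]
      exact ⟨fun x hx => .atom List.mem_cons_self hx,
        fun x hx => .atom (List.mem_cons_of_mem _ List.mem_cons_self) hx⟩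
    · simp only [List.forall_mem_cons, List.not_mem_nil, false_imp_iff, implies_true, and_true]
      constructor <;> rintro a ⟨⟩ R' ⟨⟩
    · simp only [List.forall_mem_cons, List.not_mem_nil, false_imp_iff, implies_true, and_true]
      constructor
      · rintro a ⟨⟩ p ⟨⟩
        exact ⟨(g, E), by simp, rfl, (seqAtom_length _ _ _).symm⟩
      · rintro a ⟨⟩ p ⟨⟩
        exact ⟨(g', F), by simp, rfl, (seqAtom_length _ _ _).symm⟩
    · have hg := hJ (g, E) (by simp)
      have hg' := hJ (g', F) (by simp)
      ext u
      simp only [DLRule.eval, List.forall_mem_cons, DLSubgoal.Holds, seqAtom_holds_inr] at hg hg' ⊢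
      simp only [hg, hg', List.not_mem_nil, false_imp_iff, implies_true, and_true,
        Set.mem_ofPred_eq, Nat.zero_add, RAExpr.eval]
      constructor
      · rintro ⟨ν, ⟨h₁, h₂⟩, rfl⟩
        exact ⟨_, h₁, _, h₂, by simp [List.range_add, Function.comp_def]⟩
      · rintro ⟨s, hs, t, ht, rfl⟩
        have hsl := RAExpr.length_of_mem_eval hEF.1 hs
        have htl := RAExpr.length_of_mem_eval hEF.2 ht
        obtain ⟨ν, hν⟩ := exists_valuation (s ++ t)
        rw [List.length_append, hsl, htl, List.range_add, List.map_append] at hν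
        obtain ⟨rfl, rfl⟩ := List.append_inj hν (by simp [hsl])
        refine ⟨ν, ⟨hs, ?_⟩, by simp [List.range_add, hn, hn']⟩
        simpa [Function.comp_def] using ht

-- Inclusions between the algebra, Datalog and the block calculus

/-- Relational algebra with a unit relation can be expressed in Datalog. -/
theorem RAExpr.eval_withUnit_mem_datalogQueries [Nonempty D] {E : RAExpr (Option Rel) D}
    (hE : E.WF S.withUnit) {f : QueryFun S D} (hf : ∀ I : Database S D, E.eval I.withUnit = f I) :
    f ∈ datalogQueries S D (E.arity S.withUnit) := by
  obtain ⟨m, g, rs, h⟩ := RAExpr.exists_dlComputes hE 0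
  refine ⟨⟨rs, g⟩, ⟨?_, ?_, ?_, h.heads_nodup, ?_, h.goal_def _ List.mem_cons_self⟩, fun I =>
    (h.eval_eq _ List.mem_cons_self I _).trans (hf I)⟩
  · intro r hr
    obtain ⟨a, b, hab⟩ := List.append_of_mem hr
    exact (h.sorted.extends hab).safe
  · intro r hr
    obtain ⟨a, b, hab⟩ := List.append_of_mem hr
    exact (h.sorted.extends hab).edb
  · exact fun a r b hab => (h.sorted.extends hab).idb
  · exact (List.nodup_append.1 h.used_nodup).2.1

theorem RAExpr.eval_lift (I : Database S D) (E : RAExpr Rel D) :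
    E.lift.eval I.withUnit = E.eval I := by
  induction E with
  | rel R => rfl
  | _ => simp_all [lift, eval]

/-- An ordinary expression is one over the enlarged schema that does not mention the unit relation.
-/
theorem raQueries_subset_datalogQueries [Nonempty D] (n : ℕ) :
    raQueries S D n ⊆ datalogQueries S D n := by
  rintro f ⟨E, hE, rfl, hf⟩
  rw [← RAExpr.arity_lift]
  exact RAExpr.eval_withUnit_mem_datalogQueries (RAExpr.wf_lift hE)
    fun I => (RAExpr.eval_lift I E).trans (hf I)

/-- Here the unit relation itself serves as the unit. It is never empty, so Boolean queries need no
proviso. -/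
theorem bcQueries_subset_datalogQueries [Nonempty D] (n : ℕ) :
    bcQueries S D n ⊆ datalogQueries S D n := by
  rintro f ⟨Q, hQ, rfl, hf⟩
  obtain ⟨E, hE, hEa, hEe⟩ := BCQuery.exists_raExpr (S' := S.withUnit) (f := some) (fun _ => rfl)
    hQ (B := .rel none) trivial rfl
  rw [← hEa]
  exact RAExpr.eval_withUnit_mem_datalogQueries hE fun I =>
    ((hEe I I.withUnit fun _ => rfl).2 ⟨[], rfl⟩).trans (hf I)

/-- Queries with at least one table occurrence need no unit relation. -/
theorem bcQueries_subset_raQueries {n : ℕ} (hn : 1 ≤ n) : bcQueries S D n ⊆ raQueries S D n := by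
  rintro f ⟨Q, hQ, rfl, hf⟩
  -- An output column belongs to a table occurrence, so there is a first one. Its relation,
  -- projected on no columns, is the unit; if the relation is empty, the block has no choice of rows
  -- and the answer is empty on both sides.
  obtain ⟨R, hR⟩ : ∃ R, Q.rels.head? = some R := by
    obtain ⟨c, hc⟩ := List.exists_mem_of_length_pos (by omega : 0 < Q.out.length)
    obtain ⟨R, hR, -⟩ := hQ.2 c hc
    cases h : Q.rels with
    | nil => simp [h] at hR
    | cons R Rs => exact ⟨R, rfl⟩
  obtain ⟨E, hE, hEa, hEe⟩ := BCQuery.exists_raExpr (S' := S) (f := id) (fun _ => rfl)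
    hQ (B := .proj [] (.rel R)) ⟨trivial, by simp⟩ rfl
  refine ⟨E, hE, hEa, fun I => ?_⟩
  obtain ⟨h₁, h₂⟩ := hEe I I fun _ => rfl
  rcases Set.eq_empty_or_nonempty (I.rel R) with h | ⟨t, ht⟩
  · rw [h₁ (by simp [RAExpr.eval, h]), ← hf]
    symm
    rw [Set.eq_empty_iff_forall_notMem]
    rintro u ⟨rs, hrs, -⟩
    obtain ⟨Rs, hRs⟩ := List.head?_eq_some_iff.1 hR
    rw [hRs] at hrs
    cases hrs with
    | cons ht _ => simp [h] at ht
  · rw [h₂ ⟨[], t, ht, .nil⟩, hf]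

/-- Without output columns the list of table occurrences may be empty, so the unit has to come from
elsewhere: it is the projection of `T` on no columns. -/
theorem exists_raQueries_of_bcQueries (T : Rel) {f : QueryFun S D} (hf : f ∈ bcQueries S D 0) :
    ∃ g ∈ raQueries S D 0, ∀ I : Database S D, (I.rel T).Nonempty → g I = f I := by
  obtain ⟨Q, hQ, hn, hf⟩ := hf
  obtain ⟨E, hE, hEa, hEe⟩ := BCQuery.exists_raExpr (S' := S) (f := id) (fun _ => rfl)
    hQ (B := .proj [] (.rel T)) ⟨trivial, by simp⟩ rfl
  refine ⟨fun I => E.eval I, ⟨E, hE, hEa.trans hn, fun I => rfl⟩, ?_⟩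
  rintro I ⟨t, ht⟩
  exact ((hEe I I fun _ => rfl).2 ⟨[], t, ht, .nil⟩).trans (hf I)

end AlgebraToDatalog

/-! ## From Datalog to the block calculus -/

section DatalogToBlock

variable {Rel Attr D : Type*} {S : DBSchema Rel Attr}

theorem DLRule.Limited.mono {r : DLRule Rel D} {b b' : Prop} (hb : b → b') {x : ℕ}
    (h : r.Limited b x) : r.Limited b' x := by
  induction h with
  | atom h hx => exact .atom h hx
  | eqLeft h _ ih => exact .eqLeft h ih
  | eqRight h _ ih => exact .eqRight h ih
  | eqConst hc h => exact .eqConst (hb hc) h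

variable [LinearOrder D]

/-- A closed query can be used below any table occurrences. -/
theorem BCQuery.exists_weaken {Q : BCQuery Rel D} (hQ : Q.WF S []) (ctx : List Rel) :
    ∃ Q' : BCQuery Rel D, Q'.WF S ctx ∧
      ∀ (I : Database S D) (rows : List (List D)) (u : List D), RowsOf I ctx rows →
        (Q'.Yields I rows u ↔ Q.Yields I [] u) := by
  refine ⟨⟨Q.rels, Q.cond.shift ctx.length, Q.out.map fun c => (ctx.length + c.1, c.2)⟩,
    ⟨BCFormula.WF.shift hQ.1 ctx, ?_⟩, fun I rows u hr => ?_⟩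
  · intro c hc
    obtain ⟨c', hc', rfl⟩ := List.mem_map.1 hc
    exact ColIn.append_left (hQ.2 c' hc') ctx
  · have hl : ctx.length = rows.length := hr.length_eq
    simp only [BCQuery.Yields, hl, BCFormula.sat_shift, ColVals, List.forall₂_map_left_iff,
      colVal_append_left, List.nil_append]

/-- The query that returns the relation `R`. -/
theorem BCQuery.exists_rel (S : DBSchema Rel Attr) (R : Rel) :
    ∃ Q : BCQuery Rel D, Q.WF S [] ∧ Q.out.length = S.arity R ∧
      ∀ (I : Database S D) (u : List D), Q.Yields I [] u ↔ u ∈ I.rel R := by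
  refine ⟨⟨[R], .top, (List.range (S.arity R)).map (Prod.mk 0)⟩, ⟨trivial, ?_⟩, by simp,
    fun I u => ?_⟩
  · intro c hc
    obtain ⟨k, hk, rfl⟩ := List.mem_map.1 hc
    exact ⟨R, rfl, List.mem_range.1 hk⟩
  · have key : ∀ t ∈ I.rel R, ColVals [t] ((List.range (S.arity R)).map (Prod.mk 0)) t := by
      intro t ht
      rw [ColVals, List.forall₂_map_left_iff, ← I.length_eq R t ht]
      simpa [colVal] using forall₂_getElem?_range t []
    constructor
    · rintro ⟨rs, h, -, hu⟩
      cases h with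
      | cons ht h =>
        cases h
        rwa [forall₂_eq_some_unique hu (key _ ht)]
    · exact fun hu => ⟨[u], .cons hu .nil, trivial, key u hu⟩

/-- The query `Q` returns the tuples for which the atom `a` holds. -/
def DLAtom.ComputedBy (J : Database S D → ℕ → Set (List D)) (a : DLAtom Rel D)
    (Q : BCQuery Rel D) : Prop :=
  Q.WF S [] ∧ Q.out.length = a.args.length ∧ ∀ (I : Database S D) (ν : ℕ → D),
    a.Holds I (J I) ν ↔ Q.Yields I [] (a.args.map (DLTerm.val ν))

/-- Table occurrences from which the values of the variables of positive atoms are read off. -/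
theorem exists_front {J : Database S D → ℕ → Set (List D)} {as : List (DLAtom Rel D)}
    (h : ∀ a ∈ as, ∃ Q, a.ComputedBy J Q) :
    ∃ (front : List Rel) (col : ℕ → ℕ × ℕ),
      (∀ x, (∃ a ∈ as, DLTerm.var x ∈ a.args) → ColIn S front (col x)) ∧
      ∀ (I : Database S D) (ν : ℕ → D), (∀ a ∈ as, a.Holds I (J I) ν) →
        ∃ rows, RowsOf I front rows ∧
          ∀ x, (∃ a ∈ as, DLTerm.var x ∈ a.args) → colVal rows (col x) = some (ν x) := by
  classical
  induction as with
  | nil => exact ⟨[], fun _ => (0, 0), by simp, fun I ν _ => ⟨[], .nil, by simp⟩⟩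
  | cons a as ih =>
    obtain ⟨front, col, hcol, hrows⟩ := ih fun a ha => h a (List.mem_cons_of_mem _ ha)
    obtain ⟨Q, ⟨-, hQ⟩, hlen, hQe⟩ := h a List.mem_cons_self
    -- A variable of the atom is read from the output column at a position where it occurs. The pair
    -- `(0, 0)` is a dummy for the others.
    have hc : ∀ x, ∃ c : ℕ × ℕ, DLTerm.var x ∈ a.args → ColIn S Q.rels c ∧
        ∀ (rows : List (List D)) (ν : ℕ → D), ColVals rows Q.out (a.args.map (DLTerm.val ν)) →
          colVal rows c = some (ν x) := by
      intro x
      by_cases hx : DLTerm.var x ∈ a.args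
      · obtain ⟨i, hi, hix⟩ := List.mem_iff_getElem.1 hx
        have hi' : i < Q.out.length := hlen ▸ hi
        refine ⟨Q.out[i], fun _ => ⟨hQ _ (List.getElem_mem hi'), fun rows ν hv => ?_⟩⟩
        have := hv.get hi' (by simpa using hi)
        simpa [hix, DLTerm.val] using this
      · exact ⟨(0, 0), fun h => absurd h hx⟩
    choose c hc using hc
    -- A variable that also occurs in the other atoms keeps its column there. Neither the agreement
    -- with `a` nor the condition of `Q` is enforced: the front only offers candidate values, and
    -- the formula for the body checks them later.
    refine ⟨front ++ Q.rels, fun x => if ∃ a ∈ as, DLTerm.var x ∈ a.args then col x else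
      (front.length + (c x).1, (c x).2), fun x hx => ?_, fun I ν hν => ?_⟩
    · dsimp only
      split_ifs with hx'
      · exact (hcol x hx').append_right _
      · have hx : DLTerm.var x ∈ a.args := by
          obtain ⟨b, hb, hbx⟩ := hx
          rcases List.mem_cons.1 hb with rfl | hb
          · exact hbx
          · exact absurd ⟨b, hb, hbx⟩ hx'
        exact ColIn.append_left (hc x hx).1 _
    · obtain ⟨rows, hr, hv⟩ := hrows I ν fun a ha => hν a (List.mem_cons_of_mem _ ha)
      obtain ⟨rs, hrs, -, hu⟩ := (hQe I ν).1 (hν a List.mem_cons_self)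
      refine ⟨rows ++ rs, hr.append hrs, fun x hx => ?_⟩
      dsimp only
      split_ifs with hx'
      · rw [hr.colVal_append (hcol x hx'), hv x hx']
      · have hx : DLTerm.var x ∈ a.args := by
          obtain ⟨b, hb, hbx⟩ := hx
          rcases List.mem_cons.1 hb with rfl | hb
          · exact hbx
          · exact absurd ⟨b, hb, hbx⟩ hx'
        rw [show front.length = rows.length from hr.length_eq, colVal_append_left]
        exact (hc x hx).2 _ ν hu

/-- The term that represents a Datalog term if the variables are represented by `τ`. -/
def DLTerm.toBCTerm (τ : ℕ → BCTerm D) : DLTerm D → BCTerm D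
  | .var x => τ x
  | .const v => .const v

/-- The conjunction of subgoals, for variables that are represented by the terms `τ`. -/
theorem exists_formula_of_subgoals {J : Database S D → ℕ → Set (List D)}
    {ls : List (DLSubgoal Rel D)}
    (h : ∀ l ∈ ls, ∀ a, l.atom? = some a → ∃ Q, a.ComputedBy J Q) {ctx : List Rel}
    {τ : ℕ → BCTerm D} (hτ : ∀ l ∈ ls, ∀ x, l.Mentions x → (τ x).WF S ctx) :
    ∃ φ : BCFormula Rel D, φ.WF S ctx ∧
      ∀ (I : Database S D) (ν : ℕ → D) (rows : List (List D)), RowsOf I ctx rows →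
        (∀ l ∈ ls, ∀ x, l.Mentions x → (τ x).val rows = some (ν x)) →
        (φ.Sat I rows ↔ ∀ l ∈ ls, l.Holds I (J I) ν) := by
  have hatom : ∀ a : DLAtom Rel D, (∃ Q, a.ComputedBy J Q) →
      (∀ x, DLTerm.var x ∈ a.args → (τ x).WF S ctx) →
      ∃ φ : BCFormula Rel D, φ.WF S ctx ∧
        ∀ (I : Database S D) (ν : ℕ → D) (rows : List (List D)), RowsOf I ctx rows →
          (∀ x, DLTerm.var x ∈ a.args → (τ x).val rows = some (ν x)) →
          (φ.Sat I rows ↔ a.Holds I (J I) ν) := by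
    rintro a ⟨Q, hQ, -, hQe⟩ ha
    obtain ⟨Q', hQ', hQe'⟩ := BCQuery.exists_weaken hQ ctx
    obtain ⟨φ, hφ, hs⟩ := BCQuery.exists_mem hQ' (ts := a.args.map (DLTerm.toBCTerm τ)) (by
      intro t ht
      obtain ⟨s, hs, rfl⟩ := List.mem_map.1 ht
      cases s with
      | var x => exact ha x hs
      | const v => trivial)
    refine ⟨φ, hφ, fun I ν rows hr hv => ?_⟩
    rw [hs I rows (a.args.map (DLTerm.val ν)) hr, hQe' I rows _ hr, hQe]
    rw [List.forall₂_map_left_iff, List.forall₂_map_right_iff, List.forall₂_same]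
    intro s hs
    cases s with
    | var x => exact hv x hs
    | const v => rfl
  induction ls with
  | nil => exact ⟨.top, trivial, fun I ν rows _ _ => by simp [BCFormula.Sat]⟩
  | cons l ls ih =>
    obtain ⟨φ, hφ, hs⟩ := ih (fun l hl => h l (List.mem_cons_of_mem _ hl))
      fun l hl => hτ l (List.mem_cons_of_mem _ hl)
    have hl := hτ l List.mem_cons_self
    have hl' : ∃ ψ : BCFormula Rel D, ψ.WF S ctx ∧
        ∀ (I : Database S D) (ν : ℕ → D) (rows : List (List D)), RowsOf I ctx rows →
          (∀ x, l.Mentions x → (τ x).val rows = some (ν x)) →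
          (ψ.Sat I rows ↔ l.Holds I (J I) ν) := by
      cases l with
      | pos a => exact hatom a (h _ List.mem_cons_self a rfl) hl
      | neg a =>
        obtain ⟨ψ, hψ, hs⟩ := hatom a (h _ List.mem_cons_self a rfl) hl
        exact ⟨.not ψ, hψ, fun I ν rows hr hv => not_congr (hs I ν rows hr hv)⟩
      | builtin x op t =>
        have hval : ∀ (ν : ℕ → D) (rows : List (List D)),
            (∀ y, DLSubgoal.Mentions y (.builtin x op t : DLSubgoal Rel D) →
              (τ y).val rows = some (ν y)) →
            (t.toBCTerm τ).val rows = some (t.val ν) := by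
          intro ν rows hv
          cases t with
          | var y => exact hv y (.inr rfl)
          | const v => rfl
        obtain ⟨ψ, hψ, hs⟩ := BCFormula.exists_cmp (s := τ x) (t := t.toBCTerm τ)
          (hl x (.inl rfl)) (by
            cases t with
            | var y => exact hl y (.inr rfl)
            | const v => trivial) op
        refine ⟨ψ, hψ, fun I ν rows hr hv => ?_⟩
        rw [hs, hv x (.inl rfl), hval ν rows hv]
        simp [DLSubgoal.Holds]
    obtain ⟨ψ, hψ, hs'⟩ := hl'
    refine ⟨.and ψ φ, ⟨hψ, hφ⟩, fun I ν rows hr hv => ?_⟩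
    rw [List.forall_mem_cons] at hv ⊢
    exact and_congr (hs' I ν rows hr hv.1) (hs I ν rows hr hv.2)

/-- A rule is a block. The positive subgoals provide the table occurrences, safety represents each
variable by a column or a constant, and the condition restates the whole body, positive subgoals
included. The quantifier over valuations in `D` thereby becomes one over rows. -/
theorem DLRule.exists_bcQuery [Nonempty D] {J : Database S D → ℕ → Set (List D)}
    {r : DLRule Rel D} (hr : r.Safe)
    (h : ∀ l ∈ r.body, ∀ a, l.atom? = some a → ∃ Q, a.ComputedBy J Q) :
    ∃ Q : BCQuery Rel D, Q.WF S [] ∧ Q.out.length = r.args.length ∧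
      ∀ I, r.eval I (J I) = {u | Q.Yields I [] u} := by
  classical
  obtain ⟨d⟩ := ‹Nonempty D›
  let pos? : DLSubgoal Rel D → Option (DLAtom Rel D)
    | .pos a => some a
    | _ => none
  have hpos : ∀ a, a ∈ r.body.filterMap pos? ↔ DLSubgoal.pos a ∈ r.body := by
    intro a
    rw [List.mem_filterMap]
    constructor
    · rintro ⟨l, hl, ha⟩
      cases l <;> cases ha
      exact hl
    · exact fun ha => ⟨_, ha, rfl⟩
  obtain ⟨front, col, hcol, hrows⟩ := exists_front (J := J) (as := r.body.filterMap pos?)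
    fun a ha => h _ ((hpos a).1 ha) a rfl
  -- Induction along the chain of equalities, which passes the representing term on. If chains may
  -- not end in a constant, the term is a column, as an output requires.
  have hlim : ∀ (b : Prop) (x : ℕ), r.Limited b x → ∃ τ : BCTerm D, τ.WF S front ∧
      (¬ b → ∃ c, τ = .col c) ∧
      ∀ (I : Database S D) (ν : ℕ → D) (rows : List (List D)), RowsOf I front rows →
        (∀ x, (∃ a ∈ r.body.filterMap pos?, DLTerm.var x ∈ a.args) →
          colVal rows (col x) = some (ν x)) →
        (∀ l ∈ r.body, l.Holds I (J I) ν) → τ.val rows = some (ν x) := by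
    intro b x hx
    induction hx with
    | @atom a x ha hx =>
      have hx' : ∃ a ∈ r.body.filterMap pos?, DLTerm.var x ∈ a.args := ⟨a, (hpos a).2 ha, hx⟩
      exact ⟨.col (col x), hcol x hx', fun _ => ⟨_, rfl⟩, fun I ν rows _ hv _ => hv x hx'⟩
    | @eqLeft x y he _ ih =>
      obtain ⟨τ, hτ, hc, hv⟩ := ih
      refine ⟨τ, hτ, hc, fun I ν rows hr hv' hh => ?_⟩
      have hxy : ν x = ν y := hh _ he
      rw [hv I ν rows hr hv' hh, hxy]
    | @eqRight x y he _ ih =>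
      obtain ⟨τ, hτ, hc, hv⟩ := ih
      refine ⟨τ, hτ, hc, fun I ν rows hr hv' hh => ?_⟩
      have hxy : ν x = ν y := hh _ he
      rw [hv I ν rows hr hv' hh, hxy]
    | @eqConst x v hb he =>
      refine ⟨.const v, trivial, fun h => absurd hb h, fun I ν rows hr hv' hh => ?_⟩
      have hxv : ν x = v := hh _ he
      rw [hxv]
      rfl
  -- One choice of terms serves both the head and the body, so a column is preferred whenever the
  -- variable is limited without constants.
  have hlim' : ∀ x, ∃ τ : BCTerm D, r.Limited True x → τ.WF S front ∧
      (r.Limited False x → ∃ c, τ = .col c) ∧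
      ∀ (I : Database S D) (ν : ℕ → D) (rows : List (List D)), RowsOf I front rows →
        (∀ x, (∃ a ∈ r.body.filterMap pos?, DLTerm.var x ∈ a.args) →
          colVal rows (col x) = some (ν x)) →
        (∀ l ∈ r.body, l.Holds I (J I) ν) → τ.val rows = some (ν x) := by
    intro x
    by_cases hx : r.Limited False x
    · obtain ⟨τ, hτ, hc, hv⟩ := hlim _ x hx
      exact ⟨τ, fun _ => ⟨hτ, fun _ => hc id, hv⟩⟩
    · by_cases hx' : r.Limited True x
      · obtain ⟨τ, hτ, hc, hv⟩ := hlim _ x hx'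
        exact ⟨τ, fun _ => ⟨hτ, fun h => absurd h hx, hv⟩⟩
      · exact ⟨.const d, fun h => absurd h hx'⟩
  choose τ hτ using hlim'
  obtain ⟨φ, hφ, hs⟩ := exists_formula_of_subgoals h fun l hl x hx => (hτ x (hr.2 l hl x hx)).1
  have hout : ∀ x, ∃ c : ℕ × ℕ, x ∈ r.args → τ x = .col c := by
    intro x
    by_cases hx : x ∈ r.args
    · obtain ⟨c, hc⟩ := (hτ x ((hr.1 x hx).mono False.elim)).2.1 (hr.1 x hx)
      exact ⟨c, fun _ => hc⟩
    · exact ⟨(0, 0), fun h => absurd h hx⟩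
  choose out hout using hout
  have hargs : ∀ x ∈ r.args, r.Limited True x := fun x hx => (hr.1 x hx).mono False.elim
  have hcv : ∀ (ν : ℕ → D) (rows : List (List D)),
      (∀ x, r.Limited True x → (τ x).val rows = some (ν x)) →
      ColVals rows (r.args.map out) (r.args.map ν) := by
    intro ν rows hv
    rw [ColVals, List.forall₂_map_left_iff, List.forall₂_map_right_iff, List.forall₂_same]
    intro x hx
    have := hv x (hargs x hx)
    rwa [hout x hx] at this
  refine ⟨⟨front, φ, r.args.map out⟩, ⟨hφ, fun c hc => ?_⟩, by simp, fun I => ?_⟩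
  · obtain ⟨x, hx, rfl⟩ := List.mem_map.1 hc
    have := (hτ x (hargs x hx)).1
    rwa [hout x hx] at this
  · ext u
    constructor
    · rintro ⟨ν, hν, rfl⟩
      obtain ⟨rows, hrw, hv⟩ := hrows I ν fun a ha => hν _ ((hpos a).1 ha)
      have hall : ∀ x, r.Limited True x → (τ x).val rows = some (ν x) :=
        fun x hx => (hτ x hx).2.2 I ν rows hrw hv hν
      exact ⟨rows, hrw, (hs I ν rows hrw fun l hl x hx => hall x (hr.2 l hl x hx)).2 hν,
        hcv ν rows hall⟩
    · rintro ⟨rows, hrw, hsat, hu⟩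
      have hall : ∀ x, r.Limited True x →
          (τ x).val rows = some (((τ x).val rows).getD d) := by
        intro x hx
        obtain ⟨v, hv⟩ := hrw.val_eq_some (hτ x hx).1
        rw [hv]
        rfl
      -- The valuation is read from the rows. By `hall` the default `d` is not needed for limited
      -- variables, and all variables of the rule are limited.
      exact ⟨fun x => ((τ x).val rows).getD d,
        (hs I _ rows hrw fun l hl x hx => hall x (hr.2 l hl x hx)).1 hsat,
        forall₂_eq_some_unique hu (hcv _ rows hall)⟩

/-- Induction along the topological order: the IDB atoms of a body are already computed by closed
queries, which are substituted. A value once computed is final, as no two rules share a head. -/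
theorem datalogQueries_subset_bcQueries [Nonempty D] (n : ℕ) :
    datalogQueries S D n ⊆ bcQueries S D n := by
  rintro f ⟨P, hP, hf⟩
  have key : ∀ pre suf, P.rules = pre ++ suf → ∀ r ∈ pre, ∃ Q : BCQuery Rel D, Q.WF S [] ∧
      Q.out.length = r.args.length ∧ ∀ I : Database S D,
        pre.foldl (fun J r => Function.update J r.head (r.eval I J)) (fun _ => ∅) r.head =
          {u | Q.Yields I [] u} := by
    intro pre
    induction pre using List.reverseRecOn with
    | nil => simp
    | append_singleton pre r ih =>
      intro suf hsuf
      rw [List.append_assoc, List.singleton_append] at hsuf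
      have ih := ih _ hsuf
      have hrP : r ∈ P.rules := by simp [hsuf]
      intro r' hr'
      rcases List.mem_append.1 hr' with hr' | hr'
      · obtain ⟨Q, hQ, hQl, hQe⟩ := ih r' hr'
        refine ⟨Q, hQ, hQl, fun I => ?_⟩
        have hne : r'.head ≠ r.head := by
          have := hP.head_once
          rw [hsuf, List.map_append, List.nodup_append] at this
          exact this.2.2 _ (List.mem_map_of_mem hr') _ (by simp)
        rw [List.foldl_append, ← hQe I]
        simp [Function.update_of_ne hne]
      · rw [List.mem_singleton.1 hr']
        obtain ⟨Q, hQ, hQl, hQe⟩ := DLRule.exists_bcQuery (S := S) (J := fun I =>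
          pre.foldl (fun J r => Function.update J r.head (r.eval I J)) fun _ => ∅)
          (hP.safe r hrP) (by
            intro l hl a ha
            rcases hp : a.pred with R | p
            · obtain ⟨Q, hQ, hQl, hQe⟩ := BCQuery.exists_rel (D := D) S R
              refine ⟨Q, hQ, hQl.trans (hP.edb_arity r hrP l hl a ha R hp).symm, fun I ν => ?_⟩
              simp [DLAtom.Holds, hp, hQe]
            · obtain ⟨r₁, hr₁, rfl, hlen⟩ := hP.topological pre r suf hsuf l hl a ha p hp
              obtain ⟨Q, hQ, hQl, hQe⟩ := ih r₁ hr₁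
              refine ⟨Q, hQ, hQl.trans hlen, fun I ν => ?_⟩
              simp [DLAtom.Holds, hp, hQe])
        refine ⟨Q, hQ, hQl, fun I => ?_⟩
        rw [List.foldl_append, ← hQe I]
        simp
  obtain ⟨r, hr, hrg, hrn⟩ := hP.goal_def
  obtain ⟨Q, hQ, hQl, hQe⟩ := key P.rules [] (by simp) r hr
  refine ⟨Q, hQ, hQl.trans hrn, fun I => ?_⟩
  rw [← hQe I, hrg, ← hf I]
  rfl

end DatalogToBlock

/-! ## Tuple relational calculus and the block calculus -/

section TupleCalculus

variable {Rel Attr D : Type*} {S : DBSchema Rel Attr}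

/-- Attribute names are pairwise distinct, so a name determines its position. -/
theorem DBSchema.attrVal_iff {R : Rel} {A : Attr} {k : ℕ} (hk : (S.attrs R)[k]? = some A)
    (t : List D) (v : D) : S.AttrVal R t A v ↔ t[k]? = some v := by
  constructor
  · rintro ⟨k', hk', hv⟩
    obtain ⟨h, hA⟩ := List.getElem?_eq_some_iff.1 hk
    obtain ⟨h', hA'⟩ := List.getElem?_eq_some_iff.1 hk'
    rwa [(S.nodup R).getElem_inj_iff.1 (hA.trans hA'.symm)]
  · exact fun h => ⟨k, hk, h⟩

theorem DBSchema.exists_attr {R : Rel} {k : ℕ} (hk : k < S.arity R) :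
    ∃ A, (S.attrs R)[k]? = some A ∧ A ∈ S.attrs R :=
  ⟨_, List.getElem?_eq_getElem hk, List.getElem_mem hk⟩

theorem DBSchema.exists_pos {R : Rel} {A : Attr} (hA : A ∈ S.attrs R) :
    ∃ k, (S.attrs R)[k]? = some A ∧ k < S.arity R := by
  obtain ⟨k, hk, rfl⟩ := List.mem_iff_getElem.1 hA
  exact ⟨k, List.getElem?_eq_getElem hk, hk⟩

theorem colVals_range_iff {n : ℕ} {oc : ℕ → ℕ × ℕ} {rows : List (List D)} {q : List D} :
    ColVals rows ((List.range n).map oc) q ↔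
      q.length = n ∧ ∀ i < n, colVal rows (oc i) = q[i]? := by
  rw [ColVals, List.forall₂_map_left_iff, List.forall₂_iff_get]
  constructor
  · rintro ⟨hl, h⟩
    rw [List.length_range] at hl
    refine ⟨hl.symm, fun i hi => ?_⟩
    have := h i (by simpa using hi) (hl ▸ hi)
    simpa [hl ▸ hi] using this
  · rintro ⟨rfl, h⟩
    refine ⟨by simp, fun i _ hi => ?_⟩
    simpa [hi] using h i hi

theorem exists_col_of_trcVal {Γ : ℕ → Option Rel} {ctx : List Rel} {m : ℕ → ℕ}
    (hm : ∀ r R, Γ r = some R → ctx[m r]? = some R) {r : ℕ} {A : Attr}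
    (h : ∃ R, Γ r = some R ∧ A ∈ S.attrs R) :
    ∃ c, ColIn S ctx c ∧ ∀ (η : ℕ → Option (Rel × List D)) (rows : List (List D)),
      (∀ r R, Γ r = some R → ∃ t, η r = some (R, t) ∧ rows[m r]? = some t) →
      ∀ v, trcVal S η r A v ↔ colVal rows c = some v := by
  obtain ⟨R, hR, hA⟩ := h
  obtain ⟨k, hk, hlt⟩ := DBSchema.exists_pos hA
  refine ⟨(m r, k), ⟨R, hm r R hR, hlt⟩, fun η rows hη v => ?_⟩
  obtain ⟨t, ht, hrt⟩ := hη r R hR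
  simp [trcVal, ht, colVal, hrt, DBSchema.attrVal_iff hk]

/-- The environment in which the table variables are the numbers of the table occurrences. -/
def trcEnv (ctx : List Rel) (rows : List (List D)) (r : ℕ) : Option (Rel × List D) :=
  ctx[r]?.bind fun R => rows[r]?.map (Prod.mk R)

/-- If the next free number names a new variable, binding it amounts to appending to the list. No
shadowing arises. -/
theorem update_getElem? {α : Type*} (l : List α) (a : α) :
    Function.update (fun r => l[r]?) l.length (some a) = fun r => (l ++ [a])[r]? := by
  ext1 r
  rcases lt_trichotomy r l.length with h | rfl | h
  · rw [Function.update_of_ne h.ne, List.getElem?_append_left h]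
  · simp
  · rw [Function.update_of_ne h.ne', List.getElem?_eq_none h.le,
      List.getElem?_eq_none (by simp; omega)]

theorem update_trcEnv {ctx : List Rel} {rows : List (List D)} (h : ctx.length = rows.length)
    (R : Rel) (t : List D) :
    Function.update (trcEnv ctx rows) ctx.length (some (R, t)) =
      trcEnv (ctx ++ [R]) (rows ++ [t]) := by
  ext1 r
  have h₁ := congrFun (update_getElem? ctx R) r
  have h₂ := congrFun (update_getElem? rows t) r
  rw [trcEnv, ← h₁, ← h₂, ← h]
  by_cases hr : r = ctx.length
  · subst hr
    simp
  · simp [Function.update_of_ne hr, trcEnv]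

theorem ColIn.exists_trc {ctx : List Rel} {c : ℕ × ℕ} (hc : ColIn S ctx c) :
    ∃ A, (∃ R, ctx[c.1]? = some R ∧ A ∈ S.attrs R) ∧
      ∀ (rows : List (List D)) (v : D),
        trcVal S (trcEnv ctx rows) c.1 A v ↔ colVal rows c = some v := by
  obtain ⟨R, hR, hlt⟩ := hc
  obtain ⟨A, hk, hA⟩ := DBSchema.exists_attr hlt
  refine ⟨A, ⟨R, hR, hA⟩, fun rows v => ?_⟩
  cases h : rows[c.1]? with
  | none => simp [trcVal, trcEnv, hR, colVal, h]
  | some t => simp [trcVal, trcEnv, hR, colVal, h, DBSchema.attrVal_iff hk]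

-- From the tuple calculus to blocks

variable [LinearOrder D]

/-- The map `m` sends a table variable to the occurrence it currently denotes, and output attribute
`i` is represented by the column `oc i`. An output predicate then is an ordinary equality of
columns, also below negations. -/
theorem TRCFormula.exists_bcFormula {n : ℕ} {φ : TRCFormula Rel Attr D} {Γ : ℕ → Option Rel}
    (hφ : φ.WF S n Γ) {ctx : List Rel} {m : ℕ → ℕ}
    (hm : ∀ r R, Γ r = some R → ctx[m r]? = some R) {oc : ℕ → ℕ × ℕ}
    (ho : ∀ i < n, ColIn S ctx (oc i)) :
    ∃ ψ : BCFormula Rel D, ψ.WF S ctx ∧ ∀ (I : Database S D) (q : List D)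
      (η : ℕ → Option (Rel × List D)) (rows : List (List D)), RowsOf I ctx rows →
      (∀ r R, Γ r = some R → ∃ t, η r = some (R, t) ∧ rows[m r]? = some t) →
      (∀ i < n, colVal rows (oc i) = q[i]?) → (ψ.Sat I rows ↔ φ.Sat I q η) := by
  induction φ generalizing Γ ctx m with
  | top => exact ⟨.top, trivial, fun _ _ _ _ _ _ _ => Iff.rfl⟩
  | joinPred r A op s B =>
    obtain ⟨c, hc, hce⟩ := exists_col_of_trcVal (D := D) hm hφ.1
    obtain ⟨c', hc', hce'⟩ := exists_col_of_trcVal (D := D) hm hφ.2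
    refine ⟨.cmp c op (.col c'), ⟨hc, hc'⟩, fun I q η rows _ hη _ => ?_⟩
    simp only [Sat, BCFormula.Sat, BCTerm.val, hce η rows hη, hce' η rows hη]
  | selPred r A op v =>
    obtain ⟨c, hc, hce⟩ := exists_col_of_trcVal (D := D) hm hφ
    refine ⟨.cmp c op (.const v), ⟨hc, trivial⟩, fun I q η rows _ hη _ => ?_⟩
    simp [Sat, BCFormula.Sat, BCTerm.val, hce η rows hη]
  | out i r A =>
    obtain ⟨c, hc, hce⟩ := exists_col_of_trcVal (D := D) hm hφ.2
    refine ⟨.cmp (oc i) .eq (.col c), ⟨ho i hφ.1, hc⟩, fun I q η rows _ hη hq => ?_⟩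
    simp only [Sat, BCFormula.Sat, BCTerm.val, hce η rows hη, hq i hφ.1, CmpOp.Holds]
    constructor
    · rintro ⟨x, y, hx, hy, rfl⟩
      exact ⟨x, hx, hy⟩
    · rintro ⟨x, hx, hy⟩
      exact ⟨x, x, hx, hy, rfl⟩
  | and φ ψ ih₁ ih₂ =>
    obtain ⟨φ', hφ', h₁⟩ := ih₁ hφ.1 hm ho
    obtain ⟨ψ', hψ', h₂⟩ := ih₂ hφ.2 hm ho
    exact ⟨.and φ' ψ', ⟨hφ', hψ'⟩, fun I q η rows hr hη hq =>
      and_congr (h₁ I q η rows hr hη hq) (h₂ I q η rows hr hη hq)⟩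
  | ex r R φ ih =>
    -- Requantifying a variable redirects `m` to the new occurrence; the shadowed one stays in the
    -- scope without a name.
    obtain ⟨φ', hφ', h⟩ := ih (ctx := ctx ++ [R]) (m := Function.update m r ctx.length) hφ (by
      intro r' R' hR'
      by_cases hrr : r' = r
      · subst hrr
        simpa using hR'
      · rw [Function.update_of_ne hrr] at hR' ⊢
        have := hm r' R' hR'
        rwa [List.getElem?_append_left (List.getElem?_eq_some_iff.1 this).1])
      fun i hi => (ho i hi).append_right _
    refine ⟨.ex R φ', hφ', fun I q η rows hr hη hq => ?_⟩
    refine exists_congr fun t => and_congr_right fun ht => ?_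
    refine h I q _ _ (hr.snoc ht) ?_ fun i hi => by rw [hr.colVal_append (ho i hi), hq i hi]
    intro r' R' hR'
    by_cases hrr : r' = r
    · subst hrr
      have hRR : R = R' := by simpa using hR'
      subst hRR
      refine ⟨t, by simp, ?_⟩
      rw [Function.update_self, show ctx.length = rows.length from hr.length_eq]
      simp
    · rw [Function.update_of_ne hrr] at hR'
      rw [Function.update_of_ne hrr, Function.update_of_ne hrr]
      obtain ⟨t', ht', htr⟩ := hη r' R' hR'
      refine ⟨t', ht', ?_⟩
      rwa [List.getElem?_append_left (List.getElem?_eq_some_iff.1 htr).1]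
  | not φ ih =>
    obtain ⟨φ', hφ', h⟩ := ih (Γ := Γ) hφ hm ho
    exact ⟨.not φ', hφ', fun I q η rows hr hη hq => not_congr (h I q η rows hr hη hq)⟩

/-- An output attribute takes its values from a column of some relation. -/
theorem TRCFormula.Outputs.exists_col {n i : ℕ} {φ : TRCFormula Rel Attr D}
    {Γ : ℕ → Option Rel} (hφ : φ.WF S n Γ) (hi : φ.Outputs i) :
    ∃ (R : Rel) (k : ℕ), k < S.arity R ∧ ∀ (I : Database S D) (q : List D)
      (η : ℕ → Option (Rel × List D)),
      (∀ r R, Γ r = some R → ∃ t ∈ I.rel R, η r = some (R, t)) → φ.Sat I q η →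
      ∃ t ∈ I.rel R, t[k]? = q[i]? := by
  induction φ generalizing Γ with
  | out j r A =>
    cases hi
    obtain ⟨-, R, hR, hA⟩ := hφ
    obtain ⟨k, hk, hlt⟩ := DBSchema.exists_pos hA
    refine ⟨R, k, hlt, ?_⟩
    rintro I q η hη ⟨x, hx, R', t, ht, hv⟩
    obtain ⟨t', hm, ht'⟩ := hη r R hR
    rw [ht] at ht'
    cases ht'
    exact ⟨t, hm, by rw [hx, (DBSchema.attrVal_iff hk _ _).1 hv]⟩
  | and φ ψ ih₁ ih₂ =>
    rcases hi with hi | hi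
    · obtain ⟨R, k, hlt, h⟩ := ih₁ hφ.1 hi
      exact ⟨R, k, hlt, fun I q η hη hs => h I q η hη hs.1⟩
    · obtain ⟨R, k, hlt, h⟩ := ih₂ hφ.2 hi
      exact ⟨R, k, hlt, fun I q η hη hs => h I q η hη hs.2⟩
  | ex r R φ ih =>
    obtain ⟨R', k, hlt, h⟩ := ih hφ hi
    refine ⟨R', k, hlt, ?_⟩
    rintro I q η hη ⟨t, ht, hs⟩
    refine h I q _ ?_ hs
    intro r' R'' hR''
    by_cases hrr : r' = r
    · subst hrr
      have hRR : R = R'' := by simpa using hR''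
      subst hRR
      exact ⟨t, ht, by simp⟩
    · rw [Function.update_of_ne hrr] at hR'' ⊢
      exact hη r' R'' hR''
  | _ => exact hi.elim

/-- The column that defines an output may be bound deep inside the formula, out of reach of the
output list. So the block ranges over one extra occurrence per output attribute, of the relation
where safety locates its values, and the formula becomes the condition. -/
theorem trcQueries_subset_bcQueries [Nonempty Rel] (n : ℕ) :
    trcQueries S D n ⊆ bcQueries S D n := by
  rintro f ⟨φ, hφ, -, hout, hf⟩
  obtain ⟨R₀⟩ := ‹Nonempty Rel›
  have hcol : ∀ i, ∃ (R : Rel) (k : ℕ), i < n → k < S.arity R ∧ ∀ (I : Database S D)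
      (q : List D), φ.Sat I q (fun _ => none) → ∃ t ∈ I.rel R, t[k]? = q[i]? := by
    intro i
    by_cases hi : i < n
    · obtain ⟨R, k, hk, h⟩ := TRCFormula.Outputs.exists_col hφ (hout i hi)
      exact ⟨R, k, fun _ => ⟨hk, fun I q hs => h I q _ (by simp) hs⟩⟩
    -- A dummy for numbers that are not output attributes.
    · exact ⟨R₀, 0, fun h => absurd h hi⟩
  choose Rf kf hcol using hcol
  have hoc : ∀ i < n, ColIn S ((List.range n).map Rf) (i, kf i) :=
    fun i hi => ⟨Rf i, by simp [hi], (hcol i hi).1⟩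
  obtain ⟨ψ, hψ, hs⟩ := TRCFormula.exists_bcFormula hφ (ctx := (List.range n).map Rf)
    (m := id) (by simp) (oc := fun i => (i, kf i)) hoc
  refine ⟨⟨(List.range n).map Rf, ψ, (List.range n).map fun i => (i, kf i)⟩,
    ⟨hψ, fun c hc => ?_⟩, by simp, fun I => ?_⟩
  · obtain ⟨i, hi, rfl⟩ := List.mem_map.1 hc
    exact hoc i (List.mem_range.1 hi)
  · rw [← hf I]
    ext q
    constructor
    · rintro ⟨rows, hr, hsat, hv⟩
      obtain ⟨hl, hv⟩ := colVals_range_iff.1 hv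
      exact ⟨hl, (hs I q _ rows hr (by simp) hv).1 hsat⟩
    · rintro ⟨hl, hsat⟩
      have ht : ∀ i, ∃ t, i < n → t ∈ I.rel (Rf i) ∧ t[kf i]? = q[i]? := by
        intro i
        by_cases hi : i < n
        · obtain ⟨t, ht, h⟩ := (hcol i hi).2 I q hsat
          exact ⟨t, fun _ => ⟨ht, h⟩⟩
        · exact ⟨[], fun h => absurd h hi⟩
      choose t ht using ht
      have hr : RowsOf I ((List.range n).map Rf) ((List.range n).map t) := by
        rw [RowsOf, List.forall₂_map_left_iff, List.forall₂_map_right_iff, List.forall₂_same]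
        exact fun i hi => (ht i (List.mem_range.1 hi)).1
      have hv : ∀ i < n, colVal ((List.range n).map t) (i, kf i) = q[i]? := by
        intro i hi
        simp [colVal, hi, (ht i hi).2]
      exact ⟨_, hr, (hs I q _ _ hr (by simp) hv).2 hsat, colVals_range_iff.2 ⟨hl, hv⟩⟩

-- Guards, and from blocks to the tuple calculus

/-- Every comparison refers, on its left-hand side, to a table occurrence introduced inside the
same negation scope: here `d` occurrences are in scope, and those from number `b` on are local. -/
def BCFormula.Guarded : ℕ → ℕ → BCFormula Rel D → Prop
  | _, _, .top => True
  | b, _, .cmp c _ _ => b ≤ c.1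
  | b, d, .and φ ψ => φ.Guarded b d ∧ ψ.Guarded b d
  | b, d, .ex _ φ => φ.Guarded b (d + 1)
  | _, d, .not φ => φ.Guarded d d

/-- Comparisons can be guarded by a local copy of the table occurrence on the left. -/
theorem BCFormula.exists_guarded {φ : BCFormula Rel D} {ctx : List Rel} (hφ : φ.WF S ctx) :
    ∃ ψ : BCFormula Rel D, ψ.WF S ctx ∧ (∀ b ≤ ctx.length, ψ.Guarded b ctx.length) ∧
      ∀ (I : Database S D) (rows : List (List D)), RowsOf I ctx rows →
        (ψ.Sat I rows ↔ φ.Sat I rows) := by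
  induction φ generalizing ctx with
  | top => exact ⟨.top, trivial, fun _ _ => trivial, fun _ _ _ => Iff.rfl⟩
  | cmp c op t =>
    obtain ⟨hc, ht⟩ := hφ
    obtain ⟨R, hR, hlt⟩ := id hc
    have hnew : ColIn S (ctx ++ [R]) (ctx.length, c.2) := ColIn.snoc hlt
    -- Both comparisons have the new occurrence on the left and so are guarded. The row of `c`
    -- itself witnesses the quantifier.
    refine ⟨.ex R (.and (.cmp (ctx.length, c.2) .eq (.col c)) (.cmp (ctx.length, c.2) op t)),
      ⟨⟨hnew, hc.append_right _⟩, hnew, ht.append_right _⟩, fun b hb => ⟨hb, hb⟩,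
      fun I rows hr => ?_⟩
    have hval : ∀ s : List D, colVal (rows ++ [s]) (ctx.length, c.2) = s[c.2]? := by
      intro s
      rw [show ctx.length = rows.length from hr.length_eq]
      simp [colVal]
    have hcol : ∀ rows, (BCTerm.col c : BCTerm D).val rows = colVal rows c := fun _ => rfl
    simp only [Sat, hcol, hval, hr.colVal_append hc, hr.val_append ht, CmpOp.Holds]
    constructor
    · rintro ⟨s, -, ⟨x, y, hx, hy, rfl⟩, x', y', hx', hy', h⟩
      rw [hx] at hx'
      cases hx'
      exact ⟨x, y', hy, hy', h⟩
    · rintro ⟨x, y, hx, hy, h⟩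
      obtain ⟨s, hs, hm⟩ := hr.get hR
      have hsx : s[c.2]? = some x := by simpa [colVal, hs] using hx
      exact ⟨s, hm, ⟨x, x, hsx, hx, rfl⟩, x, y, hsx, hy, h⟩
  | and φ ψ ih₁ ih₂ =>
    obtain ⟨φ', hφ', hg₁, h₁⟩ := ih₁ hφ.1
    obtain ⟨ψ', hψ', hg₂, h₂⟩ := ih₂ hφ.2
    exact ⟨.and φ' ψ', ⟨hφ', hψ'⟩, fun b hb => ⟨hg₁ b hb, hg₂ b hb⟩,
      fun I rows hr => and_congr (h₁ I rows hr) (h₂ I rows hr)⟩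
  | ex R φ ih =>
    obtain ⟨φ', hφ', hg, h⟩ := ih hφ
    rw [List.length_append, List.length_singleton] at hg
    exact ⟨.ex R φ', hφ', fun b hb => hg b (by omega), fun I rows hr =>
      exists_congr fun t => and_congr_right fun ht => h I _ (hr.snoc ht)⟩
  | not φ ih =>
    obtain ⟨φ', hφ', hg, h⟩ := ih (ctx := ctx) hφ
    -- Below a negation no occurrence is local yet, which is the case `b = ctx.length`; hence the
    -- claim for all `b`.
    exact ⟨.not φ', hφ', fun b hb => hg _ le_rfl, fun I rows hr => not_congr (h I rows hr)⟩

/-- Occurrence number `r` becomes the table variable `r`. Any `L` that contains the numbers from `b`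
on accepts the left-hand side of every comparison as a guard. -/
theorem BCFormula.Guarded.exists_trc (n : ℕ) {φ : BCFormula Rel D} {ctx : List Rel} {b : ℕ}
    (hφ : φ.WF S ctx) (hg : φ.Guarded b ctx.length) :
    ∃ ψ : TRCFormula Rel Attr D, ψ.WF S n (fun r => ctx[r]?) ∧
      (∀ L : Set ℕ, (∀ r, b ≤ r → r < ctx.length → r ∈ L) → ψ.Guarded L) ∧
      ∀ (I : Database S D) (q : List D) (rows : List (List D)), RowsOf I ctx rows →
        (ψ.Sat I q (trcEnv ctx rows) ↔ φ.Sat I rows) := by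
  induction φ generalizing ctx b with
  | top => exact ⟨.top, trivial, fun _ _ => trivial, fun _ _ _ _ => Iff.rfl⟩
  | cmp c op t =>
    obtain ⟨A, hA, hAv⟩ := hφ.1.exists_trc (D := D)
    have hL : ∀ L : Set ℕ, (∀ r, b ≤ r → r < ctx.length → r ∈ L) → c.1 ∈ L := by
      obtain ⟨R, hR, -⟩ := hφ.1
      exact fun L hL => hL _ hg (List.getElem?_eq_some_iff.1 hR).1
    cases t with
    | col c' =>
      obtain ⟨A', hA', hAv'⟩ := ColIn.exists_trc (D := D) (c := c') hφ.2
      refine ⟨.joinPred c.1 A op c'.1 A', ⟨hA, hA'⟩, fun L h => .inl (hL L h),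
        fun I q rows _ => ?_⟩
      simp only [Sat, TRCFormula.Sat, hAv, hAv', BCTerm.val]
    | const v =>
      refine ⟨.selPred c.1 A op v, hA, hL, fun I q rows _ => ?_⟩
      simp [Sat, TRCFormula.Sat, hAv, BCTerm.val]
  | and φ ψ ih₁ ih₂ =>
    obtain ⟨φ', hφ', hg₁, h₁⟩ := ih₁ hφ.1 hg.1
    obtain ⟨ψ', hψ', hg₂, h₂⟩ := ih₂ hφ.2 hg.2
    exact ⟨.and φ' ψ', ⟨hφ', hψ'⟩, fun L hL => ⟨hg₁ L hL, hg₂ L hL⟩,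
      fun I q rows hr => and_congr (h₁ I q rows hr) (h₂ I q rows hr)⟩
  | ex R φ ih =>
    obtain ⟨φ', hφ', hg', h⟩ := ih (b := b) hφ (by
      rw [List.length_append, List.length_singleton]
      exact hg)
    refine ⟨.ex ctx.length R φ', ?_, fun L hL => hg' _ fun r hb hr => ?_, fun I q rows hr => ?_⟩
    · rw [TRCFormula.WF, update_getElem?]
      exact hφ'
    · rw [List.length_append, List.length_singleton] at hr
      rcases (by omega : r = ctx.length ∨ r < ctx.length) with rfl | hr
      · exact Set.mem_insert _ _
      · exact Set.mem_insert_of_mem _ (hL r hb hr)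
    · refine exists_congr fun t => and_congr_right fun ht => ?_
      rw [update_trcEnv hr.length_eq]
      exact h I q _ (hr.snoc ht)
  | not φ ih =>
    obtain ⟨φ', hφ', hg', h⟩ := ih (ctx := ctx) (b := ctx.length) hφ hg
    exact ⟨.not φ', hφ', fun L hL => hg' ∅ fun r h₁ h₂ => by omega,
      fun I q rows hr => not_congr (h I q rows hr)⟩

/-- The conjunction of output predicates for the attributes from number `i` on. -/
theorem exists_trc_outputs {n : ℕ} {ctx : List Rel} {cs : List (ℕ × ℕ)}
    (hcs : ∀ c ∈ cs, ColIn S ctx c) {i : ℕ} (hi : i + cs.length ≤ n) :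
    ∃ ψ : TRCFormula Rel Attr D, ψ.WF S n (fun r => ctx[r]?) ∧
      (∀ L : Set ℕ, (∀ r < ctx.length, r ∈ L) → ψ.Guarded L) ∧
      (∀ j < cs.length, ψ.Outputs (i + j)) ∧
      ∀ (I : Database S D) (q u : List D) (rows : List (List D)), q.length = i →
        u.length = cs.length →
        (ψ.Sat I (q ++ u) (trcEnv ctx rows) ↔ ColVals rows cs u) := by
  induction cs generalizing i with
  | nil =>
    refine ⟨.top, trivial, fun _ _ => trivial, by simp, fun I q u rows _ hu => ?_⟩
    rw [List.length_nil, List.length_eq_zero_iff] at hu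
    subst hu
    simp [TRCFormula.Sat, ColVals]
  | cons c cs ih =>
    rw [List.length_cons] at hi
    obtain ⟨ψ, hψ, hg, ho, h⟩ := ih (fun c hc => hcs c (List.mem_cons_of_mem _ hc))
      (i := i + 1) (by omega)
    have hc := hcs c List.mem_cons_self
    obtain ⟨A, hA, hAv⟩ := hc.exists_trc (D := D)
    refine ⟨.and (.out i c.1 A) ψ, ⟨⟨by omega, hA⟩, hψ⟩, fun L hL => ⟨?_, hg L hL⟩,
      fun j hj => ?_, fun I q u rows hq hu => ?_⟩
    · obtain ⟨R, hR, -⟩ := hc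
      exact hL _ (List.getElem?_eq_some_iff.1 hR).1
    · cases j with
      | zero => exact .inl rfl
      | succ j =>
        refine .inr ?_
        rw [show i + (j + 1) = i + 1 + j by omega]
        exact ho j (by simpa using hj)
    · cases u with
      | nil => simp at hu
      | cons v u =>
        have := h I (q ++ [v]) u rows (by simp [hq]) (by simpa using hu)
        rw [List.append_assoc, List.singleton_append] at this
        simp only [TRCFormula.Sat, this, ColVals, List.forall₂_cons, hAv]
        refine and_congr ?_ Iff.rfl
        subst hq
        simp

/-- Quantification over several table variables. -/
theorem exists_trc_exs {n : ℕ} {ctx Rs : List Rel} {ψ : TRCFormula Rel Attr D}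
    (hψ : ψ.WF S n (fun r => (ctx ++ Rs)[r]?))
    (hg : ∀ L : Set ℕ, (∀ r < (ctx ++ Rs).length, r ∈ L) → ψ.Guarded L) :
    ∃ ψ' : TRCFormula Rel Attr D, ψ'.WF S n (fun r => ctx[r]?) ∧
      (∀ L : Set ℕ, (∀ r < ctx.length, r ∈ L) → ψ'.Guarded L) ∧
      (∀ j, ψ.Outputs j → ψ'.Outputs j) ∧
      ∀ (I : Database S D) (q : List D) (rows : List (List D)), RowsOf I ctx rows →
        (ψ'.Sat I q (trcEnv ctx rows) ↔
          ∃ rs, RowsOf I Rs rs ∧ ψ.Sat I q (trcEnv (ctx ++ Rs) (rows ++ rs))) := by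
  induction Rs generalizing ctx with
  | nil =>
    rw [List.append_nil] at hψ hg
    refine ⟨ψ, hψ, hg, fun _ => id, fun I q rows _ => ?_⟩
    simp [RowsOf]
  | cons R Rs ih =>
    obtain ⟨ψ', hψ', hg', ho, h⟩ := ih (ctx := ctx ++ [R]) (by simpa using hψ) (by simpa using hg)
    refine ⟨.ex ctx.length R ψ', ?_, fun L hL => hg' _ fun r hr => ?_, ho,
      fun I q rows hr => ?_⟩
    · rw [TRCFormula.WF, update_getElem?]
      exact hψ'
    · rw [List.length_append, List.length_singleton] at hr
      rcases (by omega : r = ctx.length ∨ r < ctx.length) with rfl | hr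
      · exact Set.mem_insert _ _
      · exact Set.mem_insert_of_mem _ (hL r hr)
    · simp only [TRCFormula.Sat, update_trcEnv hr.length_eq]
      constructor
      · rintro ⟨t, ht, hs⟩
        obtain ⟨rs, hrs, hs⟩ := (h I q _ (hr.snoc ht)).1 hs
        exact ⟨t :: rs, .cons ht hrs, by simpa using hs⟩
      · rintro ⟨rs, hrs, hs⟩
        cases hrs with
        | @cons _ t _ rs ht hrs =>
          exact ⟨t, ht, (h I q _ (hr.snoc ht)).2 ⟨rs, hrs, by simpa using hs⟩⟩

/-- The table occurrences become a prefix of quantifiers. Below it, the output predicates stand next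
to the guarded condition, outside all negations. -/
theorem bcQueries_subset_trcQueries (n : ℕ) : bcQueries S D n ⊆ trcQueries S D n := by
  rintro f ⟨⟨Rs, φ, out⟩, hQ, rfl, hf⟩
  obtain ⟨hφ, hout⟩ := hQ
  obtain ⟨φ', hφ', hg, hs⟩ := BCFormula.exists_guarded hφ
  obtain ⟨ψ₁, hψ₁, hg₁, hs₁⟩ :=
    BCFormula.Guarded.exists_trc out.length hφ' (hg 0 (Nat.zero_le _))
  obtain ⟨ψ₂, hψ₂, hg₂, ho₂, hs₂⟩ := exists_trc_outputs (D := D) (n := out.length) hout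
    (i := 0) (by simp)
  obtain ⟨ψ, hψ, hg, ho, hs'⟩ := exists_trc_exs (ctx := []) (Rs := Rs) (ψ := .and ψ₁ ψ₂)
    ⟨hψ₁, hψ₂⟩ fun L hL => ⟨hg₁ L fun r _ hr => hL r hr, hg₂ L hL⟩
  refine ⟨ψ, by simpa using hψ, hg ∅ (by simp),
    fun i hi => ho i (.inr (by simpa using ho₂ i hi)), fun I => ?_⟩
  rw [← hf I]
  have henv : (fun _ => none) = trcEnv ([] : List Rel) ([] : List (List D)) := by
    ext1 r
    simp [trcEnv]
  ext q
  simp only [Set.mem_ofPred_eq, henv, hs' I q [] .nil, BCQuery.Yields]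
  constructor
  · rintro ⟨hl, rs, hrs, h₁, h₂⟩
    refine ⟨rs, hrs, ?_, (hs₂ I [] q _ rfl hl).1 h₂⟩
    exact (hs I _ hrs).1 ((hs₁ I q _ hrs).1 h₁)
  · rintro ⟨rs, hrs, h₁, h₂⟩
    have hl : q.length = out.length := h₂.length_eq.symm
    exact ⟨hl, rs, hrs, (hs₁ I q _ hrs).2 ((hs I _ hrs).2 h₁), (hs₂ I [] q _ rfl hl).2 h₂⟩

end TupleCalculus

/-! ## SQL and the block calculus -/

section SQL

variable {Rel Attr D : Type*} {S : DBSchema Rel Attr}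

/-- The innermost block with a match is unique, and so is the match in it. -/
theorem SQLCol.Resolves.unique {sctx : List (SQLBlock Rel)} {c : SQLCol Rel Attr}
    {i j i' j' : ℕ} {R R' : Rel} (h : c.Resolves S sctx i j R) (h' : c.Resolves S sctx i' j' R') :
    i = i' ∧ j = j' ∧ R = R' := by
  obtain ⟨b, T, hb, hj, hm, -, hu, hn⟩ := h
  obtain ⟨b', T', hb', hj', hm', -, hu', hn'⟩ := h'
  have hi : i = i' := by
    rcases lt_trichotomy i i' with hlt | heq | hlt
    · exact absurd hm (hn' i hlt b hb _ (List.mem_of_getElem? hj))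
    · exact heq
    · exact absurd hm' (hn i' hlt b' hb' _ (List.mem_of_getElem? hj'))
  subst hi
  rw [hb] at hb'
  cases hb'
  have hjj := hu j' _ hj' hm'
  subst hjj
  rw [hj] at hj'
  cases hj'
  exact ⟨rfl, rfl, rfl⟩

/-- A block without a match is transparent for name resolution. -/
theorem SQLCol.Resolves.cons {sctx : List (SQLBlock Rel)} {c : SQLCol Rel Attr} {i j : ℕ} {R : Rel}
    (h : c.Resolves S sctx i j R) {b : SQLBlock Rel} (hb : ∀ e ∈ b, ¬ c.Matches S e) :
    c.Resolves S (b :: sctx) (i + 1) j R := by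
  obtain ⟨b', T, hb', hj, hm, hA, hu, hn⟩ := h
  refine ⟨b', T, by simpa using hb', hj, hm, hA, hu, fun i' hi' b'' hb'' => ?_⟩
  cases i' with
  | zero =>
    cases hb''
    exact hb
  | succ i' => exact hn i' (by omega) b'' (by simpa using hb'')

/-! ### From the block calculus to SQL -/

/-- Table occurrence `r` of `ctx` is known as `Sum.inr r` and found at position `pos r` of the
blocks `sctx`; from number `b` on, it is found in one of the `g` innermost blocks. -/
structure SQLNaming (S : DBSchema Rel Attr) (ctx : List Rel) (sctx : List (SQLBlock Rel))
    (pos : ℕ → ℕ × ℕ) (b g : ℕ) : Prop where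
  resolves : ∀ r R A, ctx[r]? = some R → A ∈ S.attrs R →
    (⟨some (.inr r), A⟩ : SQLCol Rel Attr).Resolves S sctx (pos r).1 (pos r).2 R
  fresh : ∀ blk ∈ sctx, ∀ e ∈ blk, ∀ r, e.1 = .inr r → r < ctx.length
  isLocal : ∀ r, b ≤ r → r < ctx.length → (pos r).1 < g

/-- The rows of the blocks are those of the table occurrences. -/
def SQLEnvAt (ctx : List Rel) (pos : ℕ → ℕ × ℕ) (senv : List (List (List D)))
    (rows : List (List D)) : Prop :=
  ∀ r < ctx.length, (senv[(pos r).1]?.bind fun rs => rs[(pos r).2]?) = rows[r]?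

/-- What happens at a negation: names are kept, and nothing is local any more. -/
theorem SQLNaming.scope {ctx : List Rel} {sctx : List (SQLBlock Rel)} {pos : ℕ → ℕ × ℕ} {b g : ℕ}
    (h : SQLNaming S ctx sctx pos b g) : SQLNaming S ctx sctx pos ctx.length 0 :=
  ⟨h.resolves, h.fresh, fun r h₁ h₂ => by omega⟩

/-- The alias `Sum.inr ctx.length` differs from the names of the earlier occurrences, so their
columns resolve past the new block, one block further out. -/
theorem SQLNaming.snoc {ctx : List Rel} {sctx : List (SQLBlock Rel)} {pos : ℕ → ℕ × ℕ} {b g : ℕ}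
    (h : SQLNaming S ctx sctx pos b g) (R : Rel) :
    SQLNaming S (ctx ++ [R]) ([(.inr ctx.length, R)] :: sctx)
      (fun r => if r = ctx.length then (0, 0) else ((pos r).1 + 1, (pos r).2)) b (g + 1) := by
  refine ⟨fun r R' A hR' hA => ?_, fun blk hblk e he r hr => ?_, fun r h₁ h₂ => ?_⟩
  · by_cases hr : r = ctx.length
    · subst hr
      have hRR : R = R' := by simpa using hR'
      subst hRR
      rw [if_pos rfl]
      refine ⟨_, .inr ctx.length, rfl, rfl, rfl, hA, fun j' e he _ => ?_, by simp⟩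
      have := (List.getElem?_eq_some_iff.1 he).1
      simpa using this
    · have hlt : r < ctx.length := by
        have := (List.getElem?_eq_some_iff.1 hR').1
        rw [List.length_append, List.length_singleton] at this
        omega
      rw [List.getElem?_append_left hlt] at hR'
      rw [if_neg hr]
      refine (h.resolves r R' A hR' hA).cons fun e he hm => ?_
      rw [List.mem_singleton.1 he] at hm
      exact hr (Sum.inr_injective hm).symm
  · rw [List.length_append, List.length_singleton]
    rcases List.mem_cons.1 hblk with rfl | hblk
    · rw [List.mem_singleton.1 he] at hr
      have := Sum.inr_injective hr
      omega
    · exact (h.fresh blk hblk e he r hr).trans (Nat.lt_succ_self _)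
  · rw [List.length_append, List.length_singleton] at h₂
    by_cases hr : r = ctx.length
    · simp [hr]
    · simp only [if_neg hr]
      have := h.isLocal r h₁ (by omega)
      omega

theorem SQLEnvAt.snoc {ctx : List Rel} {pos : ℕ → ℕ × ℕ} {senv : List (List (List D))}
    {rows : List (List D)} (h : SQLEnvAt ctx pos senv rows) (hl : ctx.length = rows.length)
    (R : Rel) (t : List D) :
    SQLEnvAt (ctx ++ [R])
      (fun r => if r = ctx.length then (0, 0) else ((pos r).1 + 1, (pos r).2))
      ([t] :: senv) (rows ++ [t]) := by
  intro r hr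
  rw [List.length_append, List.length_singleton] at hr
  by_cases hrl : r = ctx.length
  · subst hrl
    simp [hl]
  · have hr' : r < ctx.length := by omega
    simp only [if_neg hrl, List.getElem?_cons_succ, h r hr']
    rw [List.getElem?_append_left (hl ▸ hr')]

theorem SQLNaming.exists_col {ctx : List Rel} {sctx : List (SQLBlock Rel)} {pos : ℕ → ℕ × ℕ}
    {b g : ℕ} (h : SQLNaming S ctx sctx pos b g) {c : ℕ × ℕ} (hc : ColIn S ctx c) :
    ∃ sc : SQLCol Rel Attr, sc.Bound S sctx ∧ (b ≤ c.1 → sc.Local S sctx g) ∧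
      ∀ (senv : List (List (List D))) (rows : List (List D)), SQLEnvAt ctx pos senv rows →
        ∀ v, sc.Val S sctx senv v ↔ colVal rows c = some v := by
  obtain ⟨r, k⟩ := c
  obtain ⟨R, hR, hlt⟩ := hc
  obtain ⟨A, hk, hA⟩ := DBSchema.exists_attr hlt
  have hr : r < ctx.length := (List.getElem?_eq_some_iff.1 hR).1
  have hres := h.resolves r R A hR hA
  refine ⟨⟨some (.inr r), A⟩, ⟨_, _, _, hres⟩, fun hb => ⟨_, _, _, h.isLocal r hb hr, hres⟩,
    fun senv rows he v => ?_⟩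
  have := he r hr
  constructor
  · rintro ⟨i, j, R', rs, t, hres', hrs, ht, hv⟩
    obtain ⟨rfl, rfl, rfl⟩ := hres.unique hres'
    rw [hrs, Option.bind_some, ht] at this
    simpa [colVal, ← this] using (DBSchema.attrVal_iff hk _ _).1 hv
  · intro hv
    obtain ⟨t, ht, hv⟩ := Option.bind_eq_some_iff.1 hv
    rw [show rows[r]? = some t from ht] at this
    obtain ⟨rs, hrs, hrt⟩ := Option.bind_eq_some_iff.1 this
    exact ⟨_, _, _, rs, t, hres, hrs, hrt, (DBSchema.attrVal_iff hk _ _).2 hv⟩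

/-! ### From SQL to the block calculus -/

/-- Table `j` of block `i` is the table occurrence number `lv i j` of `ctx`. -/
def SQLLevels (ctx : List Rel) (sctx : List (SQLBlock Rel)) (lv : ℕ → ℕ → ℕ) : Prop :=
  ∀ i blk j e, sctx[i]? = some blk → blk[j]? = some e → ctx[lv i j]? = some e.2

/-- The rows of the table occurrences are those of the blocks. -/
def SQLEnvOf (sctx : List (SQLBlock Rel)) (lv : ℕ → ℕ → ℕ) (senv : List (List (List D)))
    (rows : List (List D)) : Prop :=
  ∀ i blk j e, sctx[i]? = some blk → blk[j]? = some e →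
    (senv[i]?.bind fun rs => rs[j]?) = rows[lv i j]?

/-- The numbering after a new innermost block. -/
def pushLevels (d : ℕ) (lv : ℕ → ℕ → ℕ) : ℕ → ℕ → ℕ
  | 0, j => d + j
  | i + 1, j => lv i j

/-- SQL counts blocks from the inside and the calculus counts occurrences from the outside. A new
block therefore shifts the former indices, while old occurrences keep their numbers. -/
theorem SQLLevels.cons {ctx : List Rel} {sctx : List (SQLBlock Rel)} {lv : ℕ → ℕ → ℕ}
    (h : SQLLevels ctx sctx lv) (blk : SQLBlock Rel) :
    SQLLevels (ctx ++ blk.map Prod.snd) (blk :: sctx) (pushLevels ctx.length lv) := by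
  intro i blk' j e hb he
  cases i with
  | zero =>
    cases hb
    simp [pushLevels, List.getElem?_append_right, he]
  | succ i =>
    have := h i blk' j e (by simpa using hb) he
    rw [pushLevels, List.getElem?_append_left (List.getElem?_eq_some_iff.1 this).1, this]

theorem SQLEnvOf.cons {ctx : List Rel} {sctx : List (SQLBlock Rel)} {lv : ℕ → ℕ → ℕ}
    {senv : List (List (List D))} {rows rs : List (List D)} (hl : SQLLevels ctx sctx lv)
    (h : SQLEnvOf sctx lv senv rows) (hr : ctx.length = rows.length) (blk : SQLBlock Rel) :
    SQLEnvOf (blk :: sctx) (pushLevels ctx.length lv) (rs :: senv) (rows ++ rs) := by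
  intro i blk' j e hb he
  cases i with
  | zero => simp [pushLevels, hr, List.getElem?_append_right]
  | succ i =>
    have hb : sctx[i]? = some blk' := by simpa using hb
    have hlt := (List.getElem?_eq_some_iff.1 (hl i blk' j e hb he)).1
    rw [pushLevels, List.getElem?_append_left (hr ▸ hlt), ← h i blk' j e hb he]
    simp

/-- Name resolution depends on the query and not on the data, so a bound column denotes one fixed
column of the calculus. -/
theorem SQLCol.Bound.exists_col {ctx : List Rel} {sctx : List (SQLBlock Rel)} {lv : ℕ → ℕ → ℕ}
    (hl : SQLLevels ctx sctx lv) {sc : SQLCol Rel Attr} (h : sc.Bound S sctx) :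
    ∃ c, ColIn S ctx c ∧ ∀ (senv : List (List (List D))) (rows : List (List D)),
      SQLEnvOf sctx lv senv rows → ∀ v, sc.Val S sctx senv v ↔ colVal rows c = some v := by
  obtain ⟨i, j, R, hres⟩ := h
  obtain ⟨blk, T, hb, hj, -, hA, -⟩ := id hres
  obtain ⟨k, hk, hlt⟩ := DBSchema.exists_pos hA
  refine ⟨(lv i j, k), ⟨R, hl i blk j _ hb hj, hlt⟩, fun senv rows he v => ?_⟩
  have := he i blk j _ hb hj
  constructor
  · rintro ⟨i', j', R', rs, t, hres', hrs, ht, hv⟩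
    obtain ⟨rfl, rfl, rfl⟩ := hres.unique hres'
    rw [hrs, Option.bind_some, ht] at this
    simpa [colVal, ← this] using (DBSchema.attrVal_iff hk _ _).1 hv
  · intro hv
    obtain ⟨t, ht, hv⟩ := Option.bind_eq_some_iff.1 hv
    rw [show rows[lv i j]? = some t from ht] at this
    obtain ⟨rs, hrs, hrt⟩ := Option.bind_eq_some_iff.1 this
    exact ⟨i, j, R, rs, t, hres, hrs, hrt, (DBSchema.attrVal_iff hk _ _).2 hv⟩

/-- All columns of the last table occurrences. -/
theorem exists_allCols (S : DBSchema Rel Attr) (D : Type*) (ctx Rs : List Rel) :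
    ∃ out : List (ℕ × ℕ), (∀ c ∈ out, ColIn S (ctx ++ Rs) c) ∧ out.length = ctxArity S Rs ∧
      ∀ (I : Database S D) (rows rs : List (List D)), RowsOf I ctx rows → RowsOf I Rs rs →
        ColVals (rows ++ rs) out rs.flatten := by
  induction Rs using List.reverseRecOn with
  | nil =>
    refine ⟨[], by simp, rfl, fun I rows rs _ h => ?_⟩
    cases h
    exact .nil
  | append_singleton Rs R ih =>
    obtain ⟨out, ho, hl, h⟩ := ih
    refine ⟨out ++ (List.range (S.arity R)).map (Prod.mk (ctx ++ Rs).length), fun c hc => ?_,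
      by simp [hl, ctxArity_append, ctxArity_singleton], fun I rows rs hr hrs => ?_⟩
    · rw [← List.append_assoc]
      rcases List.mem_append.1 hc with hc | hc
      · exact (ho c hc).append_right _
      · obtain ⟨k, hk, rfl⟩ := List.mem_map.1 hc
        exact ColIn.snoc (List.mem_range.1 hk)
    · obtain ⟨rs, rs', hrs₁, hrs', rfl⟩ := hrs.of_append
      cases hrs' with
      | @cons _ t _ _ ht hn =>
        cases hn
        rw [← List.append_assoc, List.flatten_append, ColVals]
        refine List.rel_append ?_ ?_
        · exact (forall₂_congr_of_mem fun c hc v => by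
            rw [(hr.append hrs₁).colVal_append (ho c hc)]).2 (h I rows rs hr hrs₁)
        · rw [List.forall₂_map_left_iff, ← I.length_eq R t ht,
            show (ctx ++ Rs).length = (rows ++ rs).length from (hr.append hrs₁).length_eq]
          simpa [colVal] using forall₂_getElem?_range t []

theorem exists_colVals_of_bound {ctx : List Rel} {sctx : List (SQLBlock Rel)} {lv : ℕ → ℕ → ℕ}
    (hl : SQLLevels ctx sctx lv) {cs : List (SQLCol Rel Attr)} (h : ∀ c ∈ cs, c.Bound S sctx) :
    ∃ out : List (ℕ × ℕ), (∀ c ∈ out, ColIn S ctx c) ∧ out.length = cs.length ∧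
      ∀ (senv : List (List (List D))) (rows : List (List D)), SQLEnvOf sctx lv senv rows →
        ∀ u, List.Forall₂ (fun c v => c.Val S sctx senv v) cs u ↔ ColVals rows out u := by
  induction cs with
  | nil =>
    exact ⟨[], by simp, rfl, fun senv rows _ u => by simp [ColVals]⟩
  | cons c cs ih =>
    obtain ⟨out, ho, hlen, hv⟩ := ih fun c hc => h c (List.mem_cons_of_mem _ hc)
    obtain ⟨d, hd, hdv⟩ := (h c List.mem_cons_self).exists_col (D := D) hl
    refine ⟨d :: out, List.forall_mem_cons.2 ⟨hd, ho⟩, by simp [hlen],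
      fun senv rows he u => ?_⟩
    cases u with
    | nil => simp [ColVals]
    | cons v u => rw [ColVals, List.forall₂_cons, List.forall₂_cons, hdv senv rows he,
        hv senv rows he u, ColVals]

theorem SQLSelect.exists_out {ctx : List Rel} {sctx : List (SQLBlock Rel)} {lv : ℕ → ℕ → ℕ}
    (hl : SQLLevels ctx sctx lv) {s : SQLSelect Rel Attr} {fr : List (SQLFrom Rel)}
    (h : sqlHeadWF S sctx s fr) :
    ∃ out : List (ℕ × ℕ), (∀ c ∈ out, ColIn S (ctx ++ (sqlBlock fr).map Prod.snd) c) ∧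
      out.length = (SQLQuery.select s fr : SQLQuery Rel Attr D).outArity S ∧
      ∀ (I : Database S D) (senv : List (List (List D))) (rows rs : List (List D)),
        RowsOf I ctx rows → RowsOf I ((sqlBlock fr).map Prod.snd) rs →
        SQLEnvOf sctx lv senv rows → ∀ u,
        (s.Returns S (sqlBlock fr :: sctx) (rs :: senv) u ↔ ColVals (rows ++ rs) out u) := by
  obtain ⟨-, -, h⟩ := h
  cases s with
  | star =>
    obtain ⟨out, ho, hlen, hv⟩ := exists_allCols S D ctx ((sqlBlock fr).map Prod.snd)
    refine ⟨out, ho, ?_, fun I senv rows rs hr hrs _ u => ?_⟩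
    · simp [hlen, ctxArity, Function.comp_def, SQLQuery.outArity, SQLQuery.sel, SQLQuery.block]
    · have := hv I rows rs hr hrs
      constructor
      · rintro ⟨_, ⟨⟩, rfl⟩
        exact this
      · exact fun hu => ⟨rs, rfl, forall₂_eq_some_unique hu this⟩
  | cols cs =>
    obtain ⟨out, ho, hlen, hv⟩ := exists_colVals_of_bound (D := D) (hl.cons (sqlBlock fr)) h.2
    exact ⟨out, ho, hlen, fun I senv rows rs hr hrs he u =>
      hv _ _ (he.cons hl hr.length_eq _) u⟩

theorem SQLBlock.rows_iff {I : Database S D} {blk : SQLBlock Rel} {rs : List (List D)} :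
    blk.Rows I rs ↔ RowsOf I (blk.map Prod.snd) rs := by
  rw [RowsOf, List.forall₂_map_left_iff]
  rfl

variable [LinearOrder D]

/-- A quantifier becomes `EXISTS` over a block with one newly named table. The guard bound `b` of
the calculus and the scope size `g` of SQL are linked by `SQLNaming.isLocal`, and both are reset at
a negation. -/
theorem BCFormula.Guarded.exists_sql [Nonempty Rel] {φ : BCFormula Rel D} {ctx : List Rel}
    {b : ℕ} (hφ : φ.WF S ctx) (hg : φ.Guarded b ctx.length) {sctx : List (SQLBlock Rel)}
    {pos : ℕ → ℕ × ℕ} {g : ℕ} (h : SQLNaming S ctx sctx pos b g) :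
    ∃ P : SQLPred Rel Attr D, P.WF S sctx g ∧
      ∀ (I : Database S D) (rows : List (List D)) (senv : List (List (List D))),
        RowsOf I ctx rows → SQLEnvAt ctx pos senv rows →
        (P.Sat I sctx senv ↔ φ.Sat I rows) := by
  induction φ generalizing ctx b sctx pos g with
  | top =>
    obtain ⟨R⟩ := ‹Nonempty Rel›
    -- SQL has no constant for truth. No row of `R` can be found while `R` has no rows, and the
    -- negation of that is true whether or not `R` is empty.
    refine ⟨.not (.exist false (.selectWhere .star [⟨R, none⟩]
      (.exist true (.select .star [⟨R, none⟩])))), ?_, fun I rows senv _ _ => ?_⟩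
    · simp [SQLPred.WF, SQLQuery.WF, sqlHeadWF, sqlBlock]
    · simp only [SQLPred.Sat, SQLQuery.Yields, SQLSelect.Returns, Sat, iff_true]
      rintro ⟨u, rs, hrs, hn, -⟩
      exact hn ⟨_, rs, hrs, rs, rfl, rfl⟩
  | cmp c op t =>
    obtain ⟨sc, hb, hl, hv⟩ := h.exists_col (D := D) hφ.1
    cases t with
    | col c' =>
      obtain ⟨sc', hb', -, hv'⟩ := h.exists_col (D := D) (c := c') hφ.2
      refine ⟨.joinPred sc op sc', ?_, fun I rows senv _ he => ?_⟩
      · simp only [SQLPred.WF]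
        exact ⟨hb, hb', .inl (hl hg)⟩
      · simp only [SQLPred.Sat, Sat, BCTerm.val, hv senv rows he, hv' senv rows he]
    | const v =>
      refine ⟨.selPred sc op v, ?_, fun I rows senv _ he => ?_⟩
      · simp only [SQLPred.WF]
        exact hl hg
      · simp [SQLPred.Sat, Sat, BCTerm.val, hv senv rows he]
  | and φ ψ ih₁ ih₂ =>
    obtain ⟨P, hP, h₁⟩ := ih₁ hφ.1 hg.1 h
    obtain ⟨P', hP', h₂⟩ := ih₂ hφ.2 hg.2 h
    refine ⟨.and P P', ?_, fun I rows senv hr he => ?_⟩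
    · simp only [SQLPred.WF]
      exact ⟨hP, hP'⟩
    · simp only [SQLPred.Sat, Sat, h₁ I rows senv hr he, h₂ I rows senv hr he]
  | ex R φ ih =>
    obtain ⟨P, hP, hs⟩ := ih (b := b) hφ (by
      rw [List.length_append, List.length_singleton]
      exact hg) (h.snoc R)
    refine ⟨.exist false (.selectWhere .star [⟨R, some (.inr ctx.length)⟩] P), ?_,
      fun I rows senv hr he => ?_⟩
    · simp only [SQLPred.WF, SQLQuery.WF]
      exact ⟨by simp [sqlHeadWF, sqlBlock], hP⟩
    · simp only [SQLPred.Sat, SQLQuery.Yields, SQLSelect.Returns, Sat]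
      constructor
      · rintro ⟨u, rs, hrs, hsat, -⟩
        cases hrs with
        | @cons _ t _ _ ht hn =>
          cases hn
          exact ⟨t, ht, (hs I _ _ (hr.snoc ht) (he.snoc hr.length_eq R t)).1 hsat⟩
      · rintro ⟨t, ht, hsat⟩
        exact ⟨_, [t], .cons ht .nil, (hs I _ _ (hr.snoc ht) (he.snoc hr.length_eq R t)).2 hsat,
          _, rfl, rfl⟩
  | not φ ih =>
    obtain ⟨P, hP, hs⟩ := ih (ctx := ctx) hφ hg h.scope
    refine ⟨.not P, ?_, fun I rows senv hr he => ?_⟩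
    · simp only [SQLPred.WF]
      exact hP
    · simp only [SQLPred.Sat, Sat, hs I rows senv hr he]

/-- A Boolean block is a closed formula `P`, returned by `SELECT NOT (NOT (P))`. Otherwise an output
column guarantees a non-empty `FROM` clause, and the block is one SQL query with numbered aliases.
-/
theorem bcQueries_subset_sqlQueries [Nonempty Rel] (n : ℕ) :
    bcQueries S D n ⊆ sqlQueries S D n := by
  rintro f ⟨⟨Rs, φ, out⟩, ⟨hφ, hout⟩, hn, hf⟩
  dsimp only at hφ hout hn
  rw [List.nil_append] at hφ hout
  rcases Nat.eq_zero_or_pos n with rfl | hpos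
  · rw [List.length_eq_zero_iff] at hn
    subst hn
    obtain ⟨ψ, hψ, hg, hs⟩ := BCFormula.exists_guarded (ctx := []) (BCFormula.wf_exs.2 hφ)
    obtain ⟨P, hP, hs'⟩ := (hg 0 le_rfl).exists_sql hψ (sctx := []) (pos := fun _ => (0, 0))
      (g := 0) ⟨by simp, by simp, by simp⟩
    refine ⟨.notPred (.not P), ⟨hP, rfl⟩, fun I => ?_⟩
    rw [← hf I]
    ext u
    simp only [SQLMain.eval, SQLPred.Sat, hs' I [] [] .nil (fun r hr => by simp at hr),
      hs I [] .nil, BCFormula.sat_exs, BCQuery.Yields, Set.mem_ofPred_eq, not_not, ColVals,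
      List.forall₂_nil_left_iff]
    tauto
  · have hRs : Rs ≠ [] := by
      rintro rfl
      obtain ⟨c, hc⟩ := List.exists_mem_of_length_pos (hn ▸ hpos)
      obtain ⟨R, hR, -⟩ := hout c hc
      simp at hR
    obtain ⟨ψ, hψ, hg, hs⟩ := BCFormula.exists_guarded hφ
    set fr : List (SQLFrom Rel) := Rs.mapIdx fun i R => ⟨R, some (.inr i)⟩ with hfr
    have hblk : sqlBlock fr = Rs.mapIdx fun i R => (.inr i, R) := by
      exact List.ext_getElem (by simp [sqlBlock, hfr]) (by simp [sqlBlock, hfr])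
    have hget : ∀ (i : ℕ) (e : SQLIdent Rel × Rel), (sqlBlock fr)[i]? = some e →
        e.1 = .inr i ∧ i < Rs.length := by
      intro i e he
      rw [hblk, List.getElem?_mapIdx] at he
      obtain ⟨R, hR, rfl⟩ := Option.map_eq_some_iff.1 he
      exact ⟨rfl, (List.getElem?_eq_some_iff.1 hR).1⟩
    have hnam : SQLNaming S Rs [sqlBlock fr] (fun r => (0, r)) 0 1 := by
      refine ⟨fun r R A hR hA => ?_, fun blk hb e he r hr => ?_, by simp⟩
      · refine ⟨_, .inr r, rfl, ?_, rfl, hA, fun j' e he hm => ?_, by simp⟩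
        · rw [hblk, List.getElem?_mapIdx, hR]
          rfl
        · have hm : e.1 = .inr r := hm
          rw [(hget j' e he).1] at hm
          exact Sum.inr_injective hm
      · rw [List.mem_singleton.1 hb] at he
        obtain ⟨i, hi⟩ := List.mem_iff_getElem?.1 he
        obtain ⟨h₁, h₂⟩ := hget i e hi
        rw [hr] at h₁
        rwa [Sum.inr_injective h₁]
    obtain ⟨P, hP, hs'⟩ := (hg 0 (Nat.zero_le _)).exists_sql hψ hnam
    have hcol : ∀ c, ∃ sc : SQLCol Rel Attr, ColIn S Rs c → sc.Bound S [sqlBlock fr] ∧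
        ∀ (rows : List (List D)) (v : D), sc.Val S [sqlBlock fr] [rows] v ↔
          colVal rows c = some v := by
      intro c
      -- Provides a default for pairs that are not columns in scope.
      obtain ⟨c₀, hc₀⟩ := List.exists_mem_of_length_pos (hn ▸ hpos)
      by_cases hc : ColIn S Rs c
      · obtain ⟨sc, hb, -, hv⟩ := hnam.exists_col (D := D) hc
        exact ⟨sc, fun _ => ⟨hb, fun rows v => hv [rows] rows (fun r _ => by simp) v⟩⟩
      · obtain ⟨sc, -⟩ := hnam.exists_col (D := D) (hout c₀ hc₀)
        exact ⟨sc, fun h => absurd h hc⟩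
    choose sc hsc using hcol
    refine ⟨.query (.selectWhere (.cols (out.map sc)) fr P), ⟨?_, ?_⟩, fun I => ?_⟩
    · simp only [SQLQuery.WF]
      refine ⟨⟨by simpa [hfr] using hRs, ?_, ?_, ?_⟩, hP⟩
      · rw [List.nodup_iff_getElem?_ne_getElem?]
        intro i j hij hj
        rw [List.length_map] at hj
        rw [List.getElem?_map, List.getElem?_map, List.getElem?_eq_getElem hj,
          List.getElem?_eq_getElem (hij.trans hj)]
        have h₁ := (hget i _ (List.getElem?_eq_getElem (hij.trans hj))).1
        have h₂ := (hget j _ (List.getElem?_eq_getElem hj)).1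
        simp only [Option.map_some, h₁, h₂]
        intro he
        cases he
        omega
      · intro h
        rw [List.map_eq_nil_iff] at h
        subst h
        simp at hn
        omega
      · intro c hc
        obtain ⟨c', hc', rfl⟩ := List.mem_map.1 hc
        exact (hsc c' (hout c' hc')).1
    · simpa [SQLQuery.outArity, SQLQuery.sel] using hn
    · rw [← hf I]
      have hrows : ∀ rows, (sqlBlock fr).Rows I rows ↔ RowsOf I Rs rows := by
        intro rows
        have : Rs = (sqlBlock fr).map Prod.snd := by
          rw [hblk]
          exact List.ext_getElem (by simp) (by simp)
        rw [this, RowsOf, List.forall₂_map_left_iff]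
        rfl
      ext u
      simp only [SQLMain.eval, SQLQuery.Yields, SQLSelect.Returns, Set.mem_ofPred_eq, hrows,
        BCQuery.Yields, List.nil_append]
      refine exists_congr fun rows => and_congr_right fun hr => and_congr ?_ ?_
      · rw [hs' I rows [rows] hr fun r _ => by simp, hs I rows hr]
      · rw [List.forall₂_map_left_iff]
        exact forall₂_congr_of_mem fun c hc v => (hsc c (hout c hc)).2 rows v

-- Quantified subqueries and the translation of nested SQL

/-- The negation of a comparison operator. -/
def CmpOp.neg : CmpOp → CmpOp
  | .eq => .ne
  | .ne => .eq
  | .lt => .ge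
  | .le => .gt
  | .gt => .le
  | .ge => .lt

theorem CmpOp.neg_holds (op : CmpOp) (x y : D) : op.neg.Holds x y ↔ ¬ op.Holds x y := by
  cases op <;> simp [neg, Holds]

/-- The comparison moves into the condition of the subquery. This serves `ANY` directly and `ALL`
with the negated operator. -/
theorem BCQuery.exists_any {ctx : List Rel} {Q : BCQuery Rel D} (hQ : Q.WF S ctx)
    (hn : Q.out.length = 1) {c : ℕ × ℕ} (hc : ColIn S ctx c) (op : CmpOp) :
    ∃ φ : BCFormula Rel D, φ.WF S ctx ∧ ∀ (I : Database S D) (rows : List (List D)),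
      RowsOf I ctx rows → ∀ x, colVal rows c = some x →
        (φ.Sat I rows ↔ ∃ y, Q.Yields I rows [y] ∧ op.Holds x y) := by
  obtain ⟨Rs, ψ, out⟩ := Q
  obtain ⟨d, rfl⟩ := List.length_eq_one_iff.1 hn
  refine ⟨.exs Rs (.and ψ (.cmp c op (.col d))),
    BCFormula.wf_exs.2 ⟨hQ.1, hc.append_right _, hQ.2 d List.mem_cons_self⟩,
    fun I rows hr x hx => ?_⟩
  simp only [BCFormula.sat_exs, BCFormula.Sat, BCTerm.val, hr.colVal_append hc, hx, Yields,
    ColVals, List.forall₂_cons, List.forall₂_nil_left_iff, and_true, Option.some.injEq]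
  constructor
  · rintro ⟨rs, hrs, hs, _, y, rfl, hy, h⟩
    exact ⟨y, ⟨rs, hrs, hs, hy⟩, h⟩
  · rintro ⟨y, ⟨rs, hrs, hs, hy⟩, h⟩
    exact ⟨rs, hrs, hs, x, y, rfl, hy, h⟩

mutual

theorem SQLQuery.exists_bcQuery : ∀ (Q : SQLQuery Rel Attr D) {sctx : List (SQLBlock Rel)} {g : ℕ}
    {ctx : List Rel} {lv : ℕ → ℕ → ℕ}, Q.WF S sctx g → SQLLevels ctx sctx lv →
    ∃ B : BCQuery Rel D, B.WF S ctx ∧ B.out.length = Q.outArity S ∧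
      ∀ (I : Database S D) (senv : List (List (List D))) (rows : List (List D)),
        RowsOf I ctx rows → SQLEnvOf sctx lv senv rows →
        ∀ u, Q.Yields I sctx senv u ↔ B.Yields I rows u
  | .select s fr, sctx, g, ctx, lv, hQ, hl => by
    simp only [SQLQuery.WF] at hQ
    obtain ⟨out, ho, hlen, hv⟩ := SQLSelect.exists_out (D := D) hl hQ
    refine ⟨⟨(sqlBlock fr).map Prod.snd, .top, out⟩, ⟨trivial, ho⟩, hlen,
      fun I senv rows hr he u => ?_⟩
    simp only [SQLQuery.Yields, BCQuery.Yields, SQLBlock.rows_iff, BCFormula.Sat, true_and]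
    exact exists_congr fun rs => and_congr_right fun hrs => hv I senv rows rs hr hrs he u
  | .selectWhere s fr P, sctx, g, ctx, lv, hQ, hl => by
    simp only [SQLQuery.WF] at hQ
    obtain ⟨out, ho, hlen, hv⟩ := SQLSelect.exists_out (D := D) hl hQ.1
    obtain ⟨φ, hφ, hs⟩ := SQLPred.exists_bcFormula P hQ.2 (hl.cons (sqlBlock fr))
    refine ⟨⟨(sqlBlock fr).map Prod.snd, φ, out⟩, ⟨hφ, ho⟩, hlen,
      fun I senv rows hr he u => ?_⟩
    simp only [SQLQuery.Yields, BCQuery.Yields, SQLBlock.rows_iff]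
    exact exists_congr fun rs => and_congr_right fun hrs =>
      and_congr (hs I _ _ (hr.append hrs) (he.cons hl hr.length_eq _))
        (hv I senv rows rs hr hrs he u)

/-- Each kind of subquery reduces to existence of rows: a membership fixes the output of the
subquery, `ANY` compares it, and `ALL` denies a counterexample. -/
theorem SQLPred.exists_bcFormula : ∀ (P : SQLPred Rel Attr D) {sctx : List (SQLBlock Rel)} {g : ℕ}
    {ctx : List Rel} {lv : ℕ → ℕ → ℕ}, P.WF S sctx g → SQLLevels ctx sctx lv →
    ∃ φ : BCFormula Rel D, φ.WF S ctx ∧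
      ∀ (I : Database S D) (senv : List (List (List D))) (rows : List (List D)),
        RowsOf I ctx rows → SQLEnvOf sctx lv senv rows → (P.Sat I sctx senv ↔ φ.Sat I rows)
  | .and P P', sctx, g, ctx, lv, hP, hl => by
    simp only [SQLPred.WF] at hP
    obtain ⟨φ, hφ, h₁⟩ := SQLPred.exists_bcFormula P hP.1 hl
    obtain ⟨ψ, hψ, h₂⟩ := SQLPred.exists_bcFormula P' hP.2 hl
    refine ⟨.and φ ψ, ⟨hφ, hψ⟩, fun I senv rows hr he => ?_⟩
    simp only [SQLPred.Sat, BCFormula.Sat, h₁ I senv rows hr he, h₂ I senv rows hr he]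
  | .joinPred c op c', sctx, g, ctx, lv, hP, hl => by
    simp only [SQLPred.WF] at hP
    obtain ⟨d, hd, hv⟩ := hP.1.exists_col (D := D) hl
    obtain ⟨d', hd', hv'⟩ := hP.2.1.exists_col (D := D) hl
    refine ⟨.cmp d op (.col d'), ⟨hd, hd'⟩, fun I senv rows hr he => ?_⟩
    simp only [SQLPred.Sat, BCFormula.Sat, BCTerm.val, hv senv rows he, hv' senv rows he]
  | .selPred c op v, sctx, g, ctx, lv, hP, hl => by
    simp only [SQLPred.WF] at hP
    obtain ⟨i, j, R, -, hres⟩ := hP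
    obtain ⟨d, hd, hv⟩ := SQLCol.Bound.exists_col (D := D) hl ⟨i, j, R, hres⟩
    refine ⟨.cmp d op (.const v), ⟨hd, trivial⟩, fun I senv rows hr he => ?_⟩
    simp [SQLPred.Sat, BCFormula.Sat, BCTerm.val, hv senv rows he]
  | .not P, sctx, g, ctx, lv, hP, hl => by
    simp only [SQLPred.WF] at hP
    obtain ⟨φ, hφ, h⟩ := SQLPred.exists_bcFormula P hP hl
    refine ⟨.not φ, hφ, fun I senv rows hr he => ?_⟩
    simp only [SQLPred.Sat, BCFormula.Sat, h I senv rows hr he]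
  | .exist neg Q, sctx, g, ctx, lv, hP, hl => by
    simp only [SQLPred.WF] at hP
    obtain ⟨B, hB, -, h⟩ := SQLQuery.exists_bcQuery Q hP hl
    have hs : ∀ (I : Database S D) (senv : List (List (List D))) (rows : List (List D)),
        RowsOf I ctx rows → SQLEnvOf sctx lv senv rows →
        ((∃ u, Q.Yields I sctx senv u) ↔ (BCFormula.exs B.rels B.cond).Sat I rows) := by
      intro I senv rows hr he
      simp only [h I senv rows hr he, BCFormula.sat_exs, BCQuery.Yields]
      constructor
      · rintro ⟨u, rs, hrs, hs, -⟩
        exact ⟨rs, hrs, hs⟩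
      · rintro ⟨rs, hrs, hs⟩
        -- `EXISTS` asks for an output tuple and not just for rows; there is one because all output
        -- columns have values.
        obtain ⟨u, hu⟩ := (hr.append hrs).exists_colVals hB.2
        exact ⟨u, rs, hrs, hs, hu⟩
    cases neg with
    | false =>
      refine ⟨.exs B.rels B.cond, BCFormula.wf_exs.2 hB.1, fun I senv rows hr he => ?_⟩
      simp only [SQLPred.Sat, hs I senv rows hr he]
    | true =>
      refine ⟨.not (.exs B.rels B.cond), BCFormula.wf_exs.2 hB.1, fun I senv rows hr he => ?_⟩
      simp only [SQLPred.Sat, BCFormula.Sat, hs I senv rows hr he]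
  | .isIn c neg Q, sctx, g, ctx, lv, hP, hl => by
    simp only [SQLPred.WF] at hP
    obtain ⟨hc, hQ, hn, -⟩ := hP
    obtain ⟨d, hd, hv⟩ := hc.exists_col (D := D) hl
    obtain ⟨B, hB, -, h⟩ := SQLQuery.exists_bcQuery Q hQ hl
    obtain ⟨φ, hφ, hs⟩ := BCQuery.exists_mem hB (ts := [.col d]) (by simpa [BCTerm.WF] using hd)
    have hs' : ∀ (I : Database S D) (senv : List (List (List D))) (rows : List (List D)),
        RowsOf I ctx rows → SQLEnvOf sctx lv senv rows → ∀ x, colVal rows d = some x →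
        (Q.Yields I sctx senv [x] ↔ φ.Sat I rows) := by
      intro I senv rows hr he x hx
      rw [h I senv rows hr he, hs I rows [x] hr (.cons hx .nil)]
    cases neg with
    | false =>
      refine ⟨φ, hφ, fun I senv rows hr he => ?_⟩
      obtain ⟨x, hx⟩ := hr.colVal_eq_some hd
      simp [SQLPred.Sat, hv senv rows he, hx, hs' I senv rows hr he]
    | true =>
      refine ⟨.not φ, hφ, fun I senv rows hr he => ?_⟩
      -- The column has a value, so `NOT IN`, which asserts such a value outside the negation, is
      -- the plain negation of `IN`.
      obtain ⟨x, hx⟩ := hr.colVal_eq_some hd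
      simp [SQLPred.Sat, BCFormula.Sat, hv senv rows he, hx, hs' I senv rows hr he]
  | .all c op Q, sctx, g, ctx, lv, hP, hl => by
    simp only [SQLPred.WF] at hP
    obtain ⟨hc, hQ, hn, -⟩ := hP
    obtain ⟨d, hd, hv⟩ := hc.exists_col (D := D) hl
    obtain ⟨B, hB, hBn, h⟩ := SQLQuery.exists_bcQuery Q hQ hl
    -- `ALL` fails exactly if some result satisfies the negated comparison.
    obtain ⟨φ, hφ, hs⟩ := BCQuery.exists_any hB (hBn.trans hn) hd op.neg
    refine ⟨.not φ, hφ, fun I senv rows hr he => ?_⟩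
    obtain ⟨x, hx⟩ := hr.colVal_eq_some hd
    simp [SQLPred.Sat, BCFormula.Sat, hv senv rows he, hx, hs I rows hr x hx,
      h I senv rows hr he, CmpOp.neg_holds]
  | .any c op Q, sctx, g, ctx, lv, hP, hl => by
    simp only [SQLPred.WF] at hP
    obtain ⟨hc, hQ, hn, -⟩ := hP
    obtain ⟨d, hd, hv⟩ := hc.exists_col (D := D) hl
    obtain ⟨B, hB, hBn, h⟩ := SQLQuery.exists_bcQuery Q hQ hl
    obtain ⟨φ, hφ, hs⟩ := BCQuery.exists_any hB (hBn.trans hn) hd op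
    refine ⟨φ, hφ, fun I senv rows hr he => ?_⟩
    obtain ⟨x, hx⟩ := hr.colVal_eq_some hd
    simp [SQLPred.Sat, hv senv rows he, hx, hs I rows hr x hx, h I senv rows hr he]

end

theorem sqlQueries_subset_bcQueries (n : ℕ) : sqlQueries S D n ⊆ bcQueries S D n := by
  rintro f ⟨M, hM, hf⟩
  have hl : SQLLevels ([] : List Rel) [] (fun _ _ => 0) := by
    intro i blk j e hb
    simp at hb
  have he : SQLEnvOf ([] : List (SQLBlock Rel)) (fun _ _ => 0) ([] : List (List (List D))) [] := by
    intro i blk j e hb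
    simp at hb
  -- A closed formula is a block with no table occurrences and no output.
  have hformula : ∀ φ : BCFormula Rel D, φ.WF S [] →
      (∀ I, {u : List D | u = [] ∧ φ.Sat I []} = f I) → f ∈ bcQueries S D 0 := by
    intro φ hφ h
    refine ⟨⟨[], φ, []⟩, ⟨hφ, by simp⟩, rfl, fun I => ?_⟩
    rw [← h I]
    ext u
    simp [BCQuery.Yields, RowsOf, ColVals, and_comm]
  cases M with
  | query Q =>
    obtain ⟨B, hB, hBn, h⟩ := SQLQuery.exists_bcQuery Q hM.1 hl
    refine ⟨B, hB, hBn.trans hM.2, fun I => ?_⟩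
    rw [← hf I]
    ext u
    exact (h I [] [] .nil he u).symm
  | notPred P =>
    obtain ⟨hP, rfl⟩ := hM
    obtain ⟨φ, hφ, h⟩ := SQLPred.exists_bcFormula P hP hl
    refine hformula (.not φ) hφ fun I => ?_
    rw [← hf I]
    simp only [BCFormula.Sat, SQLMain.eval, h I [] [] .nil he]
  | exist neg Q =>
    obtain ⟨hQ, rfl⟩ := hM
    -- At the top level the scope is empty anyway, so the main query may be treated as a predicate,
    -- with or without negation.
    obtain ⟨φ, hφ, h⟩ := SQLPred.exists_bcFormula (.exist neg Q) (g := 0) (by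
      simp only [SQLPred.WF]
      simpa [scopeAfter] using hQ) hl
    refine hformula φ hφ fun I => ?_
    rw [← hf I]
    have := h I [] [] .nil he
    cases neg <;> simp only [← this, SQLMain.eval, SQLPred.Sat]

end SQL

/-- On every schema and every linearly ordered domain, the non-disjunctive fragments of Datalog,
relational algebra, tuple relational calculus and SQL express the same queries. For Boolean queries
(`n = 0`), where an algebra without constant relations returns nothing on the empty database, the
algebra catches up as soon as some fixed relation is not empty. -/
theorem mainTheorem2 {Rel : Type*} {Attr : Type*} {D : Type*} [Nonempty Rel] [Nonempty D]
    [LinearOrder D] (S : DBSchema Rel Attr) :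
    (∀ n : ℕ, 1 ≤ n →
      datalogQueries S D n = raQueries S D n ∧
      raQueries S D n = trcQueries S D n ∧
      trcQueries S D n = sqlQueries S D n) ∧
    (datalogQueries S D 0 = trcQueries S D 0 ∧
      trcQueries S D 0 = sqlQueries S D 0 ∧
      raQueries S D 0 ⊆ datalogQueries S D 0 ∧
      ∀ T : Rel, ∀ f ∈ datalogQueries S D 0, ∃ g ∈ raQueries S D 0,
        ∀ I : Database S D, (I.rel T).Nonempty → g I = f I) := by
  have hDL : ∀ n, datalogQueries S D n = bcQueries S D n := fun n =>
    (datalogQueries_subset_bcQueries n).antisymm (bcQueries_subset_datalogQueries n)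
  have hTRC : ∀ n, trcQueries S D n = bcQueries S D n := fun n =>
    (trcQueries_subset_bcQueries n).antisymm (bcQueries_subset_trcQueries n)
  have hSQL : ∀ n, sqlQueries S D n = bcQueries S D n := fun n =>
    (sqlQueries_subset_bcQueries n).antisymm (bcQueries_subset_sqlQueries n)
  -- The algebra reaches the block calculus by way of Datalog.
  have hRA : ∀ n, raQueries S D n ⊆ bcQueries S D n := fun n =>
    (raQueries_subset_datalogQueries n).trans (hDL n).le
  refine ⟨fun n hn => ?_, ?_⟩
  · have h : raQueries S D n = bcQueries S D n :=
      (hRA n).antisymm (bcQueries_subset_raQueries hn)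
    rw [hDL, hTRC, hSQL, h]
    exact ⟨rfl, rfl, rfl⟩
  · rw [hDL, hTRC, hSQL]
    exact ⟨rfl, rfl, hRA 0, fun T f hf => exists_raQueries_of_bcQueries T hf⟩
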